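/- **Setup.** Let $\hbar,\tau\in\mathbb C$ with $\tau\neq0$, put $q=e^{\sqrt{-1}\hbar}$ and $q^a=e^{\sqrt{-1}\hbar a}$ for $a\in\mathbb C$, and assume $q^k\ne1$ for all $k\ge1$. Let $\boldsymbol p=(p_k)_{k\ge1}$, $\bar{\boldsymbol p}=(\bar p_k)_{k\ge1}$ be two sequences of formal variables and $\mathcal P$ the set of all partitions. For $\nu\in\mathcal P$ let $l(\nu)$ be its length, $\kappa(\nu)=\sum_{i\ge1}\nu_i(\nu_i-2i+1)$ and $$S_\nu(\boldsymbol p)=\det\bigl(S_{\nu_i-i+j}(\boldsymbol p)\bigr)_{i,j=1}^{l(\nu)},\qquad \sum_{m\ge0}S_m(\boldsymbol p)z^m=\exp\Bigl(\sum_{k\ge1}\frac{p_k}{k}z^k\Bigr),\quad S_m=0\ (m<0).$$ Let $\mathcal W_{\nu\bar\nu}(q)=s_\nu(q^\rho)\,s_{\bar\nu}(q^{\nu+\rho})$ be the two-leg topological vertex, where $q^{\nu+\rho}=(q^{\nu_i-i+1/2})_{i\ge1}$, $q^\rho=q^{\emptyset+\rho}$, and $s_\mu(q^{\nu+\rho})$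 is $S_\mu$ evaluated at the power sums $$p_k(q^{\nu+\rho})=\sum_{i=1}^{l(\nu)}q^{k(\nu_i-i+1/2)}+\frac{q^{-k(l(\nu)+1/2)}}{1-q^{-k}},$$ so that $\mathcal W_{\nu\bar\nu}$ is a rational function of $q^{1/2}$ (for $|q|>1$ this is the convergent series $\sum_{i\ge1}q^{k(\nu_i-i+1/2)}$). Define $$R^\bullet(\tau,\boldsymbol p,\bar{\boldsymbol p})=\sum_{\nu,\bar\nu\in\mathcal P}q^{(\kappa(\nu)\tau+\kappa(\bar\nu)\tau^{-1})/2}\,\mathcal W_{\nu\bar\nu}(q)\,S_\nu(\boldsymbol p)\,S_{\bar\nu}(\bar{\boldsymbol p}).$$ Let $\psi_n,\psi^*_n$ $(n\in\mathbb Z)$ be the free fermions with $\psi_m\psi_n^*+\psi_n^*\psi_m=\delta_{m+n,0}$, all other anticommutators being zero, acting on the Fock space with orthonormal basis $|\mu,s\rangle=\psi_{-\mu_1-s}\psi_{-\mu_2+1-s}\cdots|{-\infty}\rangle$ $(\mu\in\mathcal P,\ s\in\mathbb Z)$, and let $|0\rangle=|\emptyset,0\rangle$. With ${:}\psi_{-m}\psi^*_n{:}=\psi_{-m}\psi_n^*-\langle0|\psi_{-m}\psi_n^*|0\rangle$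 put $$K=\sum_{n\in\mathbb Z}(n-\tfrac12)^2{:}\psi_{-n}\psi_n^*{:},\quad J_m=\sum_{n\in\mathbb Z}{:}\psi_{-n}\psi^*_{n+m}{:},\quad \Gamma_\pm(z)=\exp\Bigl(\sum_{k\ge1}\frac{z^k}{k}J_{\pm k}\Bigr),\quad \Gamma_\pm(q^{-\rho})=\prod_{i\ge1}\Gamma_\pm(q^{i-1/2}).$$ Operators are given by their matrix elements in the basis $|\mu,s\rangle$; infinite products converge in each matrix element, and $q^{aK}=\exp(\sqrt{-1}\hbar aK)$. **Theorem.** The sum defining $R^\bullet$ converges coefficientwise in $\mathbb C[[\boldsymbol p,\bar{\boldsymbol p}]]$. If $|q|<1$, the infinite products $\Gamma_\pm(q^{-\rho})$ converge and $$R^\bullet(\tau,\boldsymbol p,\bar{\boldsymbol p})=\Bigl\langle0\Bigr|\exp\Bigl(\sum_{k\ge1}\frac{(-1)^kp_k}{k}J_k\Bigr)\,h\,\exp\Bigl(\sum_{k\ge1}\frac{(-1)^k\bar p_k}{k}J_{-k}\Bigr)\Bigl|0\Bigr\rangle,$$ $$h=q^{(\tau+1)K/2}\,\Gamma_-(q^{-\rho})\,\Gamma_+(q^{-\rho})\,q^{(\tau^{-1}+1)K/2}.$$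 For every $q$ that is not a root of unity the same identity holds when $\Gamma_\pm(q^{-\rho})$ in $h$ is understood as its analytic continuation $\exp\Bigl(\sum_{k\ge1}\frac{q^{k/2}}{k(1-q^k)}J_{\pm k}\Bigr)$. -/

import Mathlib

open scoped MvPowerSeries.WithPiTopology Nat Topology

noncomputable section

namespace TwoPartition

/-! ## Fermions

A basis state `|μ,s⟩ = ψ_{-μ₁-s} ψ_{-μ₂+1-s} ⋯ |-∞⟩` is recorded by the set of its occupied levels
`n`, the factor `ψ_{-n}` standing for a particle at level `n`. The sets that occur (over all
partitions `μ` and all charges `s`) are the Maya diagrams. The factors are always written in the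
order of decreasing levels. -/

/-- Maya diagrams: sets of integers containing almost all `n ≤ 0` and almost no `n > 0`. -/
@[ext] structure Maya where
  occ : Set ℤ
  finite_particles : {n | n ∈ occ ∧ 0 < n}.Finite
  finite_holes : {n | n ∉ occ ∧ n ≤ 0}.Finite

/-- The vacuum `∅, s = 0`: the occupied levels are exactly the `n ≤ 0`. -/
def vac : Maya where
  occ := {n | n ≤ 0}
  finite_particles := by
    convert Set.finite_empty (α := ℤ)
    ext n; simp
  finite_holes := by
    convert Set.finite_empty (α := ℤ)
    ext n; simp

/-- Occupy level `n`. -/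
def Maya.add (S : Maya) (n : ℤ) : Maya where
  occ := insert n S.occ
  finite_particles := by
    refine (S.finite_particles.union (Set.finite_singleton n)).subset ?_
    rintro m ⟨h | h, h0⟩
    · exact Or.inr h
    · exact Or.inl ⟨h, h0⟩
  finite_holes := by
    refine S.finite_holes.subset ?_
    rintro m ⟨h, h0⟩
    exact ⟨fun h' => h (Or.inr h'), h0⟩

/-- Empty level `n`. -/
def Maya.remove (S : Maya) (n : ℤ) : Maya where
  occ := S.occ \ {n}
  finite_particles := S.finite_particles.subset fun _ h => ⟨h.1.1, h.2⟩
  finite_holes := by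
    refine (S.finite_holes.union (Set.finite_singleton n)).subset ?_
    rintro m ⟨h, h0⟩
    by_cases hm : m = n
    · exact Or.inr hm
    · exact Or.inl ⟨fun h' => h ⟨h', hm⟩, h0⟩

/-- The sign picked up when a fermion is moved past all occupied levels above `n`. -/
def Maya.sign (S : Maya) (n : ℤ) : ℂ := (-1) ^ {m | m ∈ S.occ ∧ n < m}.ncard

/-- The (ket) Fock space, with the states `|μ,s⟩` as a basis. The bra `⟨S|` is the coordinate
functional of `S`, so that the pairing of the two bases is orthonormal. -/
abbrev Fock := Maya →₀ ℂ

/-- The basis ket of a Maya diagram. -/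
def ket (S : Maya) : Fock := Finsupp.single S 1

open Classical in
/-- `ψ_m` creates a particle at level `-m`. -/
def psi (m : ℤ) : Fock →ₗ[ℂ] Fock :=
  Finsupp.linearCombination ℂ fun S : Maya =>
    if -m ∈ S.occ then 0 else S.sign (-m) • ket (S.add (-m))

open Classical in
/-- `ψ*_m` annihilates a particle at level `m`. -/
def psiStar (m : ℤ) : Fock →ₗ[ℂ] Fock :=
  Finsupp.linearCombination ℂ fun S : Maya =>
    if m ∈ S.occ then S.sign m • ket (S.remove m) else 0

/-- The normal ordered product
`:ψ_{-m} ψ*_n: = ψ_{-m} ψ*_n - ⟨0|ψ_{-m} ψ*_n|0⟩`. -/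
def normalOrdered (m n : ℤ) : Fock →ₗ[ℂ] Fock :=
  psi (-m) ∘ₗ psiStar n - (psi (-m) (psiStar n (ket vac)) vac) • LinearMap.id

/-! ## Operators as matrices

The operators below (infinite sums of bilinears, exponentials, ...) are given by their matrix
elements `M S T = ⟨S|M|T⟩` with entries in a commutative topological `ℂ`-algebra `B`. Products are
formed by inserting the partition of unity `1 = ∑_U |U⟩⟨U|`. -/

/-- Operators with matrix elements in `B`. -/
abbrev Op (B : Type*) := Matrix Maya Maya B

section Op

variable {B : Type*} [CommRing B] [Algebra ℂ B] [TopologicalSpace B]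

/-- `⟨S|MN|T⟩ = ∑_U ⟨S|M|U⟩ ⟨U|N|T⟩`. -/
def opMul (M N : Op B) : Op B := fun S T => ∑' U : Maya, M S U * N U T

open Classical in
/-- Powers of an operator. -/
def opPow (M : Op B) : ℕ → Op B
  | 0 => 1
  | j + 1 => opMul M (opPow M j)

/-- `exp M = ∑_j M^j / j!`. -/
def opExp (M : Op B) : Op B := fun S T => ∑' j : ℕ, (j ! : ℂ)⁻¹ • opPow M j S T

end Op

/-- `K = ∑_n (n - 1/2)² :ψ_{-n} ψ*_n:`. For given `S`, `T` only finitely many terms are nonzero. -/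
def K : Op ℂ := fun S T => ∑ᶠ n : ℤ, ((n : ℂ) - 1 / 2) ^ 2 * normalOrdered n n (ket T) S

/-- `J_m = ∑_n :ψ_{-n} ψ*_{n+m}:`. For given `S`, `T` only finitely many terms are nonzero. -/
def J (m : ℤ) : Op ℂ := fun S T => ∑ᶠ n : ℤ, normalOrdered n (n + m) (ket T) S

/-- `exp (∑_{k ≥ 1} t_k J_{εk})` for a sign `ε = ±1`. -/
def currentExp {B : Type*} [CommRing B] [Algebra ℂ B] [TopologicalSpace B]
    (ε : ℤˣ) (t : ℕ+ → B) : Op B :=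
  opExp fun S T => ∑' k : ℕ+, J ((ε : ℤ) * (k : ℤ)) S T • t k

/-- The vertex operators `Γ_±(z) = exp (∑_{k ≥ 1} (z^k / k) J_{±k})`. -/
def Gamma (ε : ℤˣ) (z : ℂ) : Op ℂ := currentExp ε fun k => z ^ (k : ℕ) / (k : ℂ)

open Classical in
/-- `Γ_±(x₁) ⋯ Γ_±(x_N)`; the sequence `x₁, x₂, …` is `x 0, x 1, …`. -/
def gammaPartial (ε : ℤˣ) (x : ℕ → ℂ) : ℕ → Op ℂ
  | 0 => 1
  | N + 1 => opMul (gammaPartial ε x N) (Gamma ε (x N))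

/-- The infinite product `∏_{i ≥ 1} Γ_±(x_i)` converges (in all matrix elements) to `G`. -/
def IsGammaProd (ε : ℤˣ) (x : ℕ → ℂ) (G : Op ℂ) : Prop :=
  ∀ S T, Filter.Tendsto (fun N => gammaPartial ε x N S T) Filter.atTop (𝓝 (G S T))

/-- `Γ_±(x) = ∏_{i ≥ 1} Γ_±(x_i)`. -/
def GammaSeq (ε : ℤˣ) (x : ℕ → ℂ) : Op ℂ :=
  fun S T => Filter.limUnder Filter.atTop fun N => gammaPartial ε x N S T

/-! ## Partitions and Schur functions

Partitions are Young diagrams; `μ_i` is `μ.rowLen (i - 1)`, and `μ.colLen 0` is the length. -/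

/-- `κ(ν) = ∑_{i ≥ 1} ν_i (ν_i - 2i + 1)`. -/
def kappa (ν : YoungDiagram) : ℤ :=
  ∑ i ∈ Finset.range (ν.colLen 0), (ν.rowLen i : ℤ) * ((ν.rowLen i : ℤ) - 2 * ((i : ℤ) + 1) + 1)

section Schur

variable {B : Type*} [CommRing B] [Algebra ℂ B]

/-- The series `∑_{k ≥ 1} (p_k / k) z^k` in `z`. -/
def powerSumSeries (p : ℕ+ → B) : PowerSeries B :=
  PowerSeries.mk fun k => if hk : 0 < k then (k : ℂ)⁻¹ • p ⟨k, hk⟩ else 0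

/-- `∑_{m ≥ 0} S_m(p) z^m = exp (∑_{k ≥ 1} (p_k / k) z^k)`, and `S_m = 0` for `m < 0`. -/
def schurOne (p : ℕ+ → B) (m : ℤ) : B :=
  if 0 ≤ m then
    PowerSeries.coeff m.toNat ((PowerSeries.exp ℂ).subst (powerSumSeries p) : PowerSeries B)
  else 0

/-- `S_μ(p) = det (S_{μ_i - i + j}(p))`, of size the length of `μ`. -/
def schur (μ : YoungDiagram) (p : ℕ+ → B) : B :=
  Matrix.det fun i j : Fin (μ.colLen 0) =>
    schurOne p ((μ.rowLen i : ℤ) - (i : ℤ) + (j : ℤ))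

end Schur

/-! ## The two-leg topological vertex -/

/-- `q^a` for `q = e^{√-1 ħ}`. -/
def qpow (ħ a : ℂ) : ℂ := Complex.exp (Complex.I * ħ * a)

/-- The power sum `p_k(q^{ν+ρ})`, where `q^{ν+ρ} = (q^{ν_i - i + 1/2})_{i ≥ 1}`, as a rational
function of `q^{1/2}`: the geometric series of the terms `i > l(ν)` is summed. -/
def powerSumRho (ħ : ℂ) (ν : YoungDiagram) (k : ℕ+) : ℂ :=
  ∑ i ∈ Finset.range (ν.colLen 0),
      qpow ħ ((ν.rowLen i : ℂ) - ((i : ℂ) + 1) + 1 / 2) ^ (k : ℕ)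
    + qpow ħ (-(ν.colLen 0 : ℂ) - 1 / 2) ^ (k : ℕ) / (1 - qpow ħ (-1) ^ (k : ℕ))

/-- In the region `|q| > 1` where the series converges, `powerSumRho` is the power sum of the
sequence `q^{ν+ρ}`. -/
theorem hasSum_powerSumRho (ħ : ℂ) (hq : 1 < ‖qpow ħ 1‖) (ν : YoungDiagram) (k : ℕ+) :
    HasSum (fun i : ℕ => qpow ħ ((ν.rowLen i : ℂ) - ((i : ℂ) + 1) + 1 / 2) ^ (k : ℕ))
      (powerSumRho ħ ν k) := by
  have hadd : ∀ a b, qpow ħ (a + b) = qpow ħ a * qpow ħ b := fun a b => by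
    simp only [qpow, mul_add, Complex.exp_add]
  have hneg : ‖qpow ħ (-1) ^ (k : ℕ)‖ < 1 := by
    have h1 : qpow ħ (-1) = (qpow ħ 1)⁻¹ := by
      simp only [qpow, mul_neg, Complex.exp_neg]
    rw [h1, norm_pow, norm_inv]
    exact pow_lt_one₀ (by positivity) (inv_lt_one_of_one_lt₀ hq) k.ne_zero
  have hnat : ∀ n : ℕ, qpow ħ (-(n : ℂ)) = qpow ħ (-1) ^ n := fun n => by
    simp only [qpow, ← Complex.exp_nat_mul]
    congr 1; ring
  have key : HasSum (fun i : ℕ => qpow ħ ((ν.rowLen (i + ν.colLen 0) : ℂ)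
      - (((i + ν.colLen 0 : ℕ) : ℂ) + 1) + 1 / 2) ^ (k : ℕ))
      (qpow ħ (-(ν.colLen 0 : ℂ) - 1 / 2) ^ (k : ℕ) / (1 - qpow ħ (-1) ^ (k : ℕ))) := by
    have hg := (hasSum_geometric_of_norm_lt_one hneg).mul_left
      (qpow ħ (-(ν.colLen 0 : ℂ) - 1 / 2) ^ (k : ℕ))
    rw [← div_eq_mul_inv] at hg
    refine hg.congr_fun ?_
    intro i
    have hz : ν.rowLen (i + ν.colLen 0) = 0 := by
      by_contra h
      have h1 : (i + ν.colLen 0, 0) ∈ ν := by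
        rw [YoungDiagram.mem_iff_lt_rowLen]; omega
      rw [YoungDiagram.mem_iff_lt_colLen] at h1
      omega
    rw [hz, ← pow_mul, mul_comm (k : ℕ) i, pow_mul, ← mul_pow, ← hnat, ← hadd]
    congr 2
    push_cast; ring
  have := (hasSum_nat_add_iff (f := fun i : ℕ =>
    qpow ħ ((ν.rowLen i : ℂ) - ((i : ℂ) + 1) + 1 / 2) ^ (k : ℕ)) (ν.colLen 0)).1 key
  rw [add_comm] at this
  exact this

/-- `𝓦_{ν ν̄}(q) = s_ν(q^ρ) s_ν̄(q^{ν+ρ})`, as a rational function of `q^{1/2}`. -/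
def vertexW (ħ : ℂ) (ν ν' : YoungDiagram) : ℂ :=
  schur ν (powerSumRho ħ ⊥) * schur ν' (powerSumRho ħ ν)

/-! ## The generating function and the vacuum expectation value -/

/-- Formal power series in the variables `p₁, p₂, …` and `p̄₁, p̄₂, …`, with the topology of
coefficientwise convergence. -/
abbrev Series := MvPowerSeries (ℕ+ ⊕ ℕ+) ℂ

/-- The variables `p_k`. -/
def pVar (k : ℕ+) : Series := MvPowerSeries.X (Sum.inl k)

/-- The variables `p̄_k`. -/
def pBarVar (k : ℕ+) : Series := MvPowerSeries.X (Sum.inr k)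

/-- `q^{(κ(ν)τ + κ(ν̄)τ⁻¹)/2} 𝓦_{ν ν̄}(q) S_ν(p) S_ν̄(p̄)`. -/
def rTerm (τ ħ : ℂ) (ν : YoungDiagram × YoungDiagram) : Series :=
  (qpow ħ (((kappa ν.1 : ℂ) * τ + (kappa ν.2 : ℂ) * τ⁻¹) / 2) * vertexW ħ ν.1 ν.2) •
    (schur ν.1 pVar * schur ν.2 pBarVar)

/-- `R^•(τ, p, p̄)`. -/
def RBullet (τ ħ : ℂ) : Series := ∑' ν : YoungDiagram × YoungDiagram, rTerm τ ħ ν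

/-- `q^{aK} = exp (a K log q)`, with `log q = √-1 ħ`. -/
def qK (ħ a : ℂ) : Op ℂ := opExp ((Complex.I * ħ * a) • K)

/-- `q^{-ρ} = (q^{i - 1/2})_{i ≥ 1}`. -/
def qNegRho (ħ : ℂ) (i : ℕ) : ℂ := qpow ħ (((i : ℂ) + 1) - 1 / 2)

/-- `q^{(τ+1)K/2} Γ₋ Γ₊ q^{(τ⁻¹+1)K/2}` for given operators `Γ₋ = Gm` and `Γ₊ = Gp`. -/
def hWith (τ ħ : ℂ) (Gm Gp : Op ℂ) : Op ℂ :=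
  opMul (opMul (opMul (qK ħ ((τ + 1) / 2)) Gm) Gp) (qK ħ ((τ⁻¹ + 1) / 2))

/-- `h = q^{(τ+1)K/2} Γ₋(q^{-ρ}) Γ₊(q^{-ρ}) q^{(τ⁻¹+1)K/2}`. -/
def hOp (τ ħ : ℂ) : Op ℂ :=
  hWith τ ħ (GammaSeq (-1) (qNegRho ħ)) (GammaSeq 1 (qNegRho ħ))

/-- The analytic continuation of `Γ_±(q^{-ρ})` in `q`, namely
`exp (∑_{k ≥ 1} q^{k/2} / (k (1 - q^k)) J_{±k})`. -/
def GammaRhoCont (ε : ℤˣ) (ħ : ℂ) : Op ℂ :=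
  currentExp ε fun k : ℕ+ => qpow ħ ((k : ℂ) / 2) / ((k : ℂ) * (1 - qpow ħ (k : ℂ)))

/-- The operator `h` with `Γ_±(q^{-ρ})` replaced by their analytic continuations. -/
def hCont (τ ħ : ℂ) : Op ℂ := hWith τ ħ (GammaRhoCont (-1) ħ) (GammaRhoCont 1 ħ)

/-- `⟨0| exp (∑_k (-1)^k p_k J_k / k) h exp (∑_k (-1)^k p̄_k J_{-k} / k) |0⟩`. -/
def vev (h : Op ℂ) : Series :=
  opMul
    (opMul (currentExp 1 fun k : ℕ+ => (((-1) ^ (k : ℕ) : ℂ) / (k : ℂ)) • pVar k)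
      (h.map (algebraMap ℂ Series)))
    (currentExp (-1) fun k : ℕ+ => (((-1) ^ (k : ℕ) : ℂ) / (k : ℂ)) • pBarVar k)
    vac vac

end TwoPartition

end

/-!
The state `|ν,0⟩` is the semi-infinite wedge of the one-particle states at the levels `ν_i - i + 1`,
and `exp (∑ t_k J_k)` acts on a wedge factorwise, by convolving each one-particle state with the
complete symmetric functions `h_m` of the power sums `p_k = k t_k` (`currentExpEnd_wedge`). As a
consequence, all matrix elements are determinants. The ones between the vacuum and `|ν,0⟩` are
Jacobi–Trudi determinants: after the signs `(-1)^k`, which produce `(-1)^{|ν|}`, the two outer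
exponentials of the theorem have the coordinates `(-1)^{|ν|} S_ν` (`currentExpEnd_toMaya_vac`).
The operator `K` is diagonal with eigenvalue `κ(ν)` on `|ν,0⟩`. So the right-hand side is
`∑ (-1)^{|ν|+|ν̄|} ⟨ν|h|ν̄⟩ S_ν(p) S_ν̄(p̄)` (`vev_eq_tsum`), and the theorem amounts to the formula
`𝓦_{νν̄} = (-1)^{|ν|+|ν̄|} q^{(κ(ν)+κ(ν̄))/2} ⟨ν|Γ₋Γ₊|ν̄⟩` for the vertex (`vertexW_eq`).

The matrix of `exp (∑ t_k J_{-k})` is the transpose of that of `exp (∑ t_k J_k)`; hence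
`⟨ν|Γ₋Γ₊|ν̄⟩` is the bilinear pairing `gram` of `Γ₊|ν⟩` with `Γ₊|ν̄⟩`, and the pairing of two wedges
is the determinant of the pairings of their factors (`pairing_wedge`, the Cauchy–Binet formula).
The entries are the sums `hookGram ħ a b = ∑_u h_{a-u} h_{b-u}` with `h_m = h_m(q^{-ρ})`. By
the `q`-difference equation of the generating function of the `h_m`, these sums are, up to
explicit factors, the coefficients of the series `hookSeries`, the generating function of the
complete functions of `q^ρ` with the one extra variable `q^{a+1/2}` (`coeff_hookSeries`). On the
other hand, by the bialternant argument the Jacobi–Trudi matrix of `s_ν(q^{μ+ρ})`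
times a matrix independent of `ν` has these coefficients as its entries, up to powers of `q`
depending only on the row (`schur_mul_det`). Comparing `ν` with the empty partition, for which `s_ν = 1`, gives the formula for the vertex.

The sum defining `R^•` converges because `S_ν(p)` is homogeneous of weight `|ν|`, so that only
finitely many terms contribute to a given monomial. If `|q| < 1`, the partial products of
`Γ_±(q^{-ρ})` are exponentials of currents again (`gammaPartial_eq`), with coefficients that are
partial sums of geometric series, and each matrix element of `exp (∑ t_k J_{±k})` is a polynomial in
finitely many `t_k` (`continuous_currentExp`); so they converge to the analytic continuation.
-/

noncomputable section

namespace TwoPartition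

/-! ### Free fermions over a commutative ring -/

namespace Maya

theorem finite_above (S : Maya) (n : ℤ) : {m | m ∈ S.occ ∧ n < m}.Finite := by
  refine (S.finite_particles.union (Set.finite_Ioc n 0)).subset ?_
  rintro m ⟨h, h'⟩
  by_cases h0 : 0 < m
  · exact Or.inl ⟨h, h0⟩
  · exact Or.inr ⟨h', not_lt.1 h0⟩

@[simp] theorem mem_add {S : Maya} {n m : ℤ} : m ∈ (S.add n).occ ↔ m = n ∨ m ∈ S.occ := Iff.rfl

@[simp] theorem mem_remove {S : Maya} {n m : ℤ} :
    m ∈ (S.remove n).occ ↔ m ∈ S.occ ∧ m ≠ n := Iff.rfl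

theorem eq_of_mem_iff {S T : Maya} (h : ∀ n, n ∈ S.occ ↔ n ∈ T.occ) : S = T :=
  Maya.ext (Set.ext h)

theorem add_remove {S : Maya} {n : ℤ} (h : n ∈ S.occ) : (S.remove n).add n = S := by
  refine eq_of_mem_iff fun m => ?_
  by_cases hm : m = n <;> simp [hm, h]

theorem remove_add {S : Maya} {n : ℤ} (h : n ∉ S.occ) : (S.add n).remove n = S := by
  refine eq_of_mem_iff fun m => ?_
  by_cases hm : m = n <;> simp [hm, h]

theorem add_comm' (S : Maya) (m n : ℤ) : (S.add m).add n = (S.add n).add m := by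
  refine eq_of_mem_iff fun a => ?_
  simp only [mem_add]; tauto

theorem add_remove_comm (S : Maya) {m n : ℤ} (h : m ≠ n) :
    (S.add m).remove n = (S.remove n).add m := by
  refine eq_of_mem_iff fun a => ?_
  simp only [mem_add, mem_remove]
  by_cases ha : a = m
  · subst ha; simp [h]
  · simp [ha]

theorem eq_remove_iff {S T : Maya} {n : ℤ} (h : n ∉ T.occ) (h' : n ∈ S.occ) :
    T.add n = S ↔ T = S.remove n :=
  ⟨fun e => by rw [← e, remove_add h], fun e => by rw [e, add_remove h']⟩

end Maya

variable {B : Type*} [CommRing B]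

/-- `Maya.sign` with values in an arbitrary commutative ring. -/
def signOver (B : Type*) [CommRing B] (S : Maya) (n : ℤ) : B :=
  (-1) ^ {m | m ∈ S.occ ∧ n < m}.ncard

theorem signOver_add_of_lt {S : Maya} {n m : ℤ} (h : n ∉ S.occ) (hm : m < n) :
    signOver B (S.add n) m = -signOver B S m := by
  have : {a | a ∈ (S.add n).occ ∧ m < a} = insert n {a | a ∈ S.occ ∧ m < a} := by
    ext a
    simp only [Maya.mem_add, Set.mem_ofPred_eq, Set.mem_insert_iff]
    constructor
    · rintro ⟨rfl | h1, h2⟩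
      · exact Or.inl rfl
      · exact Or.inr ⟨h1, h2⟩
    · rintro (rfl | ⟨h1, h2⟩)
      · exact ⟨Or.inl rfl, hm⟩
      · exact ⟨Or.inr h1, h2⟩
  rw [signOver, this, Set.ncard_insert_of_notMem (fun hn => h hn.1) (S.finite_above m), pow_succ,
    signOver]
  ring

theorem signOver_add_of_le {S : Maya} {n m : ℤ} (hm : n ≤ m) :
    signOver B (S.add n) m = signOver B S m := by
  have : {a | a ∈ (S.add n).occ ∧ m < a} = {a | a ∈ S.occ ∧ m < a} := by
    ext a
    simp only [Maya.mem_add, Set.mem_ofPred_eq]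
    constructor
    · rintro ⟨rfl | h1, h2⟩
      · exact absurd h2 (not_lt.2 hm)
      · exact ⟨h1, h2⟩
    · rintro ⟨h1, h2⟩
      exact ⟨Or.inr h1, h2⟩
  rw [signOver, this, signOver]

theorem signOver_remove_of_lt {S : Maya} {n m : ℤ} (h : n ∈ S.occ) (hm : m < n) :
    signOver B (S.remove n) m = -signOver B S m := by
  have := signOver_add_of_lt (B := B) (S := S.remove n) (n := n) (by simp) hm
  rw [Maya.add_remove h] at this
  rw [this, neg_neg]

theorem signOver_remove_of_le {S : Maya} {n m : ℤ} (h : n ∈ S.occ) (hm : n ≤ m) :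
    signOver B (S.remove n) m = signOver B S m := by
  have := signOver_add_of_le (B := B) (S := S.remove n) hm
  rwa [Maya.add_remove h, eq_comm] at this

theorem signOver_mul_self (S : Maya) (n : ℤ) : signOver B S n * signOver B S n = 1 := by
  rw [signOver, ← mul_pow]; simp

/-- The Fock space with coefficients in `B`. -/
abbrev FockOver (B : Type*) [CommRing B] := Maya →₀ B

/-- The basis ket of a Maya diagram, over `B`. -/
abbrev ketOver (B : Type*) [CommRing B] (S : Maya) : FockOver B := Finsupp.single S 1

open Classical in
/-- Creation of a particle at level `n`: the operator `ψ_{-n}`, over `B`. -/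
def create (n : ℤ) : Module.End B (FockOver B) :=
  Finsupp.linearCombination B fun S : Maya =>
    if n ∈ S.occ then 0 else signOver B S n • ketOver B (S.add n)

open Classical in
/-- Annihilation of a particle at level `n`: the operator `ψ*_n`, over `B`. -/
def annihilate (n : ℤ) : Module.End B (FockOver B) :=
  Finsupp.linearCombination B fun S : Maya =>
    if n ∈ S.occ then signOver B S n • ketOver B (S.remove n) else 0

theorem create_ket_of_mem {S : Maya} {n : ℤ} (h : n ∈ S.occ) : create n (ketOver B S) = 0 := by
  simp [create, h]

theorem create_ket {S : Maya} {n : ℤ} (h : n ∉ S.occ) :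
    create n (ketOver B S) = signOver B S n • ketOver B (S.add n) := by
  simp [create, h]

theorem annihilate_ket {S : Maya} {n : ℤ} (h : n ∈ S.occ) :
    annihilate n (ketOver B S) = signOver B S n • ketOver B (S.remove n) := by
  simp [annihilate, h]

theorem annihilate_ket_of_notMem {S : Maya} {n : ℤ} (h : n ∉ S.occ) :
    annihilate n (ketOver B S) = 0 := by
  simp [annihilate, h]

/-- Linear maps on the Fock space agree if they agree on the kets. -/
theorem fock_hom_ext {M : Type*} [AddCommMonoid M] [Module B M] {f g : FockOver B →ₗ[B] M}
    (h : ∀ S, f (ketOver B S) = g (ketOver B S)) : f = g :=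
  Finsupp.lhom_ext' fun S => LinearMap.ext_ring (h S)

theorem create_create (m n : ℤ) :
    create m * create n = -(create n * create m : Module.End B (FockOver B)) := by
  refine fock_hom_ext fun S => ?_
  simp only [Module.End.mul_apply, LinearMap.neg_apply]
  -- the levels `m`, `n` enter symmetrically
  have key : ∀ m n : ℤ, m < n → create m (create n (ketOver B S))
      = -create n (create m (ketOver B S)) := fun m n hmn => by
    by_cases hn : n ∈ S.occ
    · rw [create_ket_of_mem hn, map_zero]
      by_cases hm : m ∈ S.occ
      · rw [create_ket_of_mem hm, map_zero, neg_zero]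
      · rw [create_ket hm, map_smul, create_ket_of_mem (by simp [hn]), smul_zero, neg_zero]
    · by_cases hm : m ∈ S.occ
      · rw [create_ket_of_mem hm, map_zero, create_ket hn, map_smul,
          create_ket_of_mem (by simp [hm]), smul_zero, neg_zero]
      · rw [create_ket hn, create_ket hm, map_smul, map_smul,
          create_ket (by simp [hm, hmn.ne]), create_ket (by simp [hn, hmn.ne']),
          signOver_add_of_lt hn hmn, signOver_add_of_le hmn.le, Maya.add_comm' S n m, smul_smul,
          smul_smul, ← neg_smul]
        congr 1; ring
  rcases lt_trichotomy m n with h | h | h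
  · exact key m n h
  · subst h
    by_cases hm : m ∈ S.occ
    · rw [create_ket_of_mem hm, map_zero, neg_zero]
    · rw [create_ket hm, map_smul, create_ket_of_mem (by simp), smul_zero, neg_zero]
  · rw [key n m h, neg_neg]

theorem annihilate_create (m n : ℤ) :
    annihilate m * create n =
      ((if m = n then 1 else 0) - create n * annihilate m : Module.End B (FockOver B)) := by
  refine fock_hom_ext fun S => ?_
  rw [LinearMap.sub_apply, Module.End.mul_apply, Module.End.mul_apply]
  rcases eq_or_ne m n with rfl | hmn
  · rw [if_pos rfl]
    by_cases hm : m ∈ S.occ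
    · rw [create_ket_of_mem hm, map_zero, annihilate_ket hm, map_smul,
        create_ket (by simp), Maya.add_remove hm, signOver_remove_of_le hm le_rfl, smul_smul,
        signOver_mul_self, one_smul, Module.End.one_apply, sub_self]
    · rw [annihilate_ket_of_notMem hm, map_zero, sub_zero, create_ket hm, map_smul,
        annihilate_ket (by simp), Maya.remove_add hm, signOver_add_of_le le_rfl, smul_smul,
        signOver_mul_self, one_smul, Module.End.one_apply]
  · rw [if_neg hmn, LinearMap.zero_apply, zero_sub]
    by_cases hm : m ∈ S.occ
    · by_cases hn : n ∈ S.occ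
      · rw [create_ket_of_mem hn, map_zero, annihilate_ket hm, map_smul,
          create_ket_of_mem (by simp [hn, hmn.symm]), smul_zero, neg_zero]
      · rw [create_ket hn, map_smul, annihilate_ket (by simp [hm]), annihilate_ket hm, map_smul,
          create_ket (by simp [hn]), Maya.add_remove_comm S hmn.symm, smul_smul, smul_smul,
          ← neg_smul]
        congr 1
        rcases lt_or_gt_of_ne hmn with h | h
        · rw [signOver_add_of_lt hn h, signOver_remove_of_le hm h.le]; ring
        · rw [signOver_add_of_le h.le, signOver_remove_of_lt hm h]; ring
    · rw [annihilate_ket_of_notMem hm, map_zero, neg_zero]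
      by_cases hn : n ∈ S.occ
      · rw [create_ket_of_mem hn, map_zero]
      · rw [create_ket hn, map_smul, annihilate_ket_of_notMem (by simp [hm, hmn]), smul_zero]

open Classical in
/-- The coordinates of `ψ_{-n} x`. -/
theorem create_apply (n : ℤ) (x : FockOver B) (S : Maya) :
    create n x S = if n ∈ S.occ then signOver B S n * x (S.remove n) else 0 := by
  induction x using Finsupp.induction_linear with
  | zero => simp
  | add x y hx hy => rw [map_add, Finsupp.add_apply, hx, hy]; split_ifs <;> simp [mul_add]
  | single T a =>
    rw [← mul_one a, ← smul_eq_mul, ← Finsupp.smul_single, map_smul, Finsupp.smul_apply]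
    by_cases hT : n ∈ T.occ
    · rw [create_ket_of_mem hT]
      split_ifs
      · rw [Finsupp.smul_apply, Finsupp.single_eq_of_ne]
        · simp
        · rintro rfl; simp at hT
      · simp
    · rw [create_ket hT]
      by_cases hS : n ∈ S.occ
      · by_cases h : T = S.remove n
        · subst h
          rw [if_pos hS, signOver_remove_of_le hS le_rfl, Maya.add_remove hS]
          simp [mul_comm]
        · have h' : T.add n ≠ S := fun e => h ((Maya.eq_remove_iff hT hS).1 e)
          simp [hS, Ne.symm h, Ne.symm h']
      · have h' : T.add n ≠ S := fun e => hS (by simp [← e])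
        simp [hS, Ne.symm h']

open Classical in
/-- The coordinates of `ψ*_n x`. -/
theorem annihilate_apply (n : ℤ) (x : FockOver B) (S : Maya) :
    annihilate n x S = if n ∈ S.occ then 0 else signOver B S n * x (S.add n) := by
  induction x using Finsupp.induction_linear with
  | zero => simp
  | add x y hx hy => rw [map_add, Finsupp.add_apply, hx, hy]; split_ifs <;> simp [mul_add]
  | single T a =>
    rw [← mul_one a, ← smul_eq_mul, ← Finsupp.smul_single, map_smul, Finsupp.smul_apply]
    by_cases hT : n ∈ T.occ
    · rw [annihilate_ket hT]
      by_cases hS : n ∈ S.occ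
      · have h' : T.remove n ≠ S := fun e => by simp [← e] at hS
        simp [hS, Ne.symm h']
      · by_cases h : S.add n = T
        · subst h
          rw [if_neg hS, signOver_add_of_le le_rfl, Maya.remove_add hS]
          simp [mul_comm]
        · have h' : S ≠ T.remove n := fun e => h ((Maya.eq_remove_iff hS hT).2 e)
          simp [hS, h, h']
    · rw [annihilate_ket_of_notMem hT]
      split_ifs
      · simp
      · rw [Finsupp.smul_apply, Finsupp.single_eq_of_ne]
        · simp
        · rintro rfl; simp at hT

/-! ### Additive weights and charged vacua -/

namespace Maya

/-- The regularised sum of `f` over the occupied levels: the sum over the particles minus the sum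
over the holes. For `f = 1` it is the charge, for `f = id` the energy. -/
def weight {A : Type*} [AddCommGroup A] (f : ℤ → A) (S : Maya) : A :=
  ∑ n ∈ S.finite_particles.toFinset, f n - ∑ n ∈ S.finite_holes.toFinset, f n

section

variable {A : Type*} [AddCommGroup A]

theorem weight_add (f : ℤ → A) {S : Maya} {n : ℤ} (h : n ∉ S.occ) :
    weight f (S.add n) = weight f S + f n := by
  unfold weight
  rcases lt_or_ge 0 n with hn | hn
  · have h1 : (S.add n).finite_particles.toFinset = insert n S.finite_particles.toFinset := by
      ext m
      simp only [Set.Finite.mem_toFinset, Set.mem_ofPred_eq, mem_add, Finset.mem_insert]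
      constructor
      · tauto
      · rintro (rfl | h)
        · exact ⟨Or.inl rfl, hn⟩
        · tauto
    have h2 : (S.add n).finite_holes.toFinset = S.finite_holes.toFinset := by
      ext m
      simp only [Set.Finite.mem_toFinset, Set.mem_ofPred_eq, mem_add]
      constructor
      · tauto
      · rintro ⟨h, h'⟩
        refine ⟨?_, h'⟩
        rintro (rfl | h'')
        · omega
        · exact h h''
    rw [h1, h2, Finset.sum_insert (by simp [h])]
    abel
  · have h1 : (S.add n).finite_particles.toFinset = S.finite_particles.toFinset := by
      ext m
      simp only [Set.Finite.mem_toFinset, Set.mem_ofPred_eq, mem_add]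
      constructor
      · rintro ⟨rfl | h, h'⟩
        · omega
        · exact ⟨h, h'⟩
      · tauto
    have h2 : S.finite_holes.toFinset = insert n (S.add n).finite_holes.toFinset := by
      ext m
      simp only [Set.Finite.mem_toFinset, Set.mem_ofPred_eq, mem_add, Finset.mem_insert]
      constructor
      · tauto
      · rintro (rfl | h')
        · exact ⟨h, hn⟩
        · tauto
    rw [h1, h2, Finset.sum_insert (by simp)]
    abel

theorem weight_remove (f : ℤ → A) {S : Maya} {n : ℤ} (h : n ∈ S.occ) :
    weight f (S.remove n) = weight f S - f n := by
  have := weight_add f (S := S.remove n) (n := n) (by simp)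
  rw [add_remove h] at this
  rw [this]; abel

@[simp] theorem weight_vac (f : ℤ → A) : weight f vac = 0 := by
  have h1 : vac.finite_particles.toFinset = ∅ := by
    ext m; simp [vac]
  have h2 : vac.finite_holes.toFinset = ∅ := by
    ext m
    simp only [vac, Set.Finite.mem_toFinset, Set.mem_ofPred_eq]
    simp
  rw [weight, h1, h2]; simp

end

/-- The energy of a Maya diagram. -/
def energy (S : Maya) : ℤ := weight id S

theorem energy_nonneg (S : Maya) : 0 ≤ energy S := by
  unfold energy weight
  have h1 : 0 ≤ ∑ n ∈ S.finite_particles.toFinset, id n :=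
    Finset.sum_nonneg fun n hn => by
      simp only [Set.Finite.mem_toFinset, Set.mem_ofPred_eq] at hn
      exact hn.2.le
  have h2 : ∑ n ∈ S.finite_holes.toFinset, id n ≤ 0 :=
    Finset.sum_nonpos fun n hn => by
      simp only [Set.Finite.mem_toFinset, Set.mem_ofPred_eq] at hn
      exact hn.2
  omega

/-- The charged vacuum whose occupied levels are the `n ≤ b`. -/
def base (b : ℤ) : Maya where
  occ := {n | n ≤ b}
  finite_particles := by
    refine (Set.finite_Ioc 0 b).subset ?_
    rintro n ⟨h, h'⟩
    exact ⟨h', h⟩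
  finite_holes := by
    refine (Set.finite_Ioc b 0).subset ?_
    rintro n ⟨h, h'⟩
    exact ⟨not_le.1 h, h'⟩

@[simp] theorem mem_base {b n : ℤ} : n ∈ (base b).occ ↔ n ≤ b := Iff.rfl

theorem vac_eq_base : vac = base 0 := rfl

/-- All levels `≤ b` are occupied. -/
def Fills (b : ℤ) (S : Maya) : Prop := ∀ n ≤ b, n ∈ S.occ

theorem exists_fills (S : Maya) : ∃ b, S.Fills b := by
  obtain ⟨c, hc⟩ := S.finite_holes.bddBelow
  refine ⟨min (c - 1) 0, fun n hn => ?_⟩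
  by_contra h
  have := hc (show n ∈ _ from ⟨h, by omega⟩)
  omega

theorem Fills.mono {S : Maya} {b c : ℤ} (h : S.Fills c) (hb : b ≤ c) : S.Fills b :=
  fun n hn => h n (hn.trans hb)

/-- A Maya diagram containing the levels `≤ b` is obtained from the charged vacuum by adding
particles in increasing order. -/
theorem fills_induction {b : ℤ} {P : Maya → Prop} (base : P (base b))
    (add : ∀ S n, S.Fills b → b < n → (∀ m ∈ S.occ, m < n) → P S → P (S.add n))
    {S : Maya} (hS : S.Fills b) : P S := by
  have key : ∀ s : Finset ℤ, (∀ n ∈ s, b < n) → ∀ T : Maya,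
      (∀ n, n ∈ T.occ ↔ n ≤ b ∨ n ∈ s) → P T := by
    intro s
    induction s using Finset.induction_on_max with
    | empty =>
      intro _ T hT
      have : T = Maya.base b := eq_of_mem_iff fun n => by simp [hT]
      rwa [this]
    | insert a s has ih =>
      intro hs T hT
      have ha : a ∈ T.occ := by simp [hT]
      have ha' : a ∉ s := fun h => (has a h).false
      have hb : b < a := hs a (by simp)
      have hR : ∀ n, n ∈ (T.remove a).occ ↔ n ≤ b ∨ n ∈ s := by
        intro n
        simp only [mem_remove, hT, Finset.mem_insert]
        constructor
        · tauto
        · rintro (h | h)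
          · exact ⟨Or.inl h, by omega⟩
          · exact ⟨Or.inr (Or.inr h), fun e => ha' (e ▸ h)⟩
      rw [← add_remove ha]
      refine add _ _ (fun n hn => (hR n).2 (Or.inl hn)) hb ?_
        (ih (fun n hn => hs n (by simp [hn])) _ hR)
      intro m hm
      rcases (hR m).1 hm with h | h
      · omega
      · exact has m h
  have hfin : {n | n ∈ S.occ ∧ b < n}.Finite := S.finite_above b
  refine key hfin.toFinset (fun n hn => ?_) S fun n => ?_
  · simp only [Set.Finite.mem_toFinset, Set.mem_ofPred_eq] at hn
    exact hn.2
  · simp only [Set.Finite.mem_toFinset, Set.mem_ofPred_eq]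
    constructor
    · intro h
      rcases le_or_gt n b with h' | h'
      · exact Or.inl h'
      · exact Or.inr ⟨h, h'⟩
    · rintro (h | h)
      · exact hS n h
      · exact h.1

end Maya

open Maya

variable {B : Type*} [CommRing B]

theorem signOver_eq_one {S : Maya} {n : ℤ} (h : ∀ m ∈ S.occ, m < n) : signOver B S n = 1 := by
  have : {m | m ∈ S.occ ∧ n < m} = ∅ := by
    ext m
    simp only [Set.mem_ofPred_eq, Set.mem_empty_iff_false, iff_false, not_and, not_lt]
    exact fun hm => (h m hm).le
  rw [signOver, this]; simp

theorem create_ket_of_lt {S : Maya} {n : ℤ} (h : ∀ m ∈ S.occ, m < n) :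
    create n (ketOver B S) = ketOver B (S.add n) := by
  rw [create_ket fun hn => (h n hn).false, signOver_eq_one h, one_smul]

/-- The energy operator, diagonal in the basis of kets. -/
def energyOp : Module.End B (FockOver B) :=
  Finsupp.linearCombination B fun S : Maya => (energy S : B) • ketOver B S

theorem energyOp_apply (x : FockOver B) (S : Maya) : energyOp x S = energy S * x S := by
  induction x using Finsupp.induction_linear with
  | zero => simp
  | add x y hx hy => rw [map_add, Finsupp.add_apply, hx, hy, Finsupp.add_apply, mul_add]
  | single T a =>
    simp only [energyOp, Finsupp.linearCombination_single, Finsupp.smul_apply, smul_eq_mul]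
    by_cases h : S = T
    · subst h; simp [mul_comm]
    · simp [h]

theorem energyOp_create (n : ℤ) :
    energyOp * create n
      = create n * energyOp + (n : B) • (create n : Module.End B (FockOver B)) := by
  refine LinearMap.ext fun x => Finsupp.ext fun S => ?_
  simp only [Module.End.mul_apply, LinearMap.add_apply, LinearMap.smul_apply, Finsupp.add_apply,
    Finsupp.smul_apply, energyOp_apply, create_apply, smul_eq_mul]
  split_ifs with h
  · rw [energy, energy, weight_remove id h]
    push_cast
    simp only [id]
    ring
  · simp

theorem energyOp_annihilate (n : ℤ) :
    energyOp * annihilate n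
      = annihilate n * energyOp - (n : B) • (annihilate n : Module.End B (FockOver B)) := by
  refine LinearMap.ext fun x => Finsupp.ext fun S => ?_
  simp only [Module.End.mul_apply, LinearMap.sub_apply, LinearMap.smul_apply, Finsupp.sub_apply,
    Finsupp.smul_apply, energyOp_apply, annihilate_apply, smul_eq_mul]
  split_ifs with h
  · simp
  · rw [energy, energy, weight_add id h]
    push_cast
    simp only [id]
    ring

/-! ### The currents -/

/-- The empty levels into which a particle of `T` can fall by `k`. -/
def hops (k : ℕ+) (T : Maya) : Set ℤ := {n | n + k ∈ T.occ ∧ n ∉ T.occ}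

theorem hops_finite (k : ℕ+) (T : Maya) : (hops k T).Finite := by
  refine (T.finite_holes.union ((T.finite_above 0).image fun n => n - (k : ℤ))).subset ?_
  rintro n ⟨h, h'⟩
  rcases le_or_gt n 0 with h0 | h0
  · exact Or.inl ⟨h', h0⟩
  · exact Or.inr ⟨n + k, ⟨h, by positivity⟩, by simp⟩

/-- The current `J_k` for `k ≥ 1`, over `B`. -/
def current (k : ℕ+) : Module.End B (FockOver B) :=
  Finsupp.linearCombination B fun T : Maya =>
    ∑ n ∈ (hops_finite k T).toFinset, create n (annihilate (n + k) (ketOver B T))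

theorem create_annihilate_ket_eq_zero {k : ℕ+} {T : Maya} {n : ℤ} (h : n ∉ hops k T) :
    create n (annihilate (n + k) (ketOver B T)) = 0 := by
  by_cases hk : n + k ∈ T.occ
  · have hn : n ∈ T.occ := by by_contra hn; exact h ⟨hk, hn⟩
    have hk0 : n ≠ n + k := by simp
    rw [annihilate_ket hk, map_smul, create_ket_of_mem (by simp [hn]), smul_zero]
  · rw [annihilate_ket_of_notMem hk, map_zero]

theorem current_ket {k : ℕ+} {T : Maya} {s : Finset ℤ} (hs : hops k T ⊆ s) :
    current k (ketOver B T) = ∑ n ∈ s, create n (annihilate (n + k) (ketOver B T)) := by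
  rw [current, Finsupp.linearCombination_single, one_smul]
  refine Finset.sum_subset (fun n hn => hs (by simpa using hn)) fun n _ hn => ?_
  exact create_annihilate_ket_eq_zero (by simpa using hn)

theorem current_ket_base (k : ℕ+) (b : ℤ) : current k (ketOver B (base b)) = 0 := by
  rw [current_ket (s := ∅), Finset.sum_empty]
  rintro n ⟨h, h'⟩
  have := k.pos
  simp only [mem_base] at h h'
  omega

theorem current_create (k : ℕ+) (a : ℤ) :
    current k * create a = create a * current k + (create (a - k) : Module.End B (FockOver B)) := by
  refine fock_hom_ext fun T => ?_
  simp only [Module.End.mul_apply, LinearMap.add_apply]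
  set s : Finset ℤ := (hops_finite k T).toFinset ∪ (hops_finite k (T.add a)).toFinset ∪ {a - k}
  have h1 : hops k T ⊆ s := fun n hn => by simp [s, hn]
  have h2 : hops k (T.add a) ⊆ s := fun n hn => by simp [s, hn]
  have h3 : current k (create a (ketOver B T))
      = ∑ n ∈ s, create n (annihilate (n + k) (create a (ketOver B T))) := by
    by_cases ha : a ∈ T.occ
    · simp [create_ket_of_mem ha]
    · simp only [create_ket ha, map_smul, current_ket h2, Finset.smul_sum]
  have h4 : ∀ n : ℤ, create n (annihilate (n + k) (create a (ketOver B T)))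
      = (if n = a - k then create n (ketOver B T) else 0)
        + create a (create n (annihilate (n + k) (ketOver B T))) := fun n => by
    have e1 := LinearMap.congr_fun (annihilate_create (B := B) (n + k) a) (ketOver B T)
    have e2 := LinearMap.congr_fun (create_create (B := B) n a)
      (annihilate (n + k) (ketOver B T))
    simp only [Module.End.mul_apply, LinearMap.sub_apply, LinearMap.neg_apply] at e1 e2
    rw [e1, map_sub, e2, sub_neg_eq_add]
    congr 1
    by_cases h : n = a - k
    · rw [if_pos (by omega), if_pos h, Module.End.one_apply]
    · rw [if_neg (by omega), if_neg h, LinearMap.zero_apply, map_zero]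
  rw [h3, Finset.sum_congr rfl fun n _ => h4 n, Finset.sum_add_distrib, Finset.sum_ite_eq',
    if_pos (by simp [s]), current_ket h1, map_sum, add_comm]

/-- The commutator of two currents commutes with all creation operators and kills the charged
vacua, which generate the Fock space. -/
theorem current_comm (k l : ℕ+) :
    current k * current l = (current l * current k : Module.End B (FockOver B)) := by
  refine fock_hom_ext fun S => ?_
  obtain ⟨b, hb⟩ := S.exists_fills
  refine fills_induction (P := fun S => (current k * current l : Module.End B (FockOver B)) (ketOver B S)
    = (current l * current k : Module.End B (FockOver B)) (ketOver B S)) ?_ ?_ hb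
  · simp [current_ket_base]
  · intro S a _ _ hlt ih
    have comm : ∀ k l : ℕ+, current k * current l * create a
        = create a * (current k * current l) + create (a - k) * current l
          + create (a - l) * current k
          + (create (a - l - k) : Module.End B (FockOver B)) := fun k l => by
      rw [mul_assoc, current_create, mul_add, ← mul_assoc, current_create, current_create]
      noncomm_ring
    rw [← create_ket_of_lt hlt, ← Module.End.mul_apply, ← Module.End.mul_apply (f := current l * _),
      comm, comm l k, sub_right_comm a (k : ℤ)]
    simp only [LinearMap.add_apply, Module.End.mul_apply] at ih ⊢
    rw [ih]; abel

theorem energyOp_current (k : ℕ+) :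
    energyOp * current k
      = current k * energyOp - ((k : ℕ) : B) • (current k : Module.End B (FockOver B)) := by
  refine fock_hom_ext fun T => ?_
  have hs : hops k T ⊆ ((hops_finite k T).toFinset : Finset ℤ) := fun n hn => by simpa using hn
  have hE : energyOp (ketOver B T) = (energy T : B) • ketOver B T := by simp [energyOp]
  simp only [Module.End.mul_apply, LinearMap.sub_apply, LinearMap.smul_apply, hE, map_smul,
    current_ket hs, map_sum, Finset.smul_sum]
  rw [← Finset.sum_sub_distrib]
  refine Finset.sum_congr rfl fun n _ => ?_
  have e1 := LinearMap.congr_fun (energyOp_create (B := B) n) (annihilate (n + k) (ketOver B T))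
  have e2 := LinearMap.congr_fun (energyOp_annihilate (B := B) (n + k)) (ketOver B T)
  simp only [Module.End.mul_apply, LinearMap.sub_apply, LinearMap.add_apply,
    LinearMap.smul_apply, hE, map_smul] at e1 e2
  rw [e1, e2, map_sub, map_smul, map_smul, ← sub_smul, ← add_smul, ← sub_smul]
  congr 1; push_cast; ring

theorem exists_hop_of_current_ne_zero {k : ℕ+} {S T : Maya} (h : current k (ketOver B T) S ≠ 0) :
    ∃ n ∈ hops k T, S = (T.remove (n + k)).add n := by
  rw [current_ket (s := (hops_finite k T).toFinset) (fun n hn => by simpa using hn),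
    Finsupp.finsetSum_apply] at h
  obtain ⟨n, hn, hne⟩ := Finset.exists_ne_zero_of_sum_ne_zero h
  have hn' : n ∈ hops k T := by simpa using hn
  refine ⟨n, hn', ?_⟩
  rw [annihilate_ket hn'.1, map_smul, create_ket (by simp [hn'.2]), smul_smul,
    Finsupp.smul_apply] at hne
  by_contra hS
  rw [Finsupp.single_eq_of_ne hS] at hne
  simp at hne

theorem weight_of_current_ne_zero {k : ℕ+} {S T : Maya} (h : current k (ketOver B T) S ≠ 0)
    {A : Type*} [AddCommGroup A] (f : ℤ → A) :
    ∃ n, weight f S = weight f T - f (n + k) + f n := by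
  obtain ⟨n, hn, rfl⟩ := exists_hop_of_current_ne_zero h
  exact ⟨n, by rw [weight_add f (by simp [hn.2]), weight_remove f hn.1]⟩

theorem energy_of_current_ne_zero {k : ℕ+} {S T : Maya} (h : current k (ketOver B T) S ≠ 0) :
    energy T = energy S + k := by
  obtain ⟨n, hn⟩ := weight_of_current_ne_zero h id
  simp only [energy, hn, id]
  ring

theorem fills_of_current_ne_zero {k : ℕ+} {S T : Maya} (h : current k (ketOver B T) S ≠ 0) {b : ℤ}
    (hT : T.Fills b) : S.Fills b := by
  obtain ⟨n, hn, rfl⟩ := exists_hop_of_current_ne_zero h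
  intro m hm
  have hnb : b < n := not_le.1 fun h => hn.2 (hT n h)
  have := k.pos
  simp only [mem_add, mem_remove]
  exact Or.inr ⟨hT m hm, by omega⟩

/-! ### The currents as matrices -/

theorem psi_eq (m : ℤ) : psi m = create (B := ℂ) (-m) := by
  refine fock_hom_ext fun S => ?_
  by_cases h : -m ∈ S.occ
  · rw [create_ket_of_mem h]; simp [psi, h]
  · rw [create_ket h]; simp [psi, h, ket, signOver, Maya.sign]

theorem psiStar_eq (m : ℤ) : psiStar m = annihilate (B := ℂ) m := by
  refine fock_hom_ext fun S => ?_
  by_cases h : m ∈ S.occ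
  · rw [annihilate_ket h]; simp [psiStar, h, ket, signOver, Maya.sign]
  · rw [annihilate_ket_of_notMem h]; simp [psiStar, h]

theorem normalOrdered_apply (m n : ℤ) (S T : Maya) :
    normalOrdered m n (ket T) S = create m (annihilate n (ketOver ℂ T)) S
      - create m (annihilate n (ketOver ℂ vac)) vac * ketOver ℂ T S := by
  simp only [normalOrdered, psi_eq, psiStar_eq, ket, LinearMap.sub_apply, LinearMap.comp_apply,
    LinearMap.smul_apply, LinearMap.id_apply, neg_neg, Finsupp.sub_apply, Finsupp.smul_apply,
    smul_eq_mul]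

theorem normalOrdered_apply_of_ne {m n : ℤ} (h : m ≠ n) (S T : Maya) :
    normalOrdered m n (ket T) S = create m (annihilate n (ketOver ℂ T)) S := by
  rw [normalOrdered_apply]
  have : create m (annihilate n (ketOver ℂ vac)) vac = 0 := by
    rw [create_apply]
    split_ifs with hm
    · rw [annihilate_apply]
      split_ifs with hn
      · simp
      · rw [Finsupp.single_eq_of_ne]
        · simp
        · intro e
          rw [← e] at hm
          simp [h] at hm
    · rfl
  rw [this, zero_mul, sub_zero]

theorem create_annihilate_symm (m n : ℤ) (S T : Maya) :
    create m (annihilate n (ketOver B T)) S = create n (annihilate m (ketOver B S)) T := by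
  have key : ∀ m n : ℤ, ∀ S T : Maya, create m (annihilate n (ketOver B T)) S ≠ 0 →
      create m (annihilate n (ketOver B T)) S = create n (annihilate m (ketOver B S)) T := by
    intro m n S T h
    rw [create_apply] at h
    split_ifs at h with hm
    · rw [annihilate_apply] at h
      split_ifs at h with hn
      · simp at h
      · by_cases hT : (S.remove m).add n = T
        · subst hT
          rw [annihilate_ket (S := (S.remove m).add n) (by simp), annihilate_ket hm,
            map_smul, map_smul, create_ket hn, Maya.remove_add hn, create_ket (by simp),
            Maya.add_remove hm, signOver_add_of_le le_rfl, signOver_remove_of_le hm le_rfl]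
          simp [mul_comm]
        · rw [Finsupp.single_eq_of_ne hT] at h
          simp at h
    · exact absurd rfl h
  by_cases h : create m (annihilate n (ketOver B T)) S = 0
  · by_cases h' : create n (annihilate m (ketOver B S)) T = 0
    · rw [h, h']
    · exact (key n m T S h').symm
  · exact key m n S T h

theorem J_eq (k : ℕ+) (S T : Maya) : J k S T = current k (ketOver ℂ T) S := by
  have h : ∀ n : ℤ, normalOrdered n (n + k) (ket T) S
      = create n (annihilate (n + k) (ketOver ℂ T)) S := fun n =>
    normalOrdered_apply_of_ne (by simp) S T
  rw [J, finsum_congr h, current_ket (s := (hops_finite k T).toFinset)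
    (fun n hn => by simpa using hn), Finsupp.finsetSum_apply]
  refine finsum_eq_sum_of_support_subset _ fun n hn => ?_
  by_contra hn'
  rw [Function.mem_support, create_annihilate_ket_eq_zero (by simpa using hn')] at hn
  exact hn rfl

theorem J_neg (k : ℕ+) (S T : Maya) : J (-k) S T = J k T S := by
  have h : ∀ n : ℤ, normalOrdered (n + k) n (ket T) S = normalOrdered n (n + k) (ket S) T :=
    fun n => by
      rw [normalOrdered_apply_of_ne (by simp), normalOrdered_apply_of_ne (by simp),
        create_annihilate_symm]
  rw [J, J, ← finsum_congr h]
  rw [← finsum_comp_equiv (Equiv.addRight (k : ℤ))]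
  simp

theorem current_eq_algebraMap [Algebra ℂ B] (k : ℕ+) (S T : Maya) :
    current k (ketOver B T) S = algebraMap ℂ B (J k S T) := by
  have hs : hops k T ⊆ ((hops_finite k T).toFinset : Finset ℤ) := fun n hn => by simpa using hn
  rw [J_eq, current_ket hs, current_ket hs, Finsupp.finsetSum_apply, Finsupp.finsetSum_apply,
    map_sum]
  refine Finset.sum_congr rfl fun n _ => ?_
  have hsign : ∀ S n, algebraMap ℂ B (signOver ℂ S n) = signOver B S n := fun S n => by
    simp [signOver]
  classical
  simp only [create_apply, annihilate_apply, Finsupp.single_apply, apply_ite (algebraMap ℂ B),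
    map_mul, hsign, map_zero, map_one]

/-! ### Exponentials of currents -/

section
variable {B : Type*} [CommRing B]

/-- Linear maps agree at `x` if they agree on the kets occurring in `x`. -/
theorem fock_congr {M : Type*} [AddCommMonoid M] [Module B M] {f g : FockOver B →ₗ[B] M}
    {x : FockOver B} (h : ∀ T, x T ≠ 0 → f (ketOver B T) = g (ketOver B T)) : f x = g x := by
  have hx : x = ∑ T ∈ x.support, x T • ketOver B T := by
    conv_lhs => rw [← Finsupp.sum_single x]
    simp [Finsupp.sum]
  rw [hx, map_sum, map_sum]
  refine Finset.sum_congr rfl fun T hT => ?_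
  rw [map_smul, map_smul, h T (by simpa using hT)]

theorem apply_eq_sum (f : Module.End B (FockOver B)) (x : FockOver B) (S : Maya) :
    f x S = ∑ U ∈ x.support, f (ketOver B U) S * x U := by
  have hx : x = ∑ T ∈ x.support, x T • ketOver B T := by
    conv_lhs => rw [← Finsupp.sum_single x]
    simp [Finsupp.sum]
  conv_lhs => rw [hx, map_sum, Finsupp.finsetSum_apply]
  refine Finset.sum_congr rfl fun U _ => ?_
  rw [map_smul, Finsupp.smul_apply, smul_eq_mul, mul_comm]

/-- Every nonzero coordinate of `f x` comes from a ket occurring in `x`. -/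
theorem exists_ket_of_apply_ne_zero {f : Module.End B (FockOver B)} {x : FockOver B} {S : Maya}
    (h : f x S ≠ 0) : ∃ T, x T ≠ 0 ∧ f (ketOver B T) S ≠ 0 := by
  by_contra! hc
  refine h ?_
  have := fock_congr (f := Finsupp.lapply S ∘ₗ f) (g := 0) (x := x) fun T hT => hc T hT
  simpa using this

theorem ketOver_ne_zero {S T : Maya} (h : ketOver B T S ≠ 0) : S = T := by
  by_contra hS
  exact h (Finsupp.single_eq_of_ne hS)

/-- All kets occurring in `x` have energy at most `e`. -/
def EnergyLE (e : ℤ) (x : FockOver B) : Prop := ∀ S, x S ≠ 0 → energy S ≤ e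

theorem EnergyLE.mono {e e' : ℤ} {x : FockOver B} (h : EnergyLE e x) (he : e ≤ e') :
    EnergyLE e' x := fun S hS => (h S hS).trans he

theorem energyLE_ket (T : Maya) : EnergyLE (energy T) (ketOver B T) :=
  fun _ hS => by rw [ketOver_ne_zero hS]

theorem EnergyLE.eq_zero {e : ℤ} {x : FockOver B} (h : EnergyLE e x) (he : e < 0) : x = 0 := by
  ext S
  by_contra hS
  have := h S hS
  have := energy_nonneg S
  omega

/-- `∑_{k ≥ 1} t_k J_k`. On a given ket only finitely many terms are nonzero. -/
def currentSum (t : ℕ+ → B) : Module.End B (FockOver B) :=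
  Finsupp.linearCombination B fun T : Maya =>
    ∑ k ∈ Finset.Icc 1 (energy T).toNat.succPNat, t k • current k (ketOver B T)

theorem currentSum_apply (t : ℕ+ → B) {N : ℕ+} {x : FockOver B} (hx : EnergyLE N x) :
    currentSum t x = ∑ k ∈ Finset.Icc 1 N, t k • current k x := by
  have h : ∀ {N : ℕ+} {T : Maya}, energy T ≤ N → ∀ {M : ℕ+}, N ≤ M →
      ∑ k ∈ Finset.Icc 1 N, t k • current k (ketOver B T)
        = ∑ k ∈ Finset.Icc 1 M, t k • current k (ketOver B T) := by
    intro N T hT M hM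
    refine Finset.sum_subset (Finset.Icc_subset_Icc_right hM) fun k _ hk => ?_
    have hk' : N < k := by simpa using hk
    have : current k (ketOver B T) = 0 := by
      ext S
      by_contra hS
      have h1 := energy_of_current_ne_zero hS
      have h2 := energy_nonneg S
      have h3 : (N : ℤ) < k := by exact_mod_cast hk'
      omega
    rw [this, smul_zero]
  have key := fock_congr (f := currentSum t) (g := ∑ k ∈ Finset.Icc 1 N, t k • current k)
    (x := x) fun T hT => by
      have hTN := hx T hT
      have hTe : energy T ≤ ((energy T).toNat.succPNat : ℕ+) := by
        have := energy_nonneg T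
        rw [Nat.succPNat_coe]; omega
      simp only [currentSum, Finsupp.linearCombination_single, one_smul, LinearMap.sum_apply,
        LinearMap.smul_apply]
      rw [h hTe (le_max_left _ N), h hTN (le_max_right (energy T).toNat.succPNat N)]
  simpa using key

theorem exists_current_of_currentSum_ne_zero {t : ℕ+ → B} {S T : Maya}
    (h : currentSum t (ketOver B T) S ≠ 0) : ∃ k, current k (ketOver B T) S ≠ 0 := by
  rw [currentSum, Finsupp.linearCombination_single, one_smul, Finsupp.finsetSum_apply] at h
  obtain ⟨k, _, hk⟩ := Finset.exists_ne_zero_of_sum_ne_zero h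
  exact ⟨k, fun h0 => hk (by simp [h0])⟩

theorem EnergyLE.currentSum {e : ℤ} {x : FockOver B} (hx : EnergyLE e x) (t : ℕ+ → B) :
    EnergyLE (e - 1) (currentSum t x) := by
  intro S hS
  obtain ⟨T, hT, h⟩ := exists_ket_of_apply_ne_zero hS
  obtain ⟨k, hk⟩ := exists_current_of_currentSum_ne_zero h
  have h1 := energy_of_current_ne_zero hk
  have h2 := hx T hT
  have h3 := k.pos
  omega

theorem EnergyLE.pow_currentSum {e : ℤ} {x : FockOver B} (hx : EnergyLE e x) (t : ℕ+ → B)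
    (j : ℕ) : EnergyLE (e - j) ((TwoPartition.currentSum t ^ j) x) := by
  induction j with
  | zero => simpa using hx
  | succ j ih =>
    rw [pow_succ', Module.End.mul_apply]
    exact (ih.currentSum t).mono (by push_cast; omega)

theorem exists_energy_le (e : ℤ) : ∃ N : ℕ+, e ≤ N :=
  ⟨e.toNat.succPNat, by rw [Nat.succPNat_coe]; omega⟩

theorem currentSum_comm (t s : ℕ+ → B) : Commute (currentSum t) (currentSum s) := by
  refine fock_hom_ext fun T => ?_
  obtain ⟨N, hN⟩ := exists_energy_le (energy T)
  have hT : EnergyLE (N : ℤ) (ketOver B T) := (energyLE_ket T).mono hN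
  simp only [Module.End.mul_apply]
  rw [currentSum_apply t (N := N) ((hT.currentSum s).mono (by omega)),
    currentSum_apply s (N := N) ((hT.currentSum t).mono (by omega)), currentSum_apply s hT,
    currentSum_apply t hT]
  simp only [map_sum, map_smul, Finset.smul_sum]
  rw [Finset.sum_comm]
  refine Finset.sum_congr rfl fun k _ => Finset.sum_congr rfl fun l _ => ?_
  rw [smul_comm, ← Module.End.mul_apply, current_comm, Module.End.mul_apply]

theorem currentSum_create (t : ℕ+ → B) {a : ℤ} {T : Maya} {N : ℕ+} (hN : energy T ≤ N)
    (hN' : energy T + a ≤ N) : currentSum t (create a (ketOver B T))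
      = create a (currentSum t (ketOver B T))
        + ∑ k ∈ Finset.Icc 1 N, t k • create (a - k) (ketOver B T) := by
  have h : EnergyLE (N : ℤ) (create a (ketOver B T)) := by
    by_cases ha : a ∈ T.occ
    · rw [create_ket_of_mem ha]; exact fun S hS => absurd rfl hS
    · rw [create_ket ha]
      intro S hS
      have : S = T.add a := by
        by_contra hS'
        exact hS (by rw [Finsupp.smul_apply, Finsupp.single_eq_of_ne hS', smul_zero])
      rw [this, energy, weight_add id ha]
      exact hN'
  rw [currentSum_apply t h, currentSum_apply t ((energyLE_ket T).mono hN), map_sum,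
    ← Finset.sum_add_distrib]
  refine Finset.sum_congr rfl fun k _ => ?_
  rw [← Module.End.mul_apply, current_create, LinearMap.add_apply, Module.End.mul_apply, smul_add,
    map_smul]

/-- The commutator with the energy: `[E, ∑ t_k J_k] = -∑ k t_k J_k`. -/
theorem energyOp_currentSum {t p : ℕ+ → B} (hp : ∀ k, p k = ((k : ℕ) : B) * t k) :
    energyOp * currentSum t = currentSum t * energyOp - currentSum p := by
  refine fock_hom_ext fun T => ?_
  obtain ⟨N, hN⟩ := exists_energy_le (energy T)
  have hT : EnergyLE (N : ℤ) (ketOver B T) := (energyLE_ket T).mono hN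
  have hE : energyOp (ketOver B T) = (energy T : B) • ketOver B T := by simp [energyOp]
  simp only [Module.End.mul_apply, LinearMap.sub_apply, hE, map_smul]
  rw [currentSum_apply t hT, currentSum_apply p hT, map_sum, Finset.smul_sum,
    ← Finset.sum_sub_distrib]
  refine Finset.sum_congr rfl fun k _ => ?_
  rw [map_smul, ← Module.End.mul_apply, energyOp_current, LinearMap.sub_apply,
    Module.End.mul_apply, hE, map_smul, LinearMap.smul_apply, smul_sub, smul_comm (t k), hp,
    smul_smul (t k), mul_comm (t k)]

theorem energyOp_currentSum_pow {t p : ℕ+ → B} (hp : ∀ k, p k = ((k : ℕ) : B) * t k) (j : ℕ) :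
    energyOp * currentSum t ^ (j + 1) = currentSum t ^ (j + 1) * energyOp
      - ((j + 1 : ℕ) : B) • (currentSum t ^ j * currentSum p) := by
  induction j with
  | zero => simp [energyOp_currentSum hp]
  | succ j ih =>
    refine LinearMap.ext fun x => ?_
    have h1 := LinearMap.congr_fun ih (currentSum t x)
    have h2 := LinearMap.congr_fun (energyOp_currentSum hp) x
    have h3 := LinearMap.congr_fun (currentSum_comm p t).eq x
    simp only [Module.End.mul_apply, LinearMap.sub_apply, LinearMap.smul_apply] at h1 h2 h3 ⊢
    rw [pow_succ _ (j + 1), Module.End.mul_apply, h1, h2, h3, map_sub, Nat.cast_succ (j + 1),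
      add_smul, one_smul, Module.End.mul_apply, ← Module.End.mul_apply (currentSum t ^ j),
      ← pow_succ]
    abel

end

section
variable {B : Type*} [CommRing B] [Algebra ℂ B]

/-- `exp (∑_{k ≥ 1} t_k J_k)`. On a given ket only finitely many terms of the exponential series
are nonzero. -/
def currentExpEnd (t : ℕ+ → B) : Module.End B (FockOver B) :=
  Finsupp.linearCombination B fun T : Maya =>
    ∑ j ∈ Finset.range ((energy T).toNat + 1),
      (j ! : ℂ)⁻¹ • (currentSum t ^ j) (ketOver B T)

theorem currentExpEnd_apply (t : ℕ+ → B) {m : ℕ} {x : FockOver B} (hx : EnergyLE (m - 1) x) :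
    currentExpEnd t x = ∑ j ∈ Finset.range m, (j ! : ℂ)⁻¹ • (currentSum t ^ j) x := by
  have key := fock_congr (f := currentExpEnd t)
    (g := ∑ j ∈ Finset.range m, algebraMap ℂ B (j ! : ℂ)⁻¹ • (currentSum t ^ j))
    (x := x) fun T hT => by
      have h := hx T hT
      have h0 := energy_nonneg T
      simp only [currentExpEnd, Finsupp.linearCombination_single, one_smul, LinearMap.sum_apply,
        LinearMap.smul_apply, algebraMap_smul]
      refine Finset.sum_subset (Finset.range_mono (by omega)) fun j _ hj => ?_
      rw [((energyLE_ket T).pow_currentSum t j).eq_zero, smul_zero]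
      simp only [Finset.mem_range, not_lt] at hj
      omega
  simpa using key

/-- The commutator with the energy: `[E, exp (∑ t_k J_k)] = -exp (∑ t_k J_k) ∑ k t_k J_k`. -/
theorem energyOp_currentExpEnd {t p : ℕ+ → B} (hp : ∀ k, p k = ((k : ℕ) : B) * t k)
    (T : Maya) : energyOp (currentExpEnd t (ketOver B T))
      = (energy T : B) • currentExpEnd t (ketOver B T)
        - currentExpEnd t (currentSum p (ketOver B T)) := by
  obtain ⟨n, hn⟩ := Int.eq_ofNat_of_zero_le (energy_nonneg T)
  have hT : EnergyLE (((n + 1 : ℕ) : ℤ) - 1) (ketOver B T) :=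
    (energyLE_ket T).mono (by omega)
  have hE : energyOp (ketOver B T) = (energy T : B) • ketOver B T := by simp [energyOp]
  rw [currentExpEnd_apply t hT, currentExpEnd_apply t (m := n)
    ((hT.currentSum p).mono (by push_cast; omega)), Finset.sum_range_succ',
    map_add, map_sum]
  simp only [← algebraMap_smul B (_ : ℂ) (_ : FockOver B), map_smul, smul_add]
  have e : ∀ j : ℕ, energyOp ((currentSum t ^ (j + 1)) (ketOver B T))
      = (energy T : B) • (currentSum t ^ (j + 1)) (ketOver B T)
        - ((j + 1 : ℕ) : B) • (currentSum t ^ j) (currentSum p (ketOver B T)) := fun j => by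
    have := LinearMap.congr_fun (energyOp_currentSum_pow hp j) (ketOver B T)
    simpa only [Module.End.mul_apply, LinearMap.sub_apply, LinearMap.smul_apply, hE, map_smul]
      using this
  simp only [e, pow_zero, Module.End.one_apply, hE, smul_sub, Finset.sum_sub_distrib,
    Finset.smul_sum]
  have e2 : ∀ j : ℕ, algebraMap ℂ B (((j + 1)! : ℕ) : ℂ)⁻¹ * ((j + 1 : ℕ) : B)
      = algebraMap ℂ B (j ! : ℂ)⁻¹ := fun j => by
    rw [← map_natCast (algebraMap ℂ B), ← map_mul]
    congr 1
    have : ((j + 1 : ℕ) : ℂ) ≠ 0 := by exact_mod_cast Nat.succ_ne_zero j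
    rw [Nat.factorial_succ]
    push_cast at this ⊢
    field_simp
  simp only [smul_smul (algebraMap ℂ B _) ((_ : ℕ) : B), e2]
  simp only [smul_comm (energy T : B)]
  abel

theorem currentExpEnd_ne_zero {t : ℕ+ → B} {S : Maya} {x : FockOver B}
    (h : currentExpEnd t x S ≠ 0) {P : Maya → Prop} (hx : ∀ T, x T ≠ 0 → P T)
    (hP : ∀ (k : ℕ+) (U T : Maya), P T → current k (ketOver B T) U ≠ 0 → P U) : P S := by
  have hpow : ∀ (j : ℕ) (T U : Maya), P T → (currentSum t ^ j) (ketOver B T) U ≠ 0 → P U := by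
    intro j
    induction j with
    | zero => intro T U hT h; rwa [ketOver_ne_zero h]
    | succ j ih =>
      intro T U hT h
      rw [pow_succ', Module.End.mul_apply] at h
      obtain ⟨V, hV, h⟩ := exists_ket_of_apply_ne_zero h
      obtain ⟨k, hk⟩ := exists_current_of_currentSum_ne_zero h
      exact hP k U V (ih T V hT hV) hk
  obtain ⟨T, hT, h⟩ := exists_ket_of_apply_ne_zero h
  rw [currentExpEnd, Finsupp.linearCombination_single, one_smul, Finsupp.finsetSum_apply] at h
  obtain ⟨j, _, hj⟩ := Finset.exists_ne_zero_of_sum_ne_zero h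
  exact hpow j T S (hx T hT) fun h0 => hj (by rw [Finsupp.smul_apply, h0, smul_zero])

theorem EnergyLE.currentExpEnd {e : ℤ} {x : FockOver B} (hx : EnergyLE e x) (t : ℕ+ → B) :
    EnergyLE e (currentExpEnd t x) := fun _ hS =>
  currentExpEnd_ne_zero (P := fun S => energy S ≤ e) hS hx fun k U T hT h => by
    have := energy_of_current_ne_zero h
    have := k.pos
    omega

/-- The top-energy part of `x` is not changed by the exponential. -/
theorem currentExpEnd_apply_of_energyLE (t : ℕ+ → B) {S : Maya} {x : FockOver B}
    (hx : EnergyLE (energy S) x) : currentExpEnd t x S = x S := by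
  obtain ⟨n, hn⟩ := Int.eq_ofNat_of_zero_le (energy_nonneg S)
  rw [currentExpEnd_apply t (m := n + 1) (hx.mono (by push_cast; omega)), Finset.sum_range_succ',
    Finsupp.add_apply, Finsupp.finsetSum_apply, Finset.sum_eq_zero]
  · simp
  · intro j _
    by_contra h
    have h0 : (currentSum t ^ (j + 1)) x S ≠ 0 := fun h0 => h (by
      rw [Finsupp.smul_apply, h0, smul_zero])
    have := hx.pow_currentSum t (j + 1) S h0
    push_cast at this
    omega

theorem currentExpEnd_ket_base (t : ℕ+ → B) (b : ℤ) :
    currentExpEnd t (ketOver B (base b)) = ketOver B (base b) := by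
  have h : currentSum t (ketOver B (base b)) = 0 := by
    simp [currentSum, current_ket_base]
  rw [currentExpEnd, Finsupp.linearCombination_single, one_smul, Finset.sum_range_succ',
    Finset.sum_eq_zero]
  · simp
  · intro j _
    rw [pow_succ, Module.End.mul_apply, h, map_zero, smul_zero]

/-! ### Matrix elements of the exponentials -/

variable [TopologicalSpace B]

theorem tsum_eq_apply {R : Type*} [CommRing R] [TopologicalSpace R]
    (f : Module.End R (FockOver R)) (x : FockOver R) (S : Maya) :
    ∑' U, f (ketOver R U) S * x U = f x S := by
  rw [apply_eq_sum f x S, tsum_eq_sum]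
  intro U hU
  rw [Finsupp.notMem_support_iff.1 hU, mul_zero]

theorem opMul_eq {R : Type*} [CommRing R] [TopologicalSpace R]
    {f g : Module.End R (FockOver R)} {M N : Op R}
    (hM : ∀ S T, M S T = f (ketOver R T) S) (hN : ∀ S T, N S T = g (ketOver R T) S)
    (S T : Maya) : opMul M N S T = (f * g) (ketOver R T) S := by
  simp only [opMul, hM, hN, Module.End.mul_apply]
  exact tsum_eq_apply f _ S

theorem opPow_eq {R : Type*} [CommRing R] [TopologicalSpace R]
    {f : Module.End R (FockOver R)} {M : Op R}
    (hM : ∀ S T, M S T = f (ketOver R T) S) (j : ℕ) (S T : Maya) :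
    opPow M j S T = (f ^ j) (ketOver R T) S := by
  induction j generalizing S T with
  | zero =>
    classical
    rw [opPow, Matrix.one_apply, pow_zero, Module.End.one_apply, Finsupp.single_apply]
    simp only [eq_comm]
  | succ j ih => rw [opPow, opMul_eq hM ih, pow_succ']

theorem opPow_transpose_eq {R : Type*} [CommRing R] [TopologicalSpace R]
    {f : Module.End R (FockOver R)} {M : Op R}
    (hM : ∀ S T, M S T = f (ketOver R S) T) (j : ℕ) (S T : Maya) :
    opPow M j S T = (f ^ j) (ketOver R S) T := by
  induction j generalizing S T with
  | zero =>
    classical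
    rw [opPow, Matrix.one_apply, pow_zero, Module.End.one_apply, Finsupp.single_apply]
  | succ j ih =>
    rw [opPow, opMul, pow_succ, Module.End.mul_apply, ← tsum_eq_apply]
    refine tsum_congr fun U => ?_
    rw [hM, ih, mul_comm]

theorem tsum_J_smul (t : ℕ+ → B) (S T : Maya) :
    ∑' k : ℕ+, J (k : ℤ) S T • t k = currentSum t (ketOver B T) S := by
  obtain ⟨N, hN⟩ := exists_energy_le (energy T)
  have hT : EnergyLE (N : ℤ) (ketOver B T) := (energyLE_ket T).mono hN
  have hJ : ∀ k : ℕ+, J (k : ℤ) S T • t k = (t k • current k (ketOver B T)) S := fun k => by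
    rw [Finsupp.smul_apply, current_eq_algebraMap, Algebra.smul_def, smul_eq_mul, mul_comm]
  rw [currentSum_apply t hT, Finsupp.finsetSum_apply, tsum_eq_sum (s := Finset.Icc 1 N)]
  · exact Finset.sum_congr rfl fun k _ => hJ k
  · intro k hk
    rw [hJ]
    have hk' : N < k := by simpa using hk
    by_contra h
    have h1 := energy_of_current_ne_zero (k := k) (S := S) (T := T) (B := B)
      fun h0 => h (by rw [Finsupp.smul_apply, h0, smul_zero])
    have h2 := energy_nonneg S
    have h3 : (N : ℤ) < k := by exact_mod_cast hk'
    omega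

theorem tsum_exp_series (t : ℕ+ → B) (S T : Maya) :
    ∑' j : ℕ, (j ! : ℂ)⁻¹ • (currentSum t ^ j) (ketOver B T) S
      = currentExpEnd t (ketOver B T) S := by
  rw [currentExpEnd, Finsupp.linearCombination_single, one_smul, Finsupp.finsetSum_apply,
    tsum_eq_sum (s := Finset.range ((energy T).toNat + 1))]
  · rfl
  · intro j hj
    rw [((energyLE_ket T).pow_currentSum t j).eq_zero, Finsupp.zero_apply, smul_zero]
    simp only [Finset.mem_range, not_lt] at hj
    have := energy_nonneg T
    omega

theorem currentExp_one_apply (t : ℕ+ → B) (S T : Maya) :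
    currentExp 1 t S T = currentExpEnd t (ketOver B T) S := by
  rw [← tsum_exp_series]
  refine tsum_congr fun j => congrArg _ (opPow_eq (fun S T => ?_) j S T)
  rw [← tsum_J_smul]
  exact tsum_congr fun k => by simp

/-- The matrix of `exp (∑ t_k J_{-k})` is the transpose of that of `exp (∑ t_k J_k)`. -/
theorem currentExp_neg_one_apply (t : ℕ+ → B) (S T : Maya) :
    currentExp (-1) t S T = currentExpEnd t (ketOver B S) T := by
  rw [← tsum_exp_series]
  refine tsum_congr fun j => congrArg _ (opPow_transpose_eq (fun S T => ?_) j S T)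
  rw [← tsum_J_smul]
  exact tsum_congr fun k => by simp [J_neg]

end

/-! ### Semi-infinite wedge products -/

section
variable {B : Type*} [CommRing B]

/-- The creation operator `∑ v_n ψ_{-n}` of a one-particle state `v`. -/
def createVec (v : ℤ →₀ B) : Module.End B (FockOver B) :=
  Finsupp.linearCombination B (create (B := B)) v

/-- The annihilation operator `∑ v_n ψ*_n` of a one-particle state `v`. -/
def annihilateVec (v : ℤ →₀ B) : Module.End B (FockOver B) :=
  Finsupp.linearCombination B (annihilate (B := B)) v

/-- The bilinear pairing `∑ v_n w_n` of one-particle states. -/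
def dot : (ℤ →₀ B) →ₗ[B] (ℤ →₀ B) →ₗ[B] B :=
  Finsupp.linearCombination B fun n => (Finsupp.lapply n : (ℤ →₀ B) →ₗ[B] B)

theorem single_dot (w : ℤ →₀ B) (n : ℤ) (a : B) : dot (Finsupp.single n a) w = a * w n := by
  simp [dot]

theorem createVec_single (n : ℤ) : createVec (Finsupp.single n (1 : B)) = create n := by
  simp [createVec]

theorem createVec_apply (v : ℤ →₀ B) {s : Finset ℤ} (hs : v.support ⊆ s) (x : FockOver B)
    (S : Maya) : createVec v x S = ∑ n ∈ s, v n * create n x S := by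
  rw [createVec, Finsupp.linearCombination_apply, Finsupp.sum_of_support_subset _ hs _ (by simp)]
  simp

theorem annihilateVec_createVec (v w : ℤ →₀ B) (x : FockOver B) :
    annihilateVec v (createVec w x) = dot v w • x - createVec w (annihilateVec v x) := by
  simp only [annihilateVec, createVec]
  induction w using Finsupp.induction_linear with
  | zero => simp
  | add w w' h h' => simp only [map_add, LinearMap.add_apply, h, h', add_smul]; abel
  | single m a =>
    induction v using Finsupp.induction_linear with
    | zero => simp
    | add v v' h h' =>
      simp only [Finsupp.linearCombination_single, map_add, LinearMap.add_apply, add_smul] at h h' ⊢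
      rw [h, h']; abel
    | single n c =>
      have key := LinearMap.congr_fun (annihilate_create (B := B) n m) x
      simp only [Module.End.mul_apply, LinearMap.sub_apply] at key
      simp only [Finsupp.linearCombination_single, LinearMap.smul_apply, map_smul, key, single_dot,
        smul_sub, smul_smul]
      by_cases hnm : n = m
      · subst hnm
        simp [mul_comm]
      · simp [hnm, mul_comm]

/-- The bilinear pairing for which the kets are orthonormal. -/
def pairing : FockOver B →ₗ[B] FockOver B →ₗ[B] B :=
  Finsupp.linearCombination B fun S => (Finsupp.lapply S : FockOver B →ₗ[B] B)

theorem ket_pairing (S : Maya) (y : FockOver B) : pairing (ketOver B S) y = y S := by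
  simp [pairing]

theorem pairing_create (n : ℤ) (x y : FockOver B) :
    pairing (create n x) y = pairing x (annihilate n y) := by
  refine fock_congr (f := pairing.flip y ∘ₗ create n) (g := pairing.flip (annihilate n y))
    fun T _ => ?_
  rw [LinearMap.comp_apply, LinearMap.flip_apply, LinearMap.flip_apply, ket_pairing,
    annihilate_apply]
  split_ifs with h
  · rw [create_ket_of_mem h, map_zero, LinearMap.zero_apply]
  · rw [create_ket h, map_smul, LinearMap.smul_apply, ket_pairing, smul_eq_mul]

theorem pairing_createVec (v : ℤ →₀ B) (x y : FockOver B) :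
    pairing (createVec v x) y = pairing x (annihilateVec v y) := by
  simp only [createVec, annihilateVec]
  induction v using Finsupp.induction_linear with
  | zero => simp
  | add v w h h' => simp only [map_add, LinearMap.add_apply, h, h']
  | single n a =>
    simp only [Finsupp.linearCombination_single, LinearMap.smul_apply, map_smul, pairing_create]

/-- The wedge product `v₁ ∧ ⋯ ∧ v_L ∧ |b⟩` over the charged vacuum of level `b`. -/
def wedge (b : ℤ) : (L : ℕ) → (Fin L → ℤ →₀ B) → FockOver B
  | 0, _ => ketOver B (base b)
  | L + 1, v => createVec (v 0) (wedge b L fun i => v i.succ)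

theorem annihilateVec_ket_base {b : ℤ} {v : ℤ →₀ B} (hv : ∀ n ≤ b, v n = 0) :
    annihilateVec v (ketOver B (base b)) = 0 := by
  rw [annihilateVec, Finsupp.linearCombination_apply, Finsupp.sum, LinearMap.sum_apply]
  refine Finset.sum_eq_zero fun n _ => ?_
  by_cases h : n ≤ b
  · simp [hv n h]
  · rw [LinearMap.smul_apply, annihilate_ket_of_notMem (by simpa using h), smul_zero]

theorem annihilateVec_wedge {b : ℤ} {v : ℤ →₀ B} (hv : ∀ n ≤ b, v n = 0) (L : ℕ)
    (w : Fin (L + 1) → ℤ →₀ B) : annihilateVec v (wedge b (L + 1) w)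
      = ∑ j : Fin (L + 1), ((-1) ^ (j : ℕ) * dot v (w j)) • wedge b L fun i => w (j.succAbove i) := by
  have step : ∀ (L : ℕ) (w : Fin (L + 1) → ℤ →₀ B), annihilateVec v (wedge b (L + 1) w)
      = dot v (w 0) • wedge b L (fun i => w i.succ)
        - createVec (w 0) (annihilateVec v (wedge b L fun i => w i.succ)) := fun L w => by
    exact annihilateVec_createVec v (w 0) _
  induction L with
  | zero =>
    rw [step, wedge, annihilateVec_ket_base hv, map_zero, sub_zero, Fin.sum_univ_one]
    simp [wedge]
  | succ L ih =>
    rw [step, ih, map_sum, Fin.sum_univ_succ (n := L + 1), sub_eq_add_neg,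
      ← Finset.sum_neg_distrib]
    congr 1
    · simp
    · refine Finset.sum_congr rfl fun j _ => ?_
      rw [map_smul, ← neg_smul]
      simp [pow_succ, wedge]

/-- The Cauchy–Binet formula for semi-infinite wedges: the pairing of two wedge products is the
determinant of the pairings of their factors. -/
theorem pairing_wedge {b : ℤ} (L : ℕ) {v w : Fin L → ℤ →₀ B} (hv : ∀ i, ∀ n ≤ b, v i n = 0) :
    pairing (wedge b L v) (wedge b L w) = Matrix.det (Matrix.of fun i j => dot (v i) (w j)) := by
  induction L with
  | zero => simp [wedge, pairing]
  | succ L ih =>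
    rw [wedge, pairing_createVec, annihilateVec_wedge (hv 0), Matrix.det_succ_row_zero, map_sum]
    refine Finset.sum_congr rfl fun j _ => ?_
    rw [map_smul, ih fun i => hv i.succ, smul_eq_mul]
    rfl

end

/-! ### Exponentials of currents acting on wedge products -/

section
variable {B : Type*} [CommRing B]

/-- Newton's identities: `h` is the sequence of complete symmetric functions with power sums `p`,
extended by zero to negative indices. -/
structure IsComplete (p : ℕ+ → B) (h : ℤ → B) : Prop where
  neg : ∀ m < 0, h m = 0
  zero : h 0 = 1
  newton : ∀ (m : ℤ) (N : ℕ+), m ≤ N → (m : B) * h m = ∑ k ∈ Finset.Icc 1 N, p k * h (m - k)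

/-- The one-particle operator `e_c ↦ ∑_{b < u ≤ c} h_{c-u} e_u`: the action of
`exp (∑ p_k J_k / k)` on a particle above the charged vacuum of level `b`. -/
def shiftVec (b : ℤ) (h : ℤ → B) : (ℤ →₀ B) →ₗ[B] (ℤ →₀ B) :=
  Finsupp.linearCombination B fun c => ∑ u ∈ Finset.Ioc b c, Finsupp.single u (h (c - u))

open Classical in
theorem shiftVec_single_apply (b : ℤ) {h : ℤ → B} (hneg : ∀ m < 0, h m = 0) (c u : ℤ) :
    shiftVec b h (Finsupp.single c 1) u = if b < u then h (c - u) else 0 := by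
  simp only [shiftVec, Finsupp.linearCombination_single, one_smul, Finsupp.finsetSum_apply,
    Finsupp.single_apply, Finset.sum_ite_eq', Finset.mem_Ioc]
  by_cases hb : b < u
  · by_cases hc : u ≤ c
    · simp [hb, hc]
    · simp [hb, hc, hneg (c - u) (by omega)]
  · simp [hb]

theorem createVec_shiftVec_single (b : ℤ) (h : ℤ → B) (c : ℤ) (y : FockOver B) :
    createVec (shiftVec b h (Finsupp.single c 1)) y
      = ∑ u ∈ Finset.Ioc b c, h (c - u) • create u y := by
  simp [shiftVec, createVec]

theorem createVec_shiftVec_single_of_le {b c : ℤ} {h : ℤ → B} (hneg : ∀ m < 0, h m = 0)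
    {c' : ℤ} (hc : c ≤ c') (y : FockOver B) :
    createVec (shiftVec b h (Finsupp.single c 1)) y
      = ∑ u ∈ Finset.Ioc b c', h (c - u) • create u y := by
  rw [createVec_shiftVec_single]
  refine Finset.sum_subset (Finset.Ioc_subset_Ioc_right hc) fun u hu hu' => ?_
  simp only [Finset.mem_Ioc] at hu hu'
  rw [hneg _ (by omega), zero_smul]

theorem energyOp_createVec_shiftVec {p : ℕ+ → B} {h : ℤ → B} (hh : IsComplete p h) (b c : ℤ)
    {N : ℕ+} (hN : c - b ≤ N) (y : FockOver B) :
    energyOp (createVec (shiftVec b h (Finsupp.single c 1)) y)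
      = createVec (shiftVec b h (Finsupp.single c 1)) (energyOp y)
        + (c : B) • createVec (shiftVec b h (Finsupp.single c 1)) y
        - ∑ k ∈ Finset.Icc 1 N,
            p k • createVec (shiftVec b h (Finsupp.single (c - k) 1)) y := by
  have h1 : ∑ k ∈ Finset.Icc 1 N, p k • createVec (shiftVec b h (Finsupp.single (c - k) 1)) y
      = ∑ u ∈ Finset.Ioc b c, (((c - u : ℤ) : B) * h (c - u)) • create u y := by
    have : ∀ k : ℕ+, createVec (shiftVec b h (Finsupp.single (c - k) 1)) y
        = ∑ u ∈ Finset.Ioc b c, h (c - k - u) • create u y := fun k =>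
      createVec_shiftVec_single_of_le hh.neg (by have := k.pos; omega) y
    simp only [this, Finset.smul_sum]
    rw [Finset.sum_comm]
    refine Finset.sum_congr rfl fun u hu => ?_
    rw [Finset.mem_Ioc] at hu
    rw [hh.newton (c - u) N (by omega), Finset.sum_smul]
    refine Finset.sum_congr rfl fun k _ => ?_
    rw [smul_smul, sub_right_comm]
  rw [h1]
  simp only [createVec_shiftVec_single, map_sum, map_smul, Finset.smul_sum]
  rw [← Finset.sum_add_distrib, ← Finset.sum_sub_distrib]
  refine Finset.sum_congr rfl fun u _ => ?_
  have e := LinearMap.congr_fun (energyOp_create (B := B) u) y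
  simp only [Module.End.mul_apply, LinearMap.add_apply, LinearMap.smul_apply] at e
  rw [e, smul_add, add_sub_assoc, smul_smul, smul_smul, ← sub_smul]
  congr 2
  push_cast; ring

/-- All kets occurring in `x` have the levels `≤ b` occupied. -/
def FillsAll (b : ℤ) (x : FockOver B) : Prop := ∀ S, x S ≠ 0 → S.Fills b

theorem fillsAll_ket {b : ℤ} {T : Maya} (hT : T.Fills b) : FillsAll b (ketOver B T) :=
  fun _ hS => ketOver_ne_zero hS ▸ hT

theorem FillsAll.createVec {b : ℤ} {x : FockOver B} (hx : FillsAll b x) (v : ℤ →₀ B) :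
    FillsAll b (createVec v x) := by
  intro S hS
  rw [createVec_apply v le_rfl] at hS
  obtain ⟨n, _, hn⟩ := Finset.exists_ne_zero_of_sum_ne_zero hS
  rw [create_apply] at hn
  split_ifs at hn
  · have h0 : x (S.remove n) ≠ 0 := fun h0 => hn (by rw [h0, mul_zero, mul_zero])
    exact fun m hm => (hx _ h0 m hm).1
  · simp at hn

theorem fillsAll_wedge (b : ℤ) (L : ℕ) (v : Fin L → ℤ →₀ B) : FillsAll b (wedge b L v) := by
  induction L with
  | zero => exact fillsAll_ket fun n hn => hn
  | succ L ih => exact (ih _).createVec _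

theorem FillsAll.currentSum {b : ℤ} {x : FockOver B} (hx : FillsAll b x) (t : ℕ+ → B) :
    FillsAll b (currentSum t x) := by
  intro S hS
  obtain ⟨T, hT, h⟩ := exists_ket_of_apply_ne_zero hS
  obtain ⟨k, hk⟩ := exists_current_of_currentSum_ne_zero h
  exact fills_of_current_ne_zero hk (hx T hT)

/-- Every ket is a wedge product of one-particle basis states over a charged vacuum. -/
theorem exists_wedge {b : ℤ} {T : Maya} (hT : T.Fills b) :
    ∃ (L : ℕ) (a : Fin L → ℤ), ketOver B T = wedge b L fun i => Finsupp.single (a i) 1 := by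
  refine fills_induction (P := fun T => ∃ (L : ℕ) (a : Fin L → ℤ),
    ketOver B T = wedge b L fun i => Finsupp.single (a i) 1) ⟨0, Fin.elim0, rfl⟩ ?_ hT
  rintro S n _ _ hlt ⟨L, a, ha⟩
  refine ⟨L + 1, Fin.cons n a, ?_⟩
  rw [← create_ket_of_lt hlt, ha, wedge, Fin.cons_zero, createVec_single]
  simp

theorem shiftVec_apply_of_le {b : ℤ} (h : ℤ → B) (v : ℤ →₀ B) {n : ℤ} (hn : n ≤ b) :
    shiftVec b h v n = 0 := by
  rw [shiftVec, Finsupp.linearCombination_apply, Finsupp.sum, Finsupp.finsetSum_apply]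
  refine Finset.sum_eq_zero fun c _ => ?_
  rw [Finsupp.smul_apply, Finsupp.finsetSum_apply, Finset.sum_eq_zero, smul_zero]
  intro u hu
  rw [Finset.mem_Ioc] at hu
  exact Finsupp.single_eq_of_ne (by omega)

variable [Algebra ℂ B]

/-- Moving `exp (∑ p_k J_k / k)` past a creation operator. Both sides agree in top energy, and
their difference is an eigenvector of the energy operator by induction on the energy. -/
theorem currentExpEnd_create {t p : ℕ+ → B} (hp : ∀ k, p k = ((k : ℕ) : B) * t k) {h : ℤ → B}
    (hh : IsComplete p h) {b : ℤ} (n : ℕ) : ∀ (c : ℤ) (T : Maya), T.Fills b →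
      c - b + energy T ≤ n → currentExpEnd t (create c (ketOver B T))
        = createVec (shiftVec b h (Finsupp.single c 1)) (currentExpEnd t (ketOver B T)) := by
  induction n with
  | zero =>
    intro c T hT hn
    have hc : c ≤ b := by have := energy_nonneg T; omega
    rw [create_ket_of_mem (hT c hc), map_zero, createVec_shiftVec_single, Finset.Ioc_eq_empty
      (by omega), Finset.sum_empty]
  | succ n ih =>
    intro c T hT hn
    rcases le_or_gt c b with hc | hc
    · rw [create_ket_of_mem (hT c hc), map_zero, createVec_shiftVec_single, Finset.Ioc_eq_empty
        (by omega), Finset.sum_empty]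
    obtain ⟨N, hN⟩ := exists_energy_le (max (max (energy T) (energy T + c)) (c - b))
    -- the action of the energy operator on the left-hand side
    have hEc : energyOp (create c (ketOver B T))
        = ((energy T + c : ℤ) : B) • create c (ketOver B T) := by
      have e := LinearMap.congr_fun (energyOp_create (B := B) c) (ketOver B T)
      have hE : energyOp (ketOver B T) = (energy T : B) • ketOver B T := by simp [energyOp]
      simp only [Module.End.mul_apply, LinearMap.add_apply, LinearMap.smul_apply, hE,
        map_smul] at e
      rw [e, ← add_smul]; push_cast; rfl
    have hL : energyOp (currentExpEnd t (create c (ketOver B T)))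
        = ((energy T + c : ℤ) : B) • currentExpEnd t (create c (ketOver B T))
          - currentExpEnd t (currentSum p (create c (ketOver B T))) := by
      by_cases hcT : c ∈ T.occ
      · simp [create_ket_of_mem hcT]
      · rw [create_ket hcT, map_smul, map_smul, energyOp_currentExpEnd hp, smul_sub, smul_comm,
          energy, energy, weight_add id hcT, map_smul, map_smul]
        simp
    have hcur : currentExpEnd t (currentSum p (create c (ketOver B T)))
        = createVec (shiftVec b h (Finsupp.single c 1))
            (currentExpEnd t (currentSum p (ketOver B T)))
          + ∑ k ∈ Finset.Icc 1 N, p k • createVec (shiftVec b h (Finsupp.single (c - k) 1))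
              (currentExpEnd t (ketOver B T)) := by
      rw [currentSum_create p (N := N) (by omega) (by omega), map_add, map_sum]
      congr 1
      · refine fock_congr (f := currentExpEnd t ∘ₗ create c)
          (g := createVec (shiftVec b h (Finsupp.single c 1)) ∘ₗ currentExpEnd t) fun U hU => ?_
        have h1 := (energyLE_ket (B := B) T).currentSum p U hU
        have h2 := (fillsAll_ket (B := B) hT).currentSum p U hU
        exact ih c U h2 (by push_cast at hn; omega)
      · refine Finset.sum_congr rfl fun k _ => ?_
        have := k.pos
        rw [map_smul, ih (c - k) T hT (by push_cast at hn; omega)]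
    have hR := energyOp_createVec_shiftVec hh b c (N := N) (by omega)
      (currentExpEnd t (ketOver B T))
    rw [energyOp_currentExpEnd hp, map_sub, map_smul] at hR
    ext S
    have hLS := congrArg (fun x : FockOver B => x S) hL
    have hRS := congrArg (fun x : FockOver B => x S) hR
    have hcS := congrArg (fun x : FockOver B => x S) hcur
    simp only [energyOp_apply, Finsupp.sub_apply, Finsupp.add_apply, Finsupp.smul_apply,
      smul_eq_mul] at hLS hRS hcS
    rcases eq_or_ne (energy S) (energy T + c) with hS | hS
    -- the top-energy component
    · rw [currentExpEnd_apply_of_energyLE, createVec_shiftVec_single, Finsupp.finsetSum_apply,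
        Finset.sum_eq_single c]
      · rw [sub_self, hh.zero, one_smul, create_apply, create_apply]
        split_ifs with hcS'
        · rw [currentExpEnd_apply_of_energyLE]
          refine (energyLE_ket T).mono ?_
          rw [energy, energy, weight_remove id hcS', ← energy, ← energy, hS]
          simp
        · rfl
      · intro u hu huc
        rw [Finset.mem_Ioc] at hu
        rw [Finsupp.smul_apply, create_apply]
        split_ifs with huS
        · by_contra h0
          have h1 : currentExpEnd t (ketOver B T) (S.remove u) ≠ 0 := fun h1 => h0 (by
            rw [h1]; simp)
          have h2 := (energyLE_ket T).currentExpEnd t _ h1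
          rw [energy, weight_remove id huS, ← energy, hS] at h2
          simp only [id] at h2
          omega
        · simp
      · intro hcI
        exact absurd (Finset.mem_Ioc.2 ⟨hc, le_rfl⟩) hcI
      · intro U hU
        rw [create_apply] at hU
        split_ifs at hU with hcU
        · have h1 : U.remove c = T := ketOver_ne_zero fun h1 => hU (by rw [h1, mul_zero])
          rw [hS, ← h1, energy, energy, weight_remove id hcU]
          simp
        · exact absurd rfl hU
    -- below the top energy both sides are determined by the commutator with the energy
    · have h0 : ((energy S - (energy T + c) : ℤ) : ℂ) ≠ 0 := by
        exact_mod_cast sub_ne_zero.2 hS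
      have hunit : IsUnit (((energy S - (energy T + c) : ℤ) : B)) := by
        rw [← map_intCast (algebraMap ℂ B)]
        exact (IsUnit.mk0 _ h0).map _
      refine hunit.mul_left_cancel ?_
      rw [hcS] at hLS
      push_cast at hLS hRS ⊢
      linear_combination hLS - hRS

theorem currentExpEnd_createVec {t p : ℕ+ → B} (hp : ∀ k, p k = ((k : ℕ) : B) * t k)
    {h : ℤ → B} (hh : IsComplete p h) {b : ℤ} (v : ℤ →₀ B) {x : FockOver B}
    (hx : FillsAll b x) : currentExpEnd t (createVec v x)
      = createVec (shiftVec b h v) (currentExpEnd t x) := by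
  induction v using Finsupp.induction_linear with
  | zero => simp [createVec]
  | add v w hv hw =>
    simp only [createVec, map_add, LinearMap.add_apply] at hv hw ⊢
    rw [hv, hw]
  | single c a =>
    have key := fock_congr (f := currentExpEnd t ∘ₗ create c)
      (g := createVec (shiftVec b h (Finsupp.single c 1)) ∘ₗ currentExpEnd t) (x := x)
      fun T hT => currentExpEnd_create hp hh (c - b + energy T).toNat c T (hx T hT) (by omega)
    have hs : (Finsupp.single c a : ℤ →₀ B) = a • Finsupp.single c 1 := by simp
    simp only [LinearMap.comp_apply, createVec] at key ⊢
    rw [hs, map_smul, map_smul, map_smul, Finsupp.linearCombination_single, one_smul,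
      LinearMap.smul_apply, LinearMap.smul_apply, map_smul, key]

/-- `exp (∑ p_k J_k / k)` acts on wedge products factor by factor. -/
theorem currentExpEnd_wedge {t p : ℕ+ → B} (hp : ∀ k, p k = ((k : ℕ) : B) * t k)
    {h : ℤ → B} (hh : IsComplete p h) (b : ℤ) (L : ℕ) (v : Fin L → ℤ →₀ B) :
    currentExpEnd t (wedge b L v) = wedge b L fun i => shiftVec b h (v i) := by
  induction L with
  | zero => exact currentExpEnd_ket_base t b
  | succ L ih =>
    rw [wedge, currentExpEnd_createVec hp hh _ (fillsAll_wedge b L _), ih]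
    rfl

/-- Matrix elements of `exp (∑ p_k J_k / k)` are minors of the Toeplitz matrix of the `h_m`. -/
theorem currentExpEnd_apply_eq_det {t p : ℕ+ → B} (hp : ∀ k, p k = ((k : ℕ) : B) * t k)
    {h : ℤ → B} (hh : IsComplete p h) {b : ℤ} {L : ℕ} {a c : Fin L → ℤ} {S T : Maya}
    (hS : ketOver B S = wedge b L fun i => Finsupp.single (a i) 1)
    (hT : ketOver B T = wedge b L fun i => Finsupp.single (c i) 1) (ha : ∀ i, b < a i) :
    currentExpEnd t (ketOver B T) S = Matrix.det (Matrix.of fun i j => h (c i - a j)) := by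
  rw [hT, currentExpEnd_wedge hp hh, ← ket_pairing, hS, pairing_wedge, ← Matrix.det_transpose]
  · congr 1
    ext i j
    rw [Matrix.transpose_apply, Matrix.of_apply, Matrix.of_apply, single_dot, one_mul,
      shiftVec_single_apply b hh.neg, if_pos (ha j)]
  · intro i n hn
    exact Finsupp.single_eq_of_ne (by have := ha i; omega)

/-- Matrix elements of `exp (∑ p_k J_{-k} / k) exp (∑ p_k J_k / k)`, as determinants. -/
theorem pairing_currentExpEnd {t p : ℕ+ → B} (hp : ∀ k, p k = ((k : ℕ) : B) * t k)
    {h : ℤ → B} (hh : IsComplete p h) {b : ℤ} {L : ℕ} {a c : Fin L → ℤ} {S T : Maya}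
    (hS : ketOver B S = wedge b L fun i => Finsupp.single (a i) 1)
    (hT : ketOver B T = wedge b L fun i => Finsupp.single (c i) 1) :
    pairing (currentExpEnd t (ketOver B S)) (currentExpEnd t (ketOver B T))
      = Matrix.det (Matrix.of fun i j =>
          ∑ u ∈ Finset.Ioc b (a i), h (a i - u) * h (c j - u)) := by
  rw [hT, hS, currentExpEnd_wedge hp hh, currentExpEnd_wedge hp hh,
    pairing_wedge L fun i n hn => shiftVec_apply_of_le h _ hn]
  congr 1
  ext i j
  rw [Matrix.of_apply, Matrix.of_apply]
  nth_rw 1 [shiftVec]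
  rw [Finsupp.linearCombination_single, one_smul, map_sum, LinearMap.sum_apply]
  refine Finset.sum_congr rfl fun u hu => ?_
  rw [Finset.mem_Ioc] at hu
  rw [single_dot, shiftVec_single_apply b hh.neg, if_pos hu.1]

end

/-! ### Complete symmetric functions -/

section
variable {B : Type*} [CommRing B] [Algebra ℂ B]

/-- The generating series `exp (∑_{k ≥ 1} p_k z^k / k)` of the complete symmetric functions. -/
def completeSeries (p : ℕ+ → B) : PowerSeries B :=
  (PowerSeries.exp ℂ).subst (powerSumSeries p)

/-- The series `∑_{k ≥ 1} p_k z^{k-1}`, the logarithmic derivative of `completeSeries p`. -/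
def logDerivSeries (p : ℕ+ → B) : PowerSeries B := PowerSeries.mk fun n => p n.succPNat

theorem hasSubst_powerSumSeries (p : ℕ+ → B) : PowerSeries.HasSubst (powerSumSeries p) := by
  refine PowerSeries.HasSubst.of_constantCoeff_zero' ?_
  rw [← PowerSeries.coeff_zero_eq_constantCoeff_apply]
  simp [powerSumSeries]

theorem derivative_powerSumSeries (p : ℕ+ → B) :
    PowerSeries.derivative B (powerSumSeries p) = logDerivSeries p := by
  ext n
  rw [PowerSeries.coeff_derivative, powerSumSeries, logDerivSeries, PowerSeries.coeff_mk,
    PowerSeries.coeff_mk, dif_pos n.succ_pos, mul_comm]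
  have h : ((n : B) + 1) = algebraMap ℂ B (n + 1) := by simp
  have h0 : (n : ℂ) + 1 ≠ 0 := by exact_mod_cast n.succ_ne_zero
  rw [h, ← Algebra.smul_def, smul_smul]
  push_cast
  rw [mul_inv_cancel₀ h0, one_smul]
  rfl

theorem derivative_completeSeries (p : ℕ+ → B) :
    PowerSeries.derivative B (completeSeries p) = completeSeries p * logDerivSeries p := by
  let : Algebra ℚ B := Algebra.compHom B (algebraMap ℚ ℂ)
  have h : completeSeries p = (PowerSeries.exp B).subst (powerSumSeries p) := by
    ext n
    rw [completeSeries, PowerSeries.coeff_subst' (hasSubst_powerSumSeries p),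
      PowerSeries.coeff_subst' (hasSubst_powerSumSeries p)]
    refine finsum_congr fun d => ?_
    rw [PowerSeries.coeff_exp, PowerSeries.coeff_exp, smul_eq_mul, Algebra.smul_def]
    rfl
  rw [h, PowerSeries.derivative_subst (hasSubst_powerSumSeries p), PowerSeries.derivative_exp,
    derivative_powerSumSeries]

theorem constantCoeff_completeSeries (p : ℕ+ → B) :
    PowerSeries.constantCoeff (completeSeries p) = 1 := by
  rw [completeSeries, ← PowerSeries.coeff_zero_eq_constantCoeff_apply,
    PowerSeries.coeff_subst' (hasSubst_powerSumSeries p), finsum_eq_single _ 0]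
  · simp
  · intro d hd
    have : PowerSeries.constantCoeff (powerSumSeries p) = 0 := by
      rw [← PowerSeries.coeff_zero_eq_constantCoeff_apply]
      simp [powerSumSeries]
    simp [this, hd]

theorem isUnit_natCast_add_one (n : ℕ) : IsUnit ((n : B) + 1) := by
  have h : ((n : B) + 1) = algebraMap ℂ B (n + 1) := by simp
  rw [h]
  exact (IsUnit.mk0 _ (by exact_mod_cast n.succ_ne_zero)).map _

/-- A series is determined by its constant coefficient and its logarithmic derivative. -/
theorem eq_completeSeries {p : ℕ+ → B} {F : PowerSeries B}
    (h0 : PowerSeries.constantCoeff F = 1)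
    (hF : PowerSeries.derivative B F = F * logDerivSeries p) : F = completeSeries p := by
  ext n
  induction n using Nat.strong_induction_on with
  | _ n ih =>
    rcases n with _ | n
    · rw [PowerSeries.coeff_zero_eq_constantCoeff_apply, h0,
        PowerSeries.coeff_zero_eq_constantCoeff_apply, constantCoeff_completeSeries]
    · have h1 := congrArg (PowerSeries.coeff n) hF
      have h2 := congrArg (PowerSeries.coeff n) (derivative_completeSeries p)
      rw [PowerSeries.coeff_derivative, PowerSeries.coeff_mul] at h1 h2
      refine (isUnit_natCast_add_one n).mul_right_cancel ?_
      rw [h1, h2]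
      refine Finset.sum_congr rfl fun ij hij => ?_
      have := Finset.HasAntidiagonal.mem_antidiagonal.1 hij
      rw [ih ij.1 (by omega)]

theorem completeSeries_add (p p' : ℕ+ → B) :
    completeSeries (fun k => p k + p' k) = completeSeries p * completeSeries p' := by
  refine (eq_completeSeries ?_ ?_).symm
  · rw [map_mul, constantCoeff_completeSeries, constantCoeff_completeSeries, one_mul]
  · have : logDerivSeries (fun k => p k + p' k) = logDerivSeries p + logDerivSeries p' := by
      ext n; simp [logDerivSeries]
    rw [Derivation.leibniz, derivative_completeSeries, derivative_completeSeries, this,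
      smul_eq_mul, smul_eq_mul]
    ring

theorem completeSeries_pow_mul (c : B) (p : ℕ+ → B) :
    completeSeries (fun k => c ^ (k : ℕ) * p k) = PowerSeries.rescale c (completeSeries p) := by
  refine (eq_completeSeries ?_ ?_).symm
  · rw [← PowerSeries.coeff_zero_eq_constantCoeff_apply, PowerSeries.coeff_rescale,
      PowerSeries.coeff_zero_eq_constantCoeff_apply, constantCoeff_completeSeries]
    simp
  · ext n
    have h := congrArg (PowerSeries.coeff n) (derivative_completeSeries p)
    rw [PowerSeries.coeff_derivative, PowerSeries.coeff_mul] at h ⊢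
    rw [PowerSeries.coeff_rescale, mul_assoc, h, Finset.mul_sum]
    refine Finset.sum_congr rfl fun ij hij => ?_
    rw [PowerSeries.coeff_rescale, ← Finset.HasAntidiagonal.mem_antidiagonal.1 hij]
    simp only [logDerivSeries, PowerSeries.coeff_mk, Nat.succPNat_coe, pow_succ, pow_add]
    ring

theorem completeSeries_zero : completeSeries (fun _ => (0 : B)) = 1 := by
  refine (eq_completeSeries (by simp) ?_).symm
  ext n
  simp [logDerivSeries]

/-- The complete symmetric functions of a single variable `y`. -/
theorem completeSeries_pow_mul_geom (y : B) :
    completeSeries (fun k => y ^ (k : ℕ)) = PowerSeries.mk fun n => y ^ n := by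
  refine (eq_completeSeries (by simp) ?_).symm
  ext n
  rw [PowerSeries.coeff_derivative, PowerSeries.coeff_mul]
  rw [Finset.sum_congr rfl (g := fun _ => y ^ (n + 1)) fun ij hij => ?_]
  · simp [mul_comm]
  · rw [← Finset.HasAntidiagonal.mem_antidiagonal.1 hij]
    simp only [logDerivSeries, PowerSeries.coeff_mk, Nat.succPNat_coe, Nat.succ_eq_add_one]
    ring

theorem one_sub_mul_completeSeries (y : B) :
    (1 - PowerSeries.C y * PowerSeries.X) * completeSeries (fun k => y ^ (k : ℕ)) = 1 := by
  rw [completeSeries_pow_mul_geom]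
  ext n
  rw [sub_mul, one_mul, map_sub, PowerSeries.coeff_mk, mul_assoc, PowerSeries.coeff_C_mul]
  rcases n with _ | n
  · simp
  · rw [PowerSeries.coeff_succ_X_mul, PowerSeries.coeff_mk, PowerSeries.coeff_one,
      if_neg n.succ_ne_zero]
    ring

theorem schurOne_natCast (p : ℕ+ → B) (n : ℕ) :
    schurOne p n = PowerSeries.coeff n (completeSeries p) := by
  simp [schurOne, completeSeries]

theorem schurOne_of_neg (p : ℕ+ → B) {m : ℤ} (hm : m < 0) : schurOne p m = 0 := by
  simp [schurOne, not_le.2 hm]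

theorem schurOne_zero (p : ℕ+ → B) : schurOne p 0 = 1 := by
  rw [show (0 : ℤ) = ((0 : ℕ) : ℤ) from rfl, schurOne_natCast,
    PowerSeries.coeff_zero_eq_constantCoeff_apply, constantCoeff_completeSeries]

theorem isComplete_schurOne (p : ℕ+ → B) : IsComplete p (schurOne p) where
  neg _ hm := schurOne_of_neg p hm
  zero := schurOne_zero p
  newton m N hm := by
    have hsum : ∀ f : ℕ+ → B, ∑ k ∈ Finset.Icc 1 N, f k = ∑ j ∈ Finset.range N, f j.succPNat := by
      intro f
      refine (Finset.sum_bij (fun j _ => j.succPNat) (fun j hj => ?_) (fun i _ j _ h => ?_)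
        (fun k hk => ?_) fun _ _ => rfl).symm
      · rw [Finset.mem_range] at hj
        rw [Finset.mem_Icc, ← PNat.coe_le_coe, ← PNat.coe_le_coe, Nat.succPNat_coe]
        simp; omega
      · exact Nat.succPNat_injective h
      · refine ⟨k.natPred, ?_, PNat.succPNat_natPred k⟩
        have h2 := k.natPred_add_one
        have h1 : (k : ℕ) ≤ N := (Finset.mem_Icc.1 hk).2
        rw [Finset.mem_range]
        omega
    rw [hsum]
    rcases lt_trichotomy m 0 with h | rfl | h
    · rw [schurOne_of_neg p h, mul_zero, Finset.sum_eq_zero]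
      intro j _
      rw [schurOne_of_neg p (by rw [Nat.succPNat_coe]; omega), mul_zero]
    · rw [Int.cast_zero, zero_mul, Finset.sum_eq_zero]
      intro j _
      rw [schurOne_of_neg p (by rw [Nat.succPNat_coe]; omega), mul_zero]
    · obtain ⟨n, rfl⟩ : ∃ n : ℕ, m = ((n + 1 : ℕ) : ℤ) := ⟨(m - 1).toNat, by omega⟩
      have h := congrArg (PowerSeries.coeff n) (derivative_completeSeries p)
      rw [PowerSeries.coeff_derivative, PowerSeries.coeff_mul,
        ← Finset.Nat.sum_antidiagonal_swap, Finset.Nat.sum_antidiagonal_eq_sum_range_succ_mk] at h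
      rw [schurOne_natCast, Int.cast_natCast, Nat.cast_succ, mul_comm, h]
      have hsub : Finset.range n.succ ⊆ Finset.range N := Finset.range_mono (by
        have : ((n + 1 : ℕ) : ℤ) ≤ ((N : ℕ) : ℤ) := hm
        omega)
      rw [← Finset.sum_subset hsub]
      · refine Finset.sum_congr rfl fun j hj => ?_
        rw [Finset.mem_range] at hj
        have : ((n + 1 : ℕ) : ℤ) - (j.succPNat : ℕ) = ((n - j : ℕ) : ℤ) := by
          rw [Nat.succPNat_coe]; omega
        rw [this, schurOne_natCast, mul_comm]
        simp [logDerivSeries]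
      · intro j _ hj
        rw [Finset.mem_range] at hj
        rw [schurOne_of_neg p (by rw [Nat.succPNat_coe]; omega), mul_zero]

theorem schurOne_pow_mul (c : B) (p : ℕ+ → B) {m : ℤ} :
    schurOne (fun k => c ^ (k : ℕ) * p k) m = c ^ m.toNat * schurOne p m := by
  rcases lt_or_ge m 0 with h | h
  · rw [schurOne_of_neg _ h, schurOne_of_neg _ h, mul_zero]
  · lift m to ℕ using h
    rw [schurOne_natCast, schurOne_natCast, completeSeries_pow_mul, PowerSeries.coeff_rescale]
    simp

/-- The complete symmetric functions of the union of two alphabets. -/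
theorem schurOne_add (p p' : ℕ+ → B) (u c : ℤ) :
    schurOne (fun k => p k + p' k) (c - u)
      = ∑ w ∈ Finset.Icc u c, schurOne p (c - w) * schurOne p' (w - u) := by
  rcases lt_or_ge c u with h | h
  · rw [schurOne_of_neg _ (by omega), Finset.Icc_eq_empty (by omega), Finset.sum_empty]
  · obtain ⟨n, rfl⟩ : ∃ n : ℕ, c = u + n := ⟨(c - u).toNat, by omega⟩
    rw [add_sub_cancel_left, schurOne_natCast, completeSeries_add, PowerSeries.coeff_mul]
    refine Finset.sum_bij (fun ij _ => u + ij.2) (fun ij hij => ?_) (fun i hi j hj h => ?_)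
      (fun w hw => ?_) fun ij hij => ?_
    · have := Finset.HasAntidiagonal.mem_antidiagonal.1 hij
      rw [Finset.mem_Icc]; omega
    · have h1 := Finset.HasAntidiagonal.mem_antidiagonal.1 hi
      have h2 := Finset.HasAntidiagonal.mem_antidiagonal.1 hj
      ext <;> omega
    · rw [Finset.mem_Icc] at hw
      exact ⟨((u + n - w).toNat, (w - u).toNat), Finset.HasAntidiagonal.mem_antidiagonal.2 (by simp; omega),
        by simp; omega⟩
    · have := Finset.HasAntidiagonal.mem_antidiagonal.1 hij
      rw [show u + (n : ℤ) - (u + ij.2) = (ij.1 : ℕ) by omega,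
        show u + (ij.2 : ℤ) - u = (ij.2 : ℕ) by omega, schurOne_natCast, schurOne_natCast]

/-- The Jacobi–Trudi determinant does not change if empty rows are added to the partition. -/
theorem schur_eq_det (μ : YoungDiagram) (p : ℕ+ → B) {L : ℕ} (hL : μ.colLen 0 ≤ L) :
    schur μ p = Matrix.det (Matrix.of fun i j : Fin L =>
      schurOne p ((μ.rowLen i : ℤ) - (i : ℤ) + (j : ℤ))) := by
  induction L, hL using Nat.le_induction with
  | base => rfl
  | succ L hL ih =>
    have h0 : μ.rowLen L = 0 := by
      by_contra h
      have h1 : (L, 0) ∈ μ := by rw [YoungDiagram.mem_iff_lt_rowLen]; omega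
      rw [YoungDiagram.mem_iff_lt_colLen] at h1
      omega
    rw [Matrix.det_succ_row _ (Fin.last L), Finset.sum_eq_single (Fin.last L), ih]
    · have h1 : (-1 : B) ^ (((Fin.last L : Fin (L + 1)) : ℕ) + ((Fin.last L : Fin (L + 1)) : ℕ)) = 1 := by
        rw [← two_mul, pow_mul]; simp
      rw [h1, one_mul, Matrix.of_apply, Fin.val_last, h0, Nat.cast_zero, zero_sub, neg_add_cancel,
        schurOne_zero, one_mul]
      congr 1
      ext i j
      simp
    · intro j _ hj
      have hj' : (j : ℕ) < L := lt_of_le_of_ne (Nat.lt_succ_iff.1 j.2) fun h => hj (Fin.ext h)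
      rw [Matrix.of_apply, Fin.val_last, h0, schurOne_of_neg _ (by push_cast; omega)]
      simp
    · simp

end

/-! ### Partitions as Maya diagrams -/

section
variable {B : Type*} [CommRing B]

/-- A Maya diagram with the levels `≤ b` and the levels `a₀ > a₁ > ⋯ > a_{L-1} > b` occupied. -/
structure IsListing (b : ℤ) (L : ℕ) (a : Fin L → ℤ) (S : Maya) : Prop where
  anti : StrictAnti a
  lt : ∀ i, b < a i
  mem_iff : ∀ n, n ∈ S.occ ↔ n ≤ b ∨ ∃ i, n = a i

theorem IsListing.zero_iff {b : ℤ} {a : Fin 0 → ℤ} {S : Maya} (h : IsListing b 0 a S) :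
    S = base b :=
  eq_of_mem_iff fun n => by simp [h.mem_iff]

theorem IsListing.succ {b : ℤ} {L : ℕ} {a : Fin (L + 1) → ℤ} {S : Maya}
    (h : IsListing b (L + 1) a S) : IsListing b L (fun i => a i.succ) (S.remove (a 0)) ∧
      ∀ m ∈ (S.remove (a 0)).occ, m < a 0 := by
  have h0 : ∀ i : Fin L, a i.succ < a 0 := fun i => h.anti (Fin.succ_pos i)
  have hmem : ∀ n, n ∈ (S.remove (a 0)).occ ↔ n ≤ b ∨ ∃ i : Fin L, n = a i.succ := by
    intro n
    rw [mem_remove, h.mem_iff, Fin.exists_fin_succ]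
    constructor
    · tauto
    · rintro (hn | ⟨i, rfl⟩)
      · exact ⟨Or.inl hn, by have := h.lt 0; omega⟩
      · exact ⟨Or.inr (Or.inr ⟨i, rfl⟩), (h0 i).ne⟩
  refine ⟨⟨fun i j hij => h.anti (Fin.succ_lt_succ_iff.2 hij), fun i => h.lt _, hmem⟩, ?_⟩
  intro m hm
  rcases (hmem m).1 hm with hm | ⟨i, rfl⟩
  · have := h.lt 0; omega
  · exact h0 i

theorem IsListing.zero_mem {b : ℤ} {L : ℕ} {a : Fin (L + 1) → ℤ} {S : Maya}
    (h : IsListing b (L + 1) a S) : a 0 ∈ S.occ := (h.mem_iff _).2 (Or.inr ⟨0, rfl⟩)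

theorem IsListing.ket_eq {b : ℤ} {L : ℕ} {a : Fin L → ℤ} {S : Maya} (h : IsListing b L a S) :
    ketOver B S = wedge b L fun i => Finsupp.single (a i) 1 := by
  induction L generalizing S with
  | zero => rw [h.zero_iff]; rfl
  | succ L ih =>
    rw [wedge, ← ih h.succ.1, createVec_single, create_ket_of_lt h.succ.2, add_remove h.zero_mem]

theorem IsListing.weight_eq {A : Type*} [AddCommGroup A] (f : ℤ → A) {b : ℤ} {L : ℕ}
    {a : Fin L → ℤ} {S : Maya} (h : IsListing b L a S) :
    weight f S = weight f (base b) + ∑ i, f (a i) := by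
  induction L generalizing S with
  | zero => rw [h.zero_iff]; simp
  | succ L ih =>
    have := ih h.succ.1
    rw [weight_remove f h.zero_mem, sub_eq_iff_eq_add] at this
    rw [this, Fin.sum_univ_succ]
    abel

theorem exists_isListing {b : ℤ} {S : Maya} (hS : S.Fills b) :
    ∃ (L : ℕ) (a : Fin L → ℤ), IsListing b L a S := by
  refine fills_induction (P := fun S => ∃ (L : ℕ) (a : Fin L → ℤ), IsListing b L a S)
    ⟨0, Fin.elim0, fun i => i.elim0, fun i => i.elim0, by simp⟩ ?_ hS
  rintro S n _ hbn hlt ⟨L, a, ha⟩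
  have hn : ∀ i, a i < n := fun i => hlt _ ((ha.mem_iff _).2 (Or.inr ⟨i, rfl⟩))
  refine ⟨L + 1, Fin.cons n a, ?_, ?_, fun m => ?_⟩
  · intro i j hij
    induction j using Fin.cases with
    | zero => exact absurd hij (by simp)
    | succ j =>
      induction i using Fin.cases with
      | zero => simpa using hn j
      | succ i => simpa using ha.anti (Fin.succ_lt_succ_iff.1 hij)
  · intro i
    induction i using Fin.cases with
    | zero => simpa using hbn
    | succ i => simpa using ha.lt i
  · rw [mem_add, ha.mem_iff, Fin.exists_fin_succ]
    simp only [Fin.cons_zero, Fin.cons_succ]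
    tauto

end

theorem rowLen_eq_zero {ν : YoungDiagram} {i : ℕ} (hi : ν.colLen 0 ≤ i) : ν.rowLen i = 0 := by
  by_contra h
  have h1 : (i, 0) ∈ ν := by rw [YoungDiagram.mem_iff_lt_rowLen]; omega
  rw [YoungDiagram.mem_iff_lt_colLen] at h1
  omega

theorem rowLen_succ_le (ν : YoungDiagram) (i : ℕ) : ν.rowLen (i + 1) ≤ ν.rowLen i :=
  ν.rowLen_anti i (i + 1) (Nat.le_succ i)

/-- The occupied levels `ν_i - i` (for `i ≥ 0`) of the state `|ν, 0⟩`, in decreasing order. -/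
def level (ν : YoungDiagram) (i : ℕ) : ℤ := (ν.rowLen i : ℤ) - i

theorem level_strictAnti (ν : YoungDiagram) : StrictAnti (level ν) :=
  strictAnti_nat_of_succ_lt fun i => by
    have := rowLen_succ_le ν i
    simp only [level]; push_cast; omega

/-- The Maya diagram of `|ν, 0⟩`. -/
def toMaya (ν : YoungDiagram) : Maya where
  occ := Set.range (level ν)
  finite_particles := by
    refine ((Finset.range (ν.colLen 0)).finite_toSet.image (level ν)).subset ?_
    rintro n ⟨⟨i, rfl⟩, h⟩
    refine ⟨i, ?_, rfl⟩
    simp only [Finset.coe_range, Set.mem_Iio]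
    by_contra hi
    rw [level, rowLen_eq_zero (not_lt.1 hi)] at h
    omega
  finite_holes := by
    refine (Set.finite_Ioc (-(ν.colLen 0 : ℤ)) 0).subset ?_
    rintro n ⟨h, h0⟩
    refine ⟨?_, h0⟩
    by_contra hn
    refine h ⟨(-n).toNat, ?_⟩
    rw [level, rowLen_eq_zero (by omega)]
    omega

theorem mem_toMaya {ν : YoungDiagram} {n : ℤ} : n ∈ (toMaya ν).occ ↔ ∃ i, level ν i = n := Iff.rfl

theorem toMaya_injective : Function.Injective toMaya := by
  intro μ ν h
  have hr : Set.range (level μ) = Set.range (level ν) := congrArg Maya.occ h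
  have hneg : (fun i => -level μ i) = fun i => -level ν i := by
    refine StrictMono.range_inj (fun i j hij => neg_lt_neg (level_strictAnti μ hij))
      (fun i j hij => neg_lt_neg (level_strictAnti ν hij)) |>.1 ?_
    have : ∀ f : ℕ → ℤ, Set.range (fun i => -f i) = (fun x => -x) '' Set.range f := fun f => by
      rw [← Set.range_comp]; rfl
    rw [this, this, hr]
  have hrow : ∀ i, μ.rowLen i = ν.rowLen i := fun i => by
    have := congrFun hneg i
    simp only [level] at this
    omega
  ext ⟨i, j⟩
  rw [YoungDiagram.mem_cells, YoungDiagram.mem_cells, YoungDiagram.mem_iff_lt_rowLen,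
    YoungDiagram.mem_iff_lt_rowLen, hrow]

theorem isListing_toMaya (ν : YoungDiagram) {L : ℕ} (hL : ν.colLen 0 ≤ L) :
    IsListing (-L) L (fun i => level ν i) (toMaya ν) where
  anti i j hij := level_strictAnti ν hij
  lt i := by simp only [level]; omega
  mem_iff n := by
    rw [mem_toMaya]
    constructor
    · rintro ⟨i, rfl⟩
      rcases lt_or_ge i L with h | h
      · exact Or.inr ⟨⟨i, h⟩, rfl⟩
      · left; rw [level, rowLen_eq_zero (hL.trans h)]; omega
    · rintro (h | ⟨i, rfl⟩)
      · refine ⟨(-n).toNat, ?_⟩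
        rw [level, rowLen_eq_zero (by omega)]; omega
      · exact ⟨i, rfl⟩

theorem rowLen_bot (i : ℕ) : (⊥ : YoungDiagram).rowLen i = 0 := by
  by_contra h
  have : (i, 0) ∈ (⊥ : YoungDiagram) := by rw [YoungDiagram.mem_iff_lt_rowLen]; omega
  exact YoungDiagram.notMem_bot _ this

theorem colLen_bot (i : ℕ) : (⊥ : YoungDiagram).colLen i = 0 := by
  by_contra h
  have : (0, i) ∈ (⊥ : YoungDiagram) := by rw [YoungDiagram.mem_iff_lt_colLen]; omega
  exact YoungDiagram.notMem_bot _ this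

theorem toMaya_bot : toMaya ⊥ = vac := by
  refine eq_of_mem_iff fun n => ?_
  rw [mem_toMaya, vac_eq_base, mem_base]
  constructor
  · rintro ⟨i, rfl⟩; simp [level, rowLen_bot]
  · intro h; exact ⟨(-n).toNat, by simp only [level, rowLen_bot]; omega⟩

theorem weight_toMaya {A : Type*} [AddCommGroup A] (f : ℤ → A) (ν : YoungDiagram) :
    weight f (toMaya ν) = ∑ i ∈ Finset.range (ν.colLen 0), (f (level ν i) - f (-i)) := by
  have h1 := (isListing_toMaya ν le_rfl).weight_eq f
  have h2 := (isListing_toMaya ⊥ (L := ν.colLen 0) (by simp [colLen_bot])).weight_eq f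
  rw [toMaya_bot, weight_vac, eq_comm] at h2
  rw [h1, eq_neg_of_add_eq_zero_left h2, neg_add_eq_sub, ← Finset.sum_sub_distrib,
    ← Fin.sum_univ_eq_sum_range (fun i => f (level ν i) - f (-i))]
  simp [level, rowLen_bot]

/-- The Young diagram with given row lengths. -/
def ofRows (f : ℕ → ℕ) (hf : Antitone f) (L : ℕ) : YoungDiagram where
  cells := (Finset.range L ×ˢ Finset.range (f 0)).filter fun c => c.2 < f c.1
  isLowerSet := by
    rintro ⟨i, j⟩ ⟨i', j'⟩ ⟨hi : i' ≤ i, hj : j' ≤ j⟩ h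
    simp only [Finset.coe_filter, Finset.mem_product, Finset.mem_range, Set.mem_ofPred_eq] at h ⊢
    have := hf hi
    omega

theorem rowLen_ofRows {f : ℕ → ℕ} (hf : Antitone f) {L : ℕ} (h0 : ∀ i, L ≤ i → f i = 0) (i : ℕ) :
    (ofRows f hf L).rowLen i = f i := by
  have h : ∀ j, j < (ofRows f hf L).rowLen i ↔ j < f i := by
    intro j
    rw [← YoungDiagram.mem_iff_lt_rowLen, ← YoungDiagram.mem_cells]
    simp only [ofRows, Finset.mem_filter, Finset.mem_product, Finset.mem_range]
    constructor
    · exact fun h => h.2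
    · intro h
      refine ⟨⟨?_, h.trans_le (hf (Nat.zero_le i))⟩, h⟩
      by_contra hi
      rw [h0 i (not_lt.1 hi)] at h
      omega
  exact le_antisymm (le_of_not_gt fun hlt => ((h _).1 hlt).false)
    (le_of_not_gt fun hlt => ((h _).2 hlt).false)

theorem weight_one_base_neg (L : ℕ) : weight (fun _ => (1 : ℤ)) (base (-L)) = -L := by
  have h := (isListing_toMaya ⊥ (L := L) (by simp [colLen_bot])).weight_eq fun _ => (1 : ℤ)
  rw [toMaya_bot, weight_vac] at h
  simp at h
  omega

/-- The Maya diagrams of charge zero are those of partitions. -/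
theorem exists_toMaya_eq {S : Maya} (hS : weight (fun _ => (1 : ℤ)) S = 0) :
    ∃ ν, toMaya ν = S := by
  obtain ⟨b, hb⟩ := S.exists_fills
  obtain ⟨L, hL⟩ : ∃ L : ℕ, (-L : ℤ) ≤ b := ⟨(-b).toNat, by omega⟩
  obtain ⟨L', a, ha⟩ := exists_isListing (hb.mono hL)
  have hw := ha.weight_eq fun _ => (1 : ℤ)
  rw [hS, weight_one_base_neg] at hw
  simp only [Finset.sum_const, Finset.card_univ, Fintype.card_fin, mul_one, nsmul_eq_mul] at hw
  obtain rfl : L' = L := by omega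
  clear hw
  -- the enumeration of all occupied levels in decreasing order
  let g : ℕ → ℤ := fun i => if h : i < L' then a ⟨i, h⟩ else -i
  have hg1 : ∀ i (h : i < L'), g i = a ⟨i, h⟩ := fun i h => dif_pos h
  have hg2 : ∀ i, L' ≤ i → g i = -i := fun i h => dif_neg (not_lt.2 h)
  have hlt : ∀ i, g (i + 1) < g i := by
    intro i
    rcases lt_or_ge (i + 1) L' with h | h
    · rw [hg1 _ h, hg1 i (by omega)]
      exact ha.anti (Fin.mk_lt_mk.2 (Nat.lt_succ_self i))
    · rw [hg2 _ h]
      rcases lt_or_ge i L' with h' | h'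
      · have := ha.lt ⟨i, h'⟩
        rw [hg1 i h']
        push_cast; omega
      · rw [hg2 i h']; push_cast; omega
  have hanti : Antitone fun i => g i + i := antitone_nat_of_succ_le fun i => by
    have := hlt i
    push_cast; omega
  have hnonneg : ∀ i, 0 ≤ g i + i := fun i => by
    have h1 := hanti (le_max_left i L')
    have h2 := hg2 (max i L') (le_max_right i L')
    simp only at h1
    rw [h2] at h1
    omega
  have hfanti : Antitone fun i => (g i + i).toNat := fun i j hij =>
    Int.toNat_le_toNat (hanti hij)
  refine ⟨ofRows (fun i => (g i + i).toNat) hfanti L', ?_⟩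
  have hlevel : ∀ i, level (ofRows (fun i => (g i + i).toNat) hfanti L') i = g i := fun i => by
    rw [level, rowLen_ofRows hfanti fun i hi => by simp [hg2 i hi], Int.toNat_of_nonneg (hnonneg i)]
    ring
  refine eq_of_mem_iff fun n => ?_
  rw [mem_toMaya, ha.mem_iff]
  simp only [hlevel]
  constructor
  · rintro ⟨i, rfl⟩
    rcases lt_or_ge i L' with h | h
    · exact Or.inr ⟨⟨i, h⟩, hg1 i h⟩
    · left; rw [hg2 i h]; omega
  · rintro (h | ⟨i, rfl⟩)
    · exact ⟨(-n).toNat, by rw [hg2 _ (by omega)]; omega⟩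
    · exact ⟨i, hg1 i i.2⟩

/-! ### Principal specialisations -/

theorem qpow_add (ħ a b : ℂ) : qpow ħ (a + b) = qpow ħ a * qpow ħ b := by
  simp only [qpow, mul_add, Complex.exp_add]

theorem qpow_ne_zero (ħ a : ℂ) : qpow ħ a ≠ 0 := Complex.exp_ne_zero _

theorem qpow_zero (ħ : ℂ) : qpow ħ 0 = 1 := by simp [qpow]

theorem qpow_pow (ħ a : ℂ) (n : ℕ) : qpow ħ a ^ n = qpow ħ (n * a) := by
  simp only [qpow, ← Complex.exp_nat_mul]
  congr 1; ring

theorem qpow_sum {ι : Type*} (ħ : ℂ) (s : Finset ι) (f : ι → ℂ) :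
    qpow ħ (∑ i ∈ s, f i) = ∏ i ∈ s, qpow ħ (f i) := by
  simp only [qpow, Finset.mul_sum, Complex.exp_sum]

section
variable {ħ : ℂ}

/-- The power sums `q^{k/2} / (1 - q^k)` of the alphabet `q^{-ρ}`. -/
def powerSumNegRho (ħ : ℂ) (k : ℕ+) : ℂ := qpow ħ ((k : ℂ) / 2) / (1 - qpow ħ (k : ℂ))

theorem one_sub_qpow_ne_zero (hq : ∀ k : ℕ+, qpow ħ 1 ^ (k : ℕ) ≠ 1) (k : ℕ+) :
    1 - qpow ħ ((k : ℕ) : ℂ) ≠ 0 := by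
  have := hq k
  rw [qpow_pow, mul_one] at this
  exact sub_ne_zero.2 (Ne.symm this)

/-- `h_n(q^{-ρ})`. -/
def hNegRho (ħ : ℂ) (n : ℕ) : ℂ := PowerSeries.coeff n (completeSeries (powerSumNegRho ħ))

/-- `h_n(q^ρ)`. -/
def hRho (ħ : ℂ) (n : ℕ) : ℂ := PowerSeries.coeff n (completeSeries (powerSumRho ħ ⊥))

theorem hNegRho_zero : hNegRho ħ 0 = 1 := by
  rw [hNegRho, PowerSeries.coeff_zero_eq_constantCoeff_apply, constantCoeff_completeSeries]

theorem hRho_zero : hRho ħ 0 = 1 := by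
  rw [hRho, PowerSeries.coeff_zero_eq_constantCoeff_apply, constantCoeff_completeSeries]

theorem coeff_succ_one_sub_mul (y : ℂ) (F : PowerSeries ℂ) (n : ℕ) :
    PowerSeries.coeff (n + 1) ((1 - PowerSeries.C y * PowerSeries.X) * F)
      = PowerSeries.coeff (n + 1) F - y * PowerSeries.coeff n F := by
  rw [sub_mul, one_mul, map_sub, mul_assoc, PowerSeries.coeff_C_mul, PowerSeries.coeff_succ_X_mul]

theorem hNegRho_succ (hq : ∀ k : ℕ+, qpow ħ 1 ^ (k : ℕ) ≠ 1) (n : ℕ) :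
    (1 - qpow ħ ((n : ℂ) + 1)) * hNegRho ħ (n + 1) = qpow ħ (1 / 2) * hNegRho ħ n := by
  -- `H(z) = H(qz) / (1 - q^{1/2} z)`
  have hp : powerSumNegRho ħ
      = fun k : ℕ+ => qpow ħ 1 ^ (k : ℕ) * powerSumNegRho ħ k + qpow ħ (1 / 2) ^ (k : ℕ) := by
    funext k
    have h := one_sub_qpow_ne_zero hq k
    rw [qpow_pow, qpow_pow, powerSumNegRho, mul_one, mul_one_div]
    field_simp
    ring
  have h1 : (1 - PowerSeries.C (qpow ħ (1 / 2)) * PowerSeries.X)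
      * completeSeries (powerSumNegRho ħ)
      = PowerSeries.rescale (qpow ħ 1) (completeSeries (powerSumNegRho ħ)) := by
    conv_lhs => rw [hp, completeSeries_add, mul_left_comm, one_sub_mul_completeSeries, mul_one,
      completeSeries_pow_mul]
  have h2 := congrArg (PowerSeries.coeff (n + 1)) h1
  rw [coeff_succ_one_sub_mul, PowerSeries.coeff_rescale, qpow_pow] at h2
  simp only [hNegRho]
  push_cast at h2
  rw [mul_one] at h2
  linear_combination h2

theorem hNegRho_ne_zero (hq : ∀ k : ℕ+, qpow ħ 1 ^ (k : ℕ) ≠ 1) (n : ℕ) : hNegRho ħ n ≠ 0 := by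
  induction n with
  | zero => rw [hNegRho_zero]; exact one_ne_zero
  | succ n ih =>
    intro h
    have := hNegRho_succ hq n
    rw [h, mul_zero, eq_comm, mul_eq_zero] at this
    exact this.elim (qpow_ne_zero _ _) ih

theorem powerSumRho_bot (k : ℕ+) :
    powerSumRho ħ ⊥ k = qpow ħ (-1 / 2) ^ (k : ℕ) / (1 - qpow ħ (-1) ^ (k : ℕ)) := by
  simp only [powerSumRho, colLen_bot, Finset.range_zero, Finset.sum_empty, Nat.cast_zero, neg_zero,
    zero_add]
  norm_num

theorem one_sub_qpow_neg_ne_zero (hq : ∀ k : ℕ+, qpow ħ 1 ^ (k : ℕ) ≠ 1) (k : ℕ+) :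
    1 - qpow ħ (-1) ^ (k : ℕ) ≠ 0 := by
  intro h
  refine hq k ?_
  have h1 : qpow ħ 1 ^ (k : ℕ) * qpow ħ (-1) ^ (k : ℕ) = 1 := by
    rw [← mul_pow, ← qpow_add]; simp [qpow_zero]
  rwa [← sub_eq_zero.1 h, mul_one] at h1

/-- `H(qz) = H(z) / (1 - q^{1/2} z)` for the alphabet `q^ρ`. -/
theorem rescale_completeSeries_rho (hq : ∀ k : ℕ+, qpow ħ 1 ^ (k : ℕ) ≠ 1) :
    PowerSeries.rescale (qpow ħ 1) (completeSeries (powerSumRho ħ ⊥))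
      = completeSeries (powerSumRho ħ ⊥)
        * completeSeries (fun k : ℕ+ => qpow ħ (1 / 2) ^ (k : ℕ)) := by
  rw [← completeSeries_pow_mul, ← completeSeries_add]
  congr 1
  funext k
  have h := one_sub_qpow_neg_ne_zero hq k
  have h1 : qpow ħ 1 ^ (k : ℕ) * qpow ħ (-1) ^ (k : ℕ) = 1 := by
    rw [← mul_pow, ← qpow_add]; simp [qpow_zero]
  have h2 : qpow ħ 1 ^ (k : ℕ) * qpow ħ (-1 / 2) ^ (k : ℕ) = qpow ħ (1 / 2) ^ (k : ℕ) := by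
    rw [← mul_pow, ← qpow_add]; norm_num
  have h3 : qpow ħ (1 / 2) ^ (k : ℕ) * qpow ħ (-1) ^ (k : ℕ) = qpow ħ (-1 / 2) ^ (k : ℕ) := by
    rw [← mul_pow, ← qpow_add]; norm_num
  rw [powerSumRho_bot, ← mul_div_assoc, h2, div_add' _ _ _ h, ← h3]
  congr 1
  ring

theorem hRho_succ (hq : ∀ k : ℕ+, qpow ħ 1 ^ (k : ℕ) ≠ 1) (n : ℕ) :
    (1 - qpow ħ ((n : ℂ) + 1)) * hRho ħ (n + 1) = -(qpow ħ ((n : ℂ) + 1 / 2) * hRho ħ n) := by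
  have h1 := rescale_completeSeries_rho hq
  have h2 := congrArg (fun F => PowerSeries.coeff (n + 1)
    ((1 - PowerSeries.C (qpow ħ (1 / 2)) * PowerSeries.X) * F)) h1
  rw [mul_left_comm, one_sub_mul_completeSeries, mul_one, coeff_succ_one_sub_mul,
    PowerSeries.coeff_rescale, PowerSeries.coeff_rescale, qpow_pow, qpow_pow, mul_one, mul_one,
    ← mul_assoc, ← qpow_add, add_comm (1 / 2 : ℂ)] at h2
  simp only [hRho]
  push_cast at h2
  linear_combination -h2

theorem hRho_eq (hq : ∀ k : ℕ+, qpow ħ 1 ^ (k : ℕ) ≠ 1) (n : ℕ) :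
    hRho ħ n = (-1) ^ n * qpow ħ ((n : ℂ) * (n - 1) / 2) * hNegRho ħ n := by
  induction n with
  | zero => simp [hRho_zero, hNegRho_zero, qpow_zero]
  | succ n ih =>
    have h0 : 1 - qpow ħ ((n : ℂ) + 1) ≠ 0 := by
      have := one_sub_qpow_ne_zero hq n.succPNat
      rw [Nat.succPNat_coe] at this
      push_cast at this
      exact this
    refine mul_left_cancel₀ h0 ?_
    have h1 := hNegRho_succ hq n
    rw [hRho_succ hq, ih]
    have e : qpow ħ (((n + 1 : ℕ) : ℂ) * ((n + 1 : ℕ) - 1) / 2) * qpow ħ (1 / 2)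
        = qpow ħ ((n : ℂ) + 1 / 2) * qpow ħ ((n : ℂ) * (n - 1) / 2) := by
      rw [← qpow_add, ← qpow_add]
      congr 1
      push_cast; ring
    rw [pow_succ]
    linear_combination (-1) ^ n * qpow ħ (((n + 1 : ℕ) : ℂ) * ((n + 1 : ℕ) - 1) / 2) * h1
      + (-1) ^ n * hNegRho ħ n * e

/-- The generating series of `h_n` in the alphabet `q^ρ` together with `q^{a+1/2}`. -/
def hookSeries (ħ : ℂ) (a : ℕ) : PowerSeries ℂ :=
  completeSeries (powerSumRho ħ ⊥) * completeSeries fun k : ℕ+ => qpow ħ ((a : ℂ) + 1 / 2) ^ (k : ℕ)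

theorem coeff_succ_hookSeries (a b : ℕ) :
    PowerSeries.coeff (b + 1) (hookSeries ħ a)
      = qpow ħ ((a : ℂ) + 1 / 2) * PowerSeries.coeff b (hookSeries ħ a) + hRho ħ (b + 1) := by
  have h : (1 - PowerSeries.C (qpow ħ ((a : ℂ) + 1 / 2)) * PowerSeries.X) * hookSeries ħ a
      = completeSeries (powerSumRho ħ ⊥) := by
    rw [hookSeries, mul_left_comm, one_sub_mul_completeSeries, mul_one]
  have := congrArg (PowerSeries.coeff (b + 1)) h
  rw [coeff_succ_one_sub_mul] at this
  rw [hRho, ← this]; ring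

theorem rescale_hookSeries (hq : ∀ k : ℕ+, qpow ħ 1 ^ (k : ℕ) ≠ 1) (a : ℕ) :
    (1 - PowerSeries.C (qpow ħ (1 / 2)) * PowerSeries.X)
      * PowerSeries.rescale (qpow ħ 1) (hookSeries ħ a) = hookSeries ħ (a + 1) := by
  rw [hookSeries, map_mul, rescale_completeSeries_rho hq, ← completeSeries_pow_mul, ← mul_assoc,
    mul_left_comm, one_sub_mul_completeSeries, mul_one, hookSeries]
  congr 2
  funext k
  rw [← mul_pow, ← qpow_add]
  congr 2
  push_cast; ring

theorem coeff_hookSeries_zero (hq : ∀ k : ℕ+, qpow ħ 1 ^ (k : ℕ) ≠ 1) (b : ℕ) :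
    PowerSeries.coeff b (hookSeries ħ 0) = qpow ħ b * hRho ħ b := by
  rw [hookSeries, Nat.cast_zero, zero_add, ← rescale_completeSeries_rho hq,
    PowerSeries.coeff_rescale, qpow_pow, mul_one, hRho]

theorem coeff_succ_hookSeries_succ (hq : ∀ k : ℕ+, qpow ħ 1 ^ (k : ℕ) ≠ 1) (a b : ℕ) :
    PowerSeries.coeff (b + 1) (hookSeries ħ (a + 1))
      = -(qpow ħ ((b : ℂ) + 1 / 2) * (1 - qpow ħ ((a : ℂ) + 1))
          * PowerSeries.coeff b (hookSeries ħ a)) + qpow ħ ((b : ℂ) + 1) * hRho ħ (b + 1) := by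
  have h := congrArg (PowerSeries.coeff (b + 1)) (rescale_hookSeries hq a)
  rw [coeff_succ_one_sub_mul, PowerSeries.coeff_rescale, PowerSeries.coeff_rescale, qpow_pow,
    qpow_pow, coeff_succ_hookSeries] at h
  push_cast at h
  rw [mul_one, mul_one] at h
  have e1 : qpow ħ ((b : ℂ) + 1 / 2) = qpow ħ (1 / 2) * qpow ħ b := by
    rw [← qpow_add]; congr 1; ring
  have e2 : qpow ħ ((b : ℂ) + 1) * qpow ħ ((a : ℂ) + 1 / 2)
      = qpow ħ (1 / 2) * qpow ħ b * qpow ħ ((a : ℂ) + 1) := by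
    rw [← qpow_add, ← qpow_add, ← qpow_add]; congr 1; ring
  rw [← h, e1]
  linear_combination PowerSeries.coeff b (hookSeries ħ a) * e2

/-- `∑_{c ≥ 0} h_{a-c} h_{b-c}` in the alphabet `q^{-ρ}`. -/
def hookGram (ħ : ℂ) (a b : ℕ) : ℂ :=
  ∑ u ∈ Finset.range (a + 1), schurOne (powerSumNegRho ħ) ((a : ℤ) - u)
    * schurOne (powerSumNegRho ħ) ((b : ℤ) - u)

theorem schurOne_powerSumNegRho (n : ℕ) : schurOne (powerSumNegRho ħ) (n : ℤ) = hNegRho ħ n :=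
  schurOne_natCast _ n

theorem hookGram_zero_left (b : ℕ) : hookGram ħ 0 b = hNegRho ħ b := by
  simp [hookGram, schurOne_powerSumNegRho, schurOne_zero]

theorem hookGram_zero_right (a : ℕ) : hookGram ħ a 0 = hNegRho ħ a := by
  rw [hookGram, Finset.sum_eq_single 0]
  · simp [schurOne_powerSumNegRho, schurOne_zero]
  · intro u _ hu
    rw [schurOne_of_neg _ (show ((0 : ℕ) : ℤ) - u < 0 by omega), mul_zero]
  · simp

theorem hookGram_succ_succ (a b : ℕ) :
    hookGram ħ (a + 1) (b + 1) = hookGram ħ a b + hNegRho ħ (a + 1) * hNegRho ħ (b + 1) := by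
  rw [hookGram, Finset.sum_range_succ', hookGram]
  refine congrArg₂ (· + ·) (Finset.sum_congr rfl fun u _ => ?_) ?_
  · push_cast
    rw [add_sub_add_right_eq_sub, add_sub_add_right_eq_sub]
  · rw [Nat.cast_zero, sub_zero, sub_zero, schurOne_powerSumNegRho, schurOne_powerSumNegRho]

/-- The rational-function identity behind the symmetry of the vertex: up to factors depending on
`a` or `b` only, `h_b(q^ρ, q^{a+1/2})` is the symmetric expression `∑_c h_{a-c} h_{b-c}` in
`q^{-ρ}`. -/
theorem coeff_hookSeries (hq : ∀ k : ℕ+, qpow ħ 1 ^ (k : ℕ) ≠ 1) (a b : ℕ) :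
    PowerSeries.coeff b (hookSeries ħ a) * hNegRho ħ a
      = (-1) ^ b * qpow ħ ((b : ℂ) * (b + 1) / 2) * hookGram ħ a b := by
  have hb : ∀ b : ℕ, qpow ħ b * hRho ħ b
      = (-1) ^ b * qpow ħ ((b : ℂ) * (b + 1) / 2) * hNegRho ħ b := fun b => by
    have e : qpow ħ ((b : ℂ) * (b + 1) / 2) = qpow ħ b * qpow ħ ((b : ℂ) * (b - 1) / 2) := by
      rw [← qpow_add]; congr 1; ring
    rw [hRho_eq hq, e]; ring
  induction a generalizing b with
  | zero => rw [coeff_hookSeries_zero hq, hb, hNegRho_zero, mul_one, hookGram_zero_left]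
  | succ a ih =>
    rcases b with _ | b
    · rw [PowerSeries.coeff_zero_eq_constantCoeff_apply, hookSeries, map_mul,
        constantCoeff_completeSeries, constantCoeff_completeSeries, hookGram_zero_right]
      simp [qpow_zero]
    · have h1 := hNegRho_succ hq a
      have h2 := hb (b + 1)
      have h3 := ih b
      have e1 : qpow ħ ((b : ℂ) + 1 / 2) * qpow ħ (1 / 2) = qpow ħ ((b : ℂ) + 1) := by
        rw [← qpow_add]; congr 1; ring
      have e2 : qpow ħ (((b + 1 : ℕ) : ℂ) * ((b + 1 : ℕ) + 1) / 2)
          = qpow ħ ((b : ℂ) + 1) * qpow ħ ((b : ℂ) * (b + 1) / 2) := by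
        rw [← qpow_add]; congr 1; push_cast; ring
      rw [coeff_succ_hookSeries_succ hq, hookGram_succ_succ]
      rw [e2] at h2 ⊢
      push_cast at h2
      rw [pow_succ] at h2 ⊢
      linear_combination (-qpow ħ ((b : ℂ) + 1 / 2) * PowerSeries.coeff b (hookSeries ħ a)) * h1
        - PowerSeries.coeff b (hookSeries ħ a) * hNegRho ħ a * e1
        + hNegRho ħ (a + 1) * h2 - qpow ħ ((b : ℂ) + 1) * h3

end

/-! ### The two-leg vertex as a Fock space matrix element -/

section
variable {ħ : ℂ}

theorem completeSeries_sum {ι : Type*} (s : Finset ι) (y : ι → ℂ) :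
    completeSeries (fun k : ℕ+ => ∑ i ∈ s, y i ^ (k : ℕ))
      = ∏ i ∈ s, completeSeries fun k : ℕ+ => y i ^ (k : ℕ) := by
  classical
  induction s using Finset.induction_on with
  | empty => simpa using completeSeries_zero
  | insert a s ha ih =>
    simp only [Finset.sum_insert ha, Finset.prod_insert ha]
    rw [completeSeries_add, ih]

/-- The power sums of `q^{ν+ρ}`, with the tail of the alphabet split off after `L` variables. -/
theorem powerSumRho_eq (hq : ∀ k : ℕ+, qpow ħ 1 ^ (k : ℕ) ≠ 1) (ν : YoungDiagram) {L : ℕ}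
    (hL : ν.colLen 0 ≤ L) (k : ℕ+) : powerSumRho ħ ν k
      = ∑ i ∈ Finset.range L, qpow ħ ((ν.rowLen i : ℂ) - ((i : ℂ) + 1) + 1 / 2) ^ (k : ℕ)
        + qpow ħ (-L) ^ (k : ℕ) * powerSumRho ħ ⊥ k := by
  have hk := one_sub_qpow_neg_ne_zero hq k
  induction L, hL using Nat.le_induction with
  | base =>
    rw [powerSumRho_bot, powerSumRho, ← mul_div_assoc, ← mul_pow, ← qpow_add]
    congr 4
    ring
  | succ L hL ih =>
    rw [ih, Finset.sum_range_succ, add_assoc, rowLen_eq_zero hL]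
    congr 1
    rw [powerSumRho_bot, ← mul_div_assoc, ← mul_div_assoc, ← mul_pow, ← mul_pow, ← qpow_add,
      ← qpow_add, eq_comm, add_div' _ _ _ hk, mul_sub, ← mul_pow, ← qpow_add]
    congr 1
    have e1 : ((0 : ℕ) : ℂ) - ((L : ℂ) + 1) + 1 / 2 = -L + -1 / 2 := by push_cast; ring
    have e2 : -(L : ℂ) + -1 / 2 + -1 = -((L + 1 : ℕ) : ℂ) + -1 / 2 := by push_cast; ring
    rw [e1, e2]
    ring

theorem coeff_mul_polynomial (p : ℕ+ → ℂ) (N : Polynomial ℂ) {L : ℕ} (hN : N.natDegree < L)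
    (n : ℕ) : PowerSeries.coeff n (completeSeries p * (N : PowerSeries ℂ))
      = ∑ r ∈ Finset.range L, schurOne p ((n : ℤ) - r) * N.coeff r := by
  have h0 : ∀ r, L ≤ r → N.coeff r = 0 := fun r hr =>
    Polynomial.coeff_eq_zero_of_natDegree_lt (hN.trans_le hr)
  rw [PowerSeries.coeff_mul, ← Finset.Nat.sum_antidiagonal_swap,
    Finset.Nat.sum_antidiagonal_eq_sum_range_succ_mk]
  have h1 : ∀ m : ℕ, (∀ r : ℕ, m ≤ r → schurOne p ((n : ℤ) - r) * N.coeff r = 0) →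
      ∑ r ∈ Finset.range m, schurOne p ((n : ℤ) - r) * N.coeff r
        = ∑ r ∈ Finset.range (max L n.succ), schurOne p ((n : ℤ) - r) * N.coeff r := by
    intro m hm
    have h2 : ∀ M : ℕ, m ≤ M → ∑ r ∈ Finset.range m, schurOne p ((n : ℤ) - r) * N.coeff r
        = ∑ r ∈ Finset.range M, schurOne p ((n : ℤ) - r) * N.coeff r := fun M hM =>
      Finset.sum_subset (Finset.range_mono hM) fun r _ hr => hm r (by simpa using hr)
    rcases le_total m (max L n.succ) with h | h
    · exact h2 _ h
    · refine (Finset.sum_subset (Finset.range_mono h) fun r _ hr => ?_).symm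
      rw [Finset.mem_range, not_lt] at hr
      rw [h0 r ((le_max_left _ _).trans hr), mul_zero]
  rw [h1 L fun r hr => by rw [h0 r hr, mul_zero], ← h1 n.succ fun r hr => by
    rw [schurOne_of_neg p (by omega), zero_mul]]
  refine Finset.sum_congr rfl fun r hr => ?_
  rw [Finset.mem_range] at hr
  rw [show (n : ℤ) - r = ((n - r : ℕ) : ℤ) by omega, schurOne_natCast]
  simp

/-- The polynomial `∏_{i ≠ k} (1 - y_i z)`. -/
def complementPoly {L : ℕ} (y : Fin L → ℂ) (k : Fin L) : Polynomial ℂ :=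
  ∏ i ∈ Finset.univ.erase k, (1 - Polynomial.C (y i) * Polynomial.X)

theorem natDegree_complementPoly_lt {L : ℕ} (y : Fin L → ℂ) (k : Fin L) :
    (complementPoly y k).natDegree < L := by
  have h1 : (complementPoly y k).natDegree ≤ ∑ i ∈ Finset.univ.erase k, 1 :=
    (Polynomial.natDegree_prod_le _ _).trans (Finset.sum_le_sum fun i _ => by
      refine (Polynomial.natDegree_sub_le _ _).trans ?_
      simp only [Polynomial.natDegree_one, zero_le, sup_of_le_right]
      exact (Polynomial.natDegree_C_mul_le _ _).trans Polynomial.natDegree_X_le)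
  have h2 := k.2
  rw [Finset.sum_const, smul_eq_mul, mul_one, Finset.card_erase_of_mem (Finset.mem_univ k),
    Finset.card_univ, Fintype.card_fin] at h1
  omega

theorem prod_mul_complementPoly {L : ℕ} (y : Fin L → ℂ) (k : Fin L) :
    (∏ i, completeSeries fun n : ℕ+ => y i ^ (n : ℕ)) * (complementPoly y k : PowerSeries ℂ)
      = completeSeries fun n : ℕ+ => y k ^ (n : ℕ) := by
  rw [complementPoly, ← Polynomial.coeToPowerSeries.ringHom_apply, map_prod,
    ← Finset.mul_prod_erase _ _ (Finset.mem_univ k), mul_assoc, ← Finset.prod_mul_distrib,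
    Finset.prod_eq_one, mul_one]
  intro i _
  rw [mul_comm]
  have : Polynomial.coeToPowerSeries.ringHom (1 - Polynomial.C (y i) * Polynomial.X)
      = 1 - PowerSeries.C (y i) * PowerSeries.X := by simp
  rw [this, one_sub_mul_completeSeries]

/-- The exponents `ν_i + L - 1 - i`. -/
def shiftedRow (L : ℕ) (ν : YoungDiagram) (i : Fin L) : ℕ := ν.rowLen i + (L - 1 - i)

/-- The scalar `q^{-Lb} (-1)^b q^{b(b+1)/2}`. -/
def rowFactor (ħ : ℂ) (L b : ℕ) : ℂ := (-1) ^ b * qpow ħ ((b : ℂ) * (b + 1) / 2 - L * b)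

/-- The bialternant argument: the Jacobi–Trudi matrix of `s_ν(q^{μ+ρ})` times a matrix which does
not depend on `ν` is, up to scalings of rows and columns, the matrix of the `hookGram`s. -/
theorem schur_mul_det (hq : ∀ k : ℕ+, qpow ħ 1 ^ (k : ℕ) ≠ 1) (μ : YoungDiagram) {L : ℕ}
    (hμ : μ.colLen 0 ≤ L) : ∃ D : ℂ, ∀ ν : YoungDiagram, ν.colLen 0 ≤ L →
      schur ν (powerSumRho ħ μ) * D
        = (∏ i, rowFactor ħ L (shiftedRow L ν i)) * Matrix.det (Matrix.of fun i k : Fin L =>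
            hookGram ħ (shiftedRow L μ k) (shiftedRow L ν i)) := by
  set y : Fin L → ℂ := fun i => qpow ħ ((μ.rowLen i : ℂ) - ((i : ℂ) + 1) + 1 / 2) with hy
  set p := powerSumRho ħ μ
  set E : Matrix (Fin L) (Fin L) ℂ :=
    Matrix.of fun j k => (complementPoly y k).coeff (L - 1 - j) with hE
  have hprod : ∀ k, completeSeries p * (complementPoly y k : PowerSeries ℂ)
      = PowerSeries.rescale (qpow ħ (-L)) (hookSeries ħ (shiftedRow L μ k)) := by
    intro k
    have hp : p = fun n : ℕ+ => ∑ i ∈ Finset.univ, y i ^ (n : ℕ)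
        + qpow ħ (-L) ^ (n : ℕ) * powerSumRho ħ ⊥ n := by
      funext n
      rw [show p n = _ from powerSumRho_eq hq μ hμ n, Finset.sum_range]
    rw [hp, completeSeries_add, completeSeries_sum, completeSeries_pow_mul, mul_right_comm,
      prod_mul_complementPoly, hookSeries, map_mul, mul_comm, ← completeSeries_pow_mul _ fun n =>
        qpow ħ _ ^ (n : ℕ)]
    congr 2
    funext n
    rw [← mul_pow, ← qpow_add, hy]
    congr 2
    have : ((L - 1 - (k : ℕ) : ℕ) : ℂ) = L - 1 - k := by
      have := k.2
      rw [Nat.cast_sub (by omega), Nat.cast_sub (by omega), Nat.cast_one]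
    rw [shiftedRow, Nat.cast_add, this]
    ring_nf
  have hmul : ∀ ν : YoungDiagram, (Matrix.of fun i j : Fin L =>
      schurOne p ((ν.rowLen i : ℤ) - (i : ℤ) + (j : ℤ))) * E
      = Matrix.of fun i k => rowFactor ħ L (shiftedRow L ν i) * ((hNegRho ħ (shiftedRow L μ k))⁻¹
          * hookGram ħ (shiftedRow L μ k) (shiftedRow L ν i)) := by
    intro ν
    ext i k
    have h1 := coeff_mul_polynomial p (complementPoly y k) (natDegree_complementPoly_lt y k)
      (shiftedRow L ν i)
    rw [hprod, PowerSeries.coeff_rescale, ← Finset.sum_range_reflect, Finset.sum_range] at h1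
    have h2 := coeff_hookSeries hq (shiftedRow L μ k) (shiftedRow L ν i)
    have h3 := hNegRho_ne_zero hq (shiftedRow L μ k)
    rw [Matrix.mul_apply, Matrix.of_apply]
    trans qpow ħ (-L) ^ shiftedRow L ν i
      * PowerSeries.coeff (shiftedRow L ν i) (hookSeries ħ (shiftedRow L μ k))
    · rw [h1]
      refine Finset.sum_congr rfl fun j _ => ?_
      rw [Matrix.of_apply, hE, Matrix.of_apply]
      congr 2
      have := i.2
      have := j.2
      rw [shiftedRow]
      omega
    · rw [← mul_div_cancel_right₀ (PowerSeries.coeff _ _) h3, h2, rowFactor, sub_eq_add_neg,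
        qpow_add, qpow_pow, mul_neg, mul_comm (L : ℂ)]
      ring
  have hA : ∏ k, (hNegRho ħ (shiftedRow L μ k))⁻¹ ≠ 0 :=
    Finset.prod_ne_zero_iff.2 fun k _ => inv_ne_zero (hNegRho_ne_zero hq _)
  refine ⟨E.det / ∏ k, (hNegRho ħ (shiftedRow L μ k))⁻¹, fun ν hν => ?_⟩
  rw [schur_eq_det ν p hν, ← mul_div_assoc, ← Matrix.det_mul, hmul, div_eq_iff hA, mul_assoc,
    mul_comm (Matrix.det _), ← Matrix.det_mul_row, ← Matrix.det_mul_column]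
  congr 1

theorem pairing_comm {B : Type*} [CommRing B] (x y : FockOver B) : pairing x y = pairing y x := by
  refine fock_congr (f := pairing.flip y) (g := pairing y) fun T _ => ?_
  rw [LinearMap.flip_apply, ket_pairing]
  refine fock_congr (f := Finsupp.lapply T) (g := pairing.flip (ketOver B T)) fun U _ => ?_
  rw [LinearMap.flip_apply, ket_pairing, Finsupp.lapply_apply]
  classical
  simp only [Finsupp.single_apply, eq_comm]

/-- The matrix element `⟨μ| Γ₋(q^{-ρ}) Γ₊(q^{-ρ}) |ν⟩`. -/
def gram (ħ : ℂ) (μ ν : YoungDiagram) : ℂ :=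
  pairing (currentExpEnd (fun k : ℕ+ => powerSumNegRho ħ k / (k : ℕ)) (ketOver ℂ (toMaya μ)))
    (currentExpEnd (fun k : ℕ+ => powerSumNegRho ħ k / (k : ℕ)) (ketOver ℂ (toMaya ν)))

theorem gram_comm (μ ν : YoungDiagram) : gram ħ μ ν = gram ħ ν μ := pairing_comm _ _

theorem gram_bot_bot : gram ħ ⊥ ⊥ = 1 := by
  rw [gram, toMaya_bot, vac_eq_base, currentExpEnd_ket_base, ket_pairing]
  simp

theorem gram_eq_det (μ ν : YoungDiagram) {L : ℕ} (hμ : μ.colLen 0 ≤ L) (hν : ν.colLen 0 ≤ L) :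
    gram ħ μ ν = Matrix.det (Matrix.of fun i k : Fin L =>
      hookGram ħ (shiftedRow L μ k) (shiftedRow L ν i)) := by
  rw [gram, pairing_currentExpEnd (p := powerSumNegRho ħ) (fun k => ?_) (isComplete_schurOne _)
    (isListing_toMaya μ hμ).ket_eq (isListing_toMaya ν hν).ket_eq, ← Matrix.det_transpose]
  · congr 1
    ext i k
    rw [Matrix.transpose_apply, Matrix.of_apply, Matrix.of_apply, hookGram]
    have hlev : ∀ (ν : YoungDiagram) (i : Fin L), level ν i = (shiftedRow L ν i : ℤ) - L + 1 := by
      intro ν i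
      have := i.2
      rw [level, shiftedRow]; omega
    refine (Finset.sum_bij (fun (u : ℕ) _ => (u : ℤ) - L + 1) (fun u hu => ?_)
      (fun u _ v _ h => by omega) (fun u hu => ?_) fun u _ => ?_).symm
    · rw [Finset.mem_range] at hu
      rw [Finset.mem_Ioc, hlev]; omega
    · rw [Finset.mem_Ioc, hlev] at hu
      refine ⟨(u + L - 1).toNat, ?_, by omega⟩
      rw [Finset.mem_range]; omega
    · rw [hlev, hlev]
      congr 2 <;> ring
  · have : ((k : ℕ) : ℂ) ≠ 0 := by exact_mod_cast k.ne_zero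
    field_simp

/-- The sign `(-1)^{|ν|}`. -/
def sizeSign (B : Type*) [CommRing B] (ν : YoungDiagram) : B :=
  ∏ i ∈ Finset.range (ν.colLen 0), (-1) ^ ν.rowLen i

theorem prod_rowFactor (ν : YoungDiagram) {L : ℕ} (hν : ν.colLen 0 ≤ L) :
    ∏ i, rowFactor ħ L (shiftedRow L ν i)
      = sizeSign ℂ ν * qpow ħ ((kappa ν : ℂ) / 2) * ∏ i, rowFactor ħ L (shiftedRow L ⊥ i) := by
  have hfac : ∀ i : Fin L, rowFactor ħ L (shiftedRow L ν i)
      = (-1) ^ ν.rowLen i * qpow ħ ((ν.rowLen i : ℂ) * ((ν.rowLen i : ℂ) - 2 * ((i : ℂ) + 1) + 1) / 2)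
        * rowFactor ħ L (shiftedRow L ⊥ i) := by
    intro i
    have hi : ((L - 1 - (i : ℕ) : ℕ) : ℂ) = L - 1 - i := by
      have := i.2
      rw [Nat.cast_sub (by omega), Nat.cast_sub (by omega), Nat.cast_one]
    rw [rowFactor, rowFactor, shiftedRow, shiftedRow, rowLen_bot, zero_add, pow_add,
      mul_mul_mul_comm, ← qpow_add]
    congr 2
    push_cast
    rw [hi]
    ring
  rw [Finset.prod_congr rfl fun i _ => hfac i, Finset.prod_mul_distrib, Finset.prod_mul_distrib,
    Fin.prod_univ_eq_prod_range (fun i => (-1 : ℂ) ^ ν.rowLen i), Fin.prod_univ_eq_prod_range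
    (fun i => qpow ħ ((ν.rowLen i : ℂ) * ((ν.rowLen i : ℂ) - 2 * ((i : ℂ) + 1) + 1) / 2))]
  have hsub : ∀ f : ℕ → ℂ, (∀ i, ν.colLen 0 ≤ i → f i = 1) →
      ∏ i ∈ Finset.range L, f i = ∏ i ∈ Finset.range (ν.colLen 0), f i := fun f hf =>
    (Finset.prod_subset (Finset.range_mono hν) fun i _ hi => hf i (by simpa using hi)).symm
  rw [hsub _ fun i hi => by rw [rowLen_eq_zero hi, pow_zero], hsub _ fun i hi => by
    rw [rowLen_eq_zero hi]; simp [qpow_zero], ← qpow_sum, ← Finset.sum_div, sizeSign, kappa]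
  push_cast
  rfl

theorem schur_bot {B : Type*} [CommRing B] [Algebra ℂ B] (p : ℕ+ → B) : schur ⊥ p = 1 := by
  rw [schur_eq_det ⊥ p (L := 0) (by simp [colLen_bot])]
  exact Matrix.det_fin_zero

/-- `s_ν(q^{μ+ρ}) ⟨μ|Γ₋Γ₊|0⟩ = (-1)^{|ν|} q^{κ(ν)/2} ⟨μ|Γ₋Γ₊|ν⟩`. -/
theorem schur_powerSumRho_mul_gram (hq : ∀ k : ℕ+, qpow ħ 1 ^ (k : ℕ) ≠ 1) (μ ν : YoungDiagram) :
    schur ν (powerSumRho ħ μ) * gram ħ μ ⊥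
      = sizeSign ℂ ν * qpow ħ ((kappa ν : ℂ) / 2) * gram ħ μ ν := by
  set L := max (μ.colLen 0) (ν.colLen 0)
  have hμ : μ.colLen 0 ≤ L := le_max_left _ _
  have hν : ν.colLen 0 ≤ L := le_max_right _ _
  have h0 : (⊥ : YoungDiagram).colLen 0 ≤ L := by simp [colLen_bot]
  obtain ⟨D, hD⟩ := schur_mul_det hq μ hμ
  have h1 := hD ν hν
  have h2 := hD ⊥ h0
  rw [← gram_eq_det μ ν hμ hν, prod_rowFactor ν hν] at h1
  rw [← gram_eq_det μ ⊥ hμ h0, schur_bot, one_mul] at h2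
  have hne : ∏ i, rowFactor ħ L (shiftedRow L ⊥ i) ≠ 0 :=
    Finset.prod_ne_zero_iff.2 fun i _ => mul_ne_zero (by simp) (qpow_ne_zero _ _)
  refine mul_right_cancel₀ hne ?_
  rw [h2] at h1
  linear_combination h1

/-- The two-leg vertex: `𝓦_{μν} = (-1)^{|μ|+|ν|} q^{(κ(μ)+κ(ν))/2} ⟨μ|Γ₋Γ₊|ν⟩`. -/
theorem vertexW_eq (hq : ∀ k : ℕ+, qpow ħ 1 ^ (k : ℕ) ≠ 1) (μ ν : YoungDiagram) :
    vertexW ħ μ ν = sizeSign ℂ μ * qpow ħ ((kappa μ : ℂ) / 2) * (sizeSign ℂ ν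
      * qpow ħ ((kappa ν : ℂ) / 2)) * gram ħ μ ν := by
  have h1 := schur_powerSumRho_mul_gram hq ⊥ μ
  have h2 := schur_powerSumRho_mul_gram hq μ ν
  rw [gram_bot_bot, mul_one, gram_comm] at h1
  rw [vertexW, h1]
  linear_combination sizeSign ℂ μ * qpow ħ ((kappa μ : ℂ) / 2) * h2

end

/-! ### The operator `q^{aK}` -/

section
variable {B : Type*} [CommRing B]

open Classical in
theorem create_annihilate_self (n : ℤ) (T : Maya) :
    create n (annihilate n (ketOver B T)) = if n ∈ T.occ then ketOver B T else 0 := by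
  split_ifs with h
  · rw [annihilate_ket h, map_smul, create_ket (by simp), add_remove h, signOver_remove_of_le h le_rfl,
      smul_smul, signOver_mul_self, one_smul]
  · rw [annihilate_ket_of_notMem h, map_zero]

end

open Classical in
/-- `K` is diagonal; its eigenvalue is the sum of `(n - 1/2)²` over the particles minus that over
the holes. -/
theorem K_apply (S T : Maya) :
    K S T = if S = T then weight (fun n : ℤ => ((n : ℂ) - 1 / 2) ^ 2) S else 0 := by
  have hterm : ∀ n : ℤ, normalOrdered n n (ket T) S
      = ((if n ∈ T.occ then 1 else 0) - if n ≤ 0 then 1 else 0) * ketOver ℂ T S := by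
    intro n
    rw [normalOrdered_apply, create_annihilate_self, create_annihilate_self]
    have : n ∈ vac.occ ↔ n ≤ 0 := Iff.rfl
    simp only [this]
    split_ifs <;> simp
  simp only [K, hterm]
  split_ifs with h
  · subst h
    rw [finsum_eq_sum_of_support_subset
      (s := S.finite_particles.toFinset ∪ S.finite_holes.toFinset), Finset.sum_union, weight,
      sub_eq_add_neg, ← Finset.sum_neg_distrib]
    · refine congrArg₂ _ (Finset.sum_congr rfl fun n hn => ?_)
        (Finset.sum_congr rfl fun n hn => ?_)
      · have h : n ∈ S.occ ∧ 0 < n := by simpa using hn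
        simp [h.1, not_le.2 h.2]
      · have h : n ∉ S.occ ∧ n ≤ 0 := by simpa using hn
        simp [h.1, h.2]
    · rw [Finset.disjoint_left]
      intro n hn hn'
      have h : n ∈ S.occ ∧ 0 < n := by simpa using hn
      have h' : n ∉ S.occ ∧ n ≤ 0 := by simpa using hn'
      exact h'.1 h.1
    · intro n hn
      by_contra hc
      refine hn ?_
      have h : (n ∈ S.occ → n ≤ 0) ∧ (n ≤ 0 → n ∈ S.occ) := by
        simp only [Finset.coe_union, Set.Finite.coe_toFinset, Set.mem_union, Set.mem_ofPred_eq] at hc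
        push Not at hc
        exact ⟨hc.1, fun h1 => by by_contra h2; exact absurd h1 (by simpa using hc.2 h2)⟩
      have h2 : n ∈ S.occ ↔ n ≤ 0 := ⟨h.1, h.2⟩
      simp [h2]
  · rw [show ketOver ℂ T S = 0 from Finsupp.single_eq_of_ne h]
    simp

open Classical in
theorem opPow_of_diagonal {M : Op ℂ} {d : Maya → ℂ} (hM : ∀ S T, M S T = if S = T then d S else 0)
    (j : ℕ) (S T : Maya) : opPow M j S T = if S = T then d S ^ j else 0 := by
  induction j generalizing S with
  | zero => simp [opPow, Matrix.one_apply]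
  | succ j ih =>
    rw [opPow, opMul, tsum_eq_single S]
    · rw [hM, if_pos rfl, ih, pow_succ']
      split_ifs <;> simp
    · intro U hU
      rw [hM, if_neg hU.symm, zero_mul]

theorem weight_sq_toMaya (ν : YoungDiagram) :
    weight (fun n : ℤ => ((n : ℂ) - 1 / 2) ^ 2) (toMaya ν) = (kappa ν : ℂ) := by
  rw [weight_toMaya, kappa]
  push_cast
  refine Finset.sum_congr rfl fun i _ => ?_
  rw [level]
  push_cast
  ring

open Classical in
theorem qK_apply (ħ a : ℂ) (S T : Maya) : qK ħ a S T
    = if S = T then qpow ħ (a * weight (fun n : ℤ => ((n : ℂ) - 1 / 2) ^ 2) S) else 0 := by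
  have hM : ∀ S T, ((Complex.I * ħ * a) • K) S T = if S = T then Complex.I * ħ * a
      * weight (fun n : ℤ => ((n : ℂ) - 1 / 2) ^ 2) S else 0 := fun S T => by
    rw [Matrix.smul_apply, K_apply, smul_eq_mul]
    split_ifs <;> simp
  simp only [qK, opExp, opPow_of_diagonal hM]
  split_ifs with h
  · rw [qpow, Complex.exp_eq_exp_ℂ, NormedSpace.exp_eq_tsum ℂ, ← mul_assoc]
  · simp

theorem opMul_qK_left (ħ a : ℂ) (N : Op ℂ) (ν : YoungDiagram) (T : Maya) :
    opMul (qK ħ a) N (toMaya ν) T = qpow ħ (a * kappa ν) * N (toMaya ν) T := by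
  classical
  rw [opMul, tsum_eq_single (toMaya ν)]
  · rw [qK_apply, if_pos rfl, weight_sq_toMaya]
  · intro U hU
    rw [qK_apply, if_neg hU.symm, zero_mul]

theorem opMul_qK_right (ħ a : ℂ) (M : Op ℂ) (S : Maya) (ν : YoungDiagram) :
    opMul M (qK ħ a) S (toMaya ν) = M S (toMaya ν) * qpow ħ (a * kappa ν) := by
  classical
  rw [opMul, tsum_eq_single (toMaya ν)]
  · rw [qK_apply, if_pos rfl, weight_sq_toMaya]
  · intro U hU
    rw [qK_apply, if_neg hU, mul_zero]

theorem pairing_eq_tsum (x y : FockOver ℂ) : ∑' U, x U * y U = pairing x y := by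
  rw [tsum_eq_sum (s := x.support), pairing, Finsupp.linearCombination_apply, Finsupp.sum,
    LinearMap.sum_apply]
  · rfl
  · intro U hU
    rw [Finsupp.notMem_support_iff.1 hU, zero_mul]

theorem GammaRhoCont_eq (ε : ℤˣ) (ħ : ℂ) :
    GammaRhoCont ε ħ = currentExp ε fun k : ℕ+ => powerSumNegRho ħ k / (k : ℕ) := by
  rw [GammaRhoCont]
  congr 1
  funext k
  rw [powerSumNegRho, div_div, mul_comm]

/-- The matrix elements of `h` between charge zero states. -/
theorem hCont_apply (τ ħ : ℂ) (μ ν : YoungDiagram) : hCont τ ħ (toMaya μ) (toMaya ν)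
    = qpow ħ ((τ + 1) / 2 * kappa μ) * gram ħ μ ν * qpow ħ ((τ⁻¹ + 1) / 2 * kappa ν) := by
  rw [hCont, hWith, opMul_qK_right]
  congr 1
  rw [opMul]
  simp only [opMul_qK_left, mul_assoc]
  rw [tsum_mul_left, gram, ← pairing_eq_tsum, GammaRhoCont_eq, GammaRhoCont_eq]
  congr 1
  exact tsum_congr fun U => by rw [currentExp_neg_one_apply, currentExp_one_apply]

/-! ### The exponentials of the formal currents on the vacuum -/

section
variable {B : Type*} [CommRing B] [Algebra ℂ B]

/-- Changing the sign of the `p_k` with `k` odd multiplies `S_ν` by `(-1)^{|ν|}`. -/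
theorem schur_neg_one_pow (ν : YoungDiagram) (p : ℕ+ → B) :
    schur ν (fun k => (-1) ^ (k : ℕ) * p k) = sizeSign B ν * schur ν p := by
  have h : ∀ i j : Fin (ν.colLen 0),
      schurOne (fun k => (-1) ^ (k : ℕ) * p k) ((ν.rowLen i : ℤ) - (i : ℤ) + (j : ℤ))
        = (-1) ^ (j : ℕ) * ((-1) ^ (ν.rowLen i + (i : ℕ))
          * schurOne p ((ν.rowLen i : ℤ) - (i : ℤ) + (j : ℤ))) := by
    intro i j
    rw [schurOne_pow_mul]
    rcases lt_or_ge ((ν.rowLen i : ℤ) - (i : ℤ) + (j : ℤ)) 0 with h | h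
    · rw [schurOne_of_neg _ h]; simp
    · rw [← mul_assoc, ← pow_add]
      congr 1
      refine neg_one_pow_congr ?_
      have : ((ν.rowLen i : ℤ) - (i : ℤ) + (j : ℤ)).toNat + 2 * (i : ℕ)
          = j + (ν.rowLen i + i) := by omega
      rw [← this]
      simp [Nat.even_add]
  rw [schur, schur, sizeSign]
  trans Matrix.det (Matrix.of fun i j : Fin (ν.colLen 0) => (-1) ^ (j : ℕ)
    * (Matrix.of fun i j : Fin (ν.colLen 0) => (-1) ^ (ν.rowLen i + (i : ℕ)) * (Matrix.of fun i j : Fin (ν.colLen 0) =>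
      schurOne p ((ν.rowLen i : ℤ) - (i : ℤ) + (j : ℤ))) i j) i j)
  · exact congrArg _ (Matrix.ext h)
  · rw [Matrix.det_mul_row, Matrix.det_mul_column, ← mul_assoc, ← Finset.prod_mul_distrib,
      Finset.prod_range fun i => (-1 : B) ^ ν.rowLen i]
    congr 1
    refine Finset.prod_congr rfl fun i _ => ?_
    rw [← pow_add]
    refine neg_one_pow_congr ?_
    simp only [Nat.even_add]
    tauto

/-- The coordinates of `exp (∑ (-1)^k p_k J_k / k)|ν⟩` along the vacuum. -/
theorem currentExpEnd_toMaya_vac (ν : YoungDiagram) (p : ℕ+ → B) :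
    currentExpEnd (fun k : ℕ+ => (((-1) ^ (k : ℕ) : ℂ) / (k : ℂ)) • p k) (ketOver B (toMaya ν)) vac
      = sizeSign B ν * schur ν p := by
  rw [← toMaya_bot, currentExpEnd_apply_eq_det (p := fun k => (-1) ^ (k : ℕ) * p k) (fun k => ?_)
    (isComplete_schurOne _) (isListing_toMaya ⊥ (L := ν.colLen 0) (by simp [colLen_bot])).ket_eq
    (isListing_toMaya ν le_rfl).ket_eq (isListing_toMaya ⊥ (by simp [colLen_bot])).lt,
    ← schur_neg_one_pow, schur]
  · congr 1
    ext i j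
    rw [Matrix.of_apply]
    congr 1
    simp [level, rowLen_bot]
  · have hk : ((k : ℕ) : ℂ) ≠ 0 := by exact_mod_cast k.ne_zero
    rw [← map_natCast (algebraMap ℂ B), ← Algebra.smul_def, smul_smul, mul_div_cancel₀ _ hk,
      Algebra.smul_def]
    simp

/-- Currents preserve the charge. -/
theorem exists_toMaya_of_currentExpEnd_ne_zero {t : ℕ+ → B} {T : Maya}
    (h : currentExpEnd t (ketOver B T) vac ≠ 0) : ∃ ν, toMaya ν = T := by
  refine exists_toMaya_eq ?_
  have := currentExpEnd_ne_zero h (P := fun S => weight (fun _ => (1 : ℤ)) S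
    = weight (fun _ => (1 : ℤ)) T) (fun U hU => by rw [ketOver_ne_zero hU]) fun k U V hV hk => by
      obtain ⟨n, hn⟩ := weight_of_current_ne_zero hk fun _ => (1 : ℤ)
      omega
  rw [← this, weight_vac]

end

/-! ### Convergence of the generating function -/

/-- The weight of a monomial, where `p_k` and `p̄_k` have weight `k`. -/
def monomialWeight (d : ℕ+ ⊕ ℕ+ →₀ ℕ) : ℤ :=
  d.sum fun i n => (n : ℤ) * (Sum.elim (fun k : ℕ+ => (k : ℤ)) (fun k : ℕ+ => (k : ℤ)) i)

theorem monomialWeight_add (d e : ℕ+ ⊕ ℕ+ →₀ ℕ) :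
    monomialWeight (d + e) = monomialWeight d + monomialWeight e :=
  Finsupp.sum_add_index' (by simp) fun i m n => by push_cast; ring

/-- All monomials of `f` have weight `m`; here `m` is an integer, and the zero series is homogeneous
of every weight. -/
def IsHomogeneous (m : ℤ) (f : Series) : Prop :=
  ∀ d, MvPowerSeries.coeff d f ≠ 0 → monomialWeight d = m

theorem isHomogeneous_zero (m : ℤ) : IsHomogeneous m 0 := fun _ hd => absurd (map_zero _) hd

theorem isHomogeneous_one : IsHomogeneous 0 1 := by
  classical
  intro d hd
  rw [MvPowerSeries.coeff_one] at hd
  rw [(ite_ne_right_iff.1 hd).1]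
  rfl

theorem isHomogeneous_pVar (k : ℕ+) : IsHomogeneous k (pVar k) := by
  classical
  intro d hd
  rw [pVar, MvPowerSeries.coeff_X] at hd
  rw [(ite_ne_right_iff.1 hd).1, monomialWeight]
  simp

theorem isHomogeneous_pBarVar (k : ℕ+) : IsHomogeneous k (pBarVar k) := by
  classical
  intro d hd
  rw [pBarVar, MvPowerSeries.coeff_X] at hd
  rw [(ite_ne_right_iff.1 hd).1, monomialWeight]
  simp

theorem IsHomogeneous.mul {m n : ℤ} {f g : Series} (hf : IsHomogeneous m f)
    (hg : IsHomogeneous n g) : IsHomogeneous (m + n) (f * g) := by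
  classical
  intro d hd
  rw [MvPowerSeries.coeff_mul] at hd
  obtain ⟨⟨a, b⟩, hab, h⟩ := Finset.exists_ne_zero_of_sum_ne_zero hd
  rw [Finset.HasAntidiagonal.mem_antidiagonal] at hab
  rw [← hab, monomialWeight_add, hf a (left_ne_zero_of_mul h), hg b (right_ne_zero_of_mul h)]

theorem IsHomogeneous.sum {ι : Type*} {s : Finset ι} {m : ℤ} {f : ι → Series}
    (hf : ∀ i ∈ s, IsHomogeneous m (f i)) : IsHomogeneous m (∑ i ∈ s, f i) := by
  intro d hd
  rw [map_sum] at hd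
  obtain ⟨i, hi, h⟩ := Finset.exists_ne_zero_of_sum_ne_zero hd
  exact hf i hi d h

theorem IsHomogeneous.prod {ι : Type*} {s : Finset ι} {m : ι → ℤ} {f : ι → Series}
    (hf : ∀ i ∈ s, IsHomogeneous (m i) (f i)) : IsHomogeneous (∑ i ∈ s, m i) (∏ i ∈ s, f i) := by
  classical
  induction s using Finset.induction_on with
  | empty => exact isHomogeneous_one
  | insert i s hi ih =>
    rw [Finset.sum_insert hi, Finset.prod_insert hi]
    exact (hf i (Finset.mem_insert_self _ _)).mul
      (ih fun j hj => hf j (Finset.mem_insert_of_mem hj))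

theorem IsHomogeneous.smul {m : ℤ} {f : Series} (hf : IsHomogeneous m f) (c : ℂ) :
    IsHomogeneous m (c • f) := fun d hd => hf d fun h => hd (by rw [map_smul, h, smul_zero])

theorem IsHomogeneous.of_smul {m : ℤ} {f : Series} {c : ℂ} (hc : c ≠ 0)
    (hf : IsHomogeneous m (c • f)) : IsHomogeneous m f := fun d hd => hf d (by
  rw [map_smul]
  exact smul_ne_zero hc hd)

theorem isHomogeneous_schurOne {p : ℕ+ → Series} (hp : ∀ k : ℕ+, IsHomogeneous k (p k)) (m : ℤ) :
    IsHomogeneous m (schurOne p m) := by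
  rcases lt_or_ge m 0 with hm | hm
  · rw [schurOne_of_neg _ hm]; exact isHomogeneous_zero m
  lift m to ℕ using hm
  induction m using Nat.strong_induction_on with
  | _ m ih =>
    rcases Nat.eq_zero_or_pos m with rfl | hm
    · rw [Nat.cast_zero, schurOne_zero]; exact isHomogeneous_one
    have hN := (isComplete_schurOne p).newton m ⟨m, hm⟩ (by simp)
    have hm0 : (m : ℂ) ≠ 0 := by exact_mod_cast hm.ne'
    refine IsHomogeneous.of_smul hm0 ?_
    rw [Algebra.smul_def, map_natCast, ← Int.cast_natCast (R := Series), hN]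
    refine IsHomogeneous.sum fun k hk => ?_
    have hk' : k ≤ ⟨m, hm⟩ := (Finset.mem_Icc.1 hk).2
    have hkm : (k : ℕ) ≤ m := hk'
    have h := (hp k).mul (ih (m - k) (by have := k.pos; omega))
    rw [Nat.cast_sub hkm] at h
    convert h using 1
    ring

/-- The number of boxes of a Young diagram. -/
def size (ν : YoungDiagram) : ℕ := ∑ i ∈ Finset.range (ν.colLen 0), ν.rowLen i

theorem isHomogeneous_schur {p : ℕ+ → Series} (hp : ∀ k : ℕ+, IsHomogeneous k (p k))
    (ν : YoungDiagram) : IsHomogeneous (size ν) (schur ν p) := by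
  refine (congrArg _ (Matrix.det_apply' _)).mpr ?_
  refine IsHomogeneous.sum fun σ _ => ?_
  have h := IsHomogeneous.prod (s := Finset.univ) fun (i : Fin (ν.colLen 0)) _ =>
    isHomogeneous_schurOne hp ((ν.rowLen (σ i) : ℤ) - ((σ i : Fin _) : ℤ) + (i : ℤ))
  have hs : ∑ i : Fin (ν.colLen 0), ((ν.rowLen (σ i) : ℤ) - ((σ i : Fin _) : ℤ) + (i : ℤ))
      = size ν := by
    rw [Finset.sum_add_distrib, Finset.sum_sub_distrib,
      Equiv.sum_comp σ fun i : Fin (ν.colLen 0) => (ν.rowLen i : ℤ),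
      Equiv.sum_comp σ fun i : Fin (ν.colLen 0) => (i : ℤ), sub_add_cancel, size, Finset.sum_range]
    push_cast
    rfl
  rw [hs] at h
  have h' := h.smul ((Equiv.Perm.sign σ : ℤ) : ℂ)
  rwa [Algebra.smul_def, map_intCast] at h'

theorem finite_size_le (n : ℕ) : {ν : YoungDiagram | size ν ≤ n}.Finite := by
  refine Set.Finite.of_finite_image (f := YoungDiagram.cells) (((Finset.range n ×ˢ
    Finset.range n).powerset.finite_toSet).subset ?_) fun μ _ ν _ h => YoungDiagram.ext h
  rintro _ ⟨ν, hν : size ν ≤ n, rfl⟩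
  rw [Finset.mem_coe, Finset.mem_powerset]
  rintro ⟨i, j⟩ hij
  rw [YoungDiagram.mem_cells] at hij
  have h1 := YoungDiagram.mem_iff_lt_rowLen.1 hij
  have hi : i < ν.colLen 0 := by
    by_contra h
    rw [rowLen_eq_zero (not_lt.1 h)] at h1
    omega
  have h2 : ν.rowLen i ≤ size ν :=
    Finset.single_le_sum (f := ν.rowLen) (fun _ _ => Nat.zero_le _) (Finset.mem_range.2 hi)
  have h3 : ν.colLen 0 ≤ size ν := by
    have := Finset.card_nsmul_le_sum (Finset.range (ν.colLen 0)) ν.rowLen 1 fun i hi => by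
      have := YoungDiagram.mem_iff_lt_rowLen.1
        (YoungDiagram.mem_iff_lt_colLen.2 (Finset.mem_range.1 hi))
      omega
    rw [Finset.card_range, smul_eq_mul, mul_one] at this
    exact this
  simp only [Finset.mem_product, Finset.mem_range]
  omega

theorem summable_of_isHomogeneous {ι : Type*} {f : ι → Series} {e : ι → ℤ}
    (hf : ∀ i, IsHomogeneous (e i) (f i)) (he : ∀ m, {i | e i = m}.Finite) : Summable f := by
  rw [MvPowerSeries.WithPiTopology.summable_iff_summable_coeff]
  intro d
  exact summable_of_hasFiniteSupport ((he (monomialWeight d)).subset fun i hi => (hf i d hi).symm)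

theorem summable_smul_schur_mul (c : YoungDiagram × YoungDiagram → ℂ) :
    Summable fun ν : YoungDiagram × YoungDiagram =>
      c ν • (schur ν.1 pVar * schur ν.2 pBarVar) := by
  refine summable_of_isHomogeneous (e := fun ν => (size ν.1 : ℤ) + size ν.2) (fun ν =>
    ((isHomogeneous_schur isHomogeneous_pVar ν.1).mul
      (isHomogeneous_schur isHomogeneous_pBarVar ν.2)).smul _) fun m => ?_
  refine ((finite_size_le m.toNat).prod (finite_size_le m.toNat)).subset fun ν hν => ?_
  have hν : (size ν.1 : ℤ) + size ν.2 = m := hν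
  refine Set.mem_prod.2 ⟨?_, ?_⟩ <;> simp only [Set.mem_ofPred_eq] <;> omega

theorem summable_smul_schur (c : YoungDiagram → ℂ) :
    Summable fun ν : YoungDiagram => c ν • schur ν pVar := by
  refine summable_of_isHomogeneous (e := fun ν => (size ν : ℤ)) (fun ν =>
    (isHomogeneous_schur isHomogeneous_pVar ν).smul _) fun m => ?_
  refine (finite_size_le m.toNat).subset fun ν hν => ?_
  have hν : (size ν : ℤ) = m := hν
  simp only [Set.mem_ofPred_eq]; omega

/-! ### The vacuum expectation value -/

theorem sizeSign_eq_algebraMap {B : Type*} [CommRing B] [Algebra ℂ B] (ν : YoungDiagram) :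
    sizeSign B ν = algebraMap ℂ B (sizeSign ℂ ν) := by
  simp [sizeSign]

theorem tsum_toMaya {f : Maya → Series} (hf : ∀ T, f T ≠ 0 → ∃ ν, toMaya ν = T) :
    ∑' T, f T = ∑' ν, f (toMaya ν) :=
  (toMaya_injective.tsum_eq fun T hT => hf T hT).symm

/-- Only the matrix elements of `h` between charge zero states contribute. -/
theorem vev_eq_tsum (h : Op ℂ) : vev h = ∑' ν : YoungDiagram × YoungDiagram,
    (sizeSign ℂ ν.1 * h (toMaya ν.1) (toMaya ν.2) * sizeSign ℂ ν.2) •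
      (schur ν.1 pVar * schur ν.2 pBarVar) := by
  have hA : ∀ T, opMul (currentExp 1 fun k : ℕ+ => (((-1) ^ (k : ℕ) : ℂ) / (k : ℂ)) • pVar k)
      (h.map (algebraMap ℂ Series)) vac T
        = ∑' ν : YoungDiagram, (sizeSign ℂ ν * h (toMaya ν) T) • schur ν pVar := by
    intro T
    simp only [opMul, currentExp_one_apply, Matrix.map_apply]
    rw [tsum_toMaya fun U hU => exists_toMaya_of_currentExpEnd_ne_zero (left_ne_zero_of_mul hU)]
    refine tsum_congr fun ν => ?_
    rw [currentExpEnd_toMaya_vac, Algebra.smul_def, map_mul, sizeSign_eq_algebraMap (B := Series)]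
    ring
  have h0 : vev h = ∑' T, (∑' ν : YoungDiagram, (sizeSign ℂ ν * h (toMaya ν) T) • schur ν pVar)
      * currentExpEnd (fun k : ℕ+ => (((-1) ^ (k : ℕ) : ℂ) / (k : ℂ)) • pBarVar k)
        (ketOver Series T) vac :=
    tsum_congr fun T => by rw [hA, currentExp_neg_one_apply]
  have hs := summable_smul_schur_mul fun ν =>
    sizeSign ℂ ν.1 * h (toMaya ν.1) (toMaya ν.2) * sizeSign ℂ ν.2
  rw [h0, tsum_toMaya fun U hU => exists_toMaya_of_currentExpEnd_ne_zero (right_ne_zero_of_mul hU),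
    ← (Equiv.prodComm YoungDiagram YoungDiagram).tsum_eq]
  have hfib : ∀ μ ν : YoungDiagram, (sizeSign ℂ ν * h (toMaya ν) (toMaya μ)) • schur ν pVar
      * (sizeSign Series μ * schur μ pBarVar) = (sizeSign ℂ ν * h (toMaya ν) (toMaya μ)
        * sizeSign ℂ μ) • (schur ν pVar * schur μ pBarVar) := fun μ ν => by
    rw [sizeSign_eq_algebraMap (B := Series), Algebra.smul_def, Algebra.smul_def,
      map_mul _ _ (sizeSign ℂ μ)]
    ring
  have hmul := fun μ : YoungDiagram => (summable_smul_schur fun ν =>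
    sizeSign ℂ ν * h (toMaya ν) (toMaya μ)).mul_right (sizeSign Series μ * schur μ pBarVar)
  simp only [hfib] at hmul
  refine Eq.trans ?_ (Summable.tsum_prod' ((Equiv.prodComm _ _).summable_iff.2 hs) hmul).symm
  refine tsum_congr fun μ => ?_
  rw [currentExpEnd_toMaya_vac, ← (summable_smul_schur fun ν =>
    sizeSign ℂ ν * h (toMaya ν) (toMaya μ)).tsum_mul_right]
  exact tsum_congr fun ν => hfib μ ν

theorem RBullet_eq_vev (τ : ℂ) {ħ : ℂ} (hq : ∀ k : ℕ+, qpow ħ 1 ^ (k : ℕ) ≠ 1) :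
    RBullet τ ħ = vev (hCont τ ħ) := by
  rw [vev_eq_tsum, RBullet]
  refine tsum_congr fun ν => ?_
  rw [rTerm, vertexW_eq hq, hCont_apply]
  congr 1
  have h1 : qpow ħ (((kappa ν.1 : ℂ) * τ + (kappa ν.2 : ℂ) * τ⁻¹) / 2) * qpow ħ ((kappa ν.1 : ℂ) / 2)
      * qpow ħ ((kappa ν.2 : ℂ) / 2)
      = qpow ħ ((τ + 1) / 2 * kappa ν.1) * qpow ħ ((τ⁻¹ + 1) / 2 * kappa ν.2) := by
    rw [← qpow_add, ← qpow_add, ← qpow_add]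
    congr 1
    ring
  linear_combination sizeSign ℂ ν.1 * sizeSign ℂ ν.2 * gram ħ ν.1 ν.2 * h1

/-! ### Infinite products of vertex operators -/

section
variable {B : Type*} [CommRing B] [Algebra ℂ B]

theorem shiftVec_shiftVec (p p' : ℕ+ → B) (b c : ℤ) :
    shiftVec b (schurOne p) (shiftVec b (schurOne p') (Finsupp.single c 1))
      = shiftVec b (schurOne fun k => p k + p' k) (Finsupp.single c 1) := by
  classical
  have hneg : ∀ (p : ℕ+ → B), ∀ m < 0, schurOne p m = 0 := fun p m hm => schurOne_of_neg _ hm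
  have hv : shiftVec b (schurOne p') (Finsupp.single c 1)
      = ∑ w ∈ Finset.Ioc b c, schurOne p' (c - w) • Finsupp.single w (1 : B) := by
    simp [shiftVec]
  ext u
  rw [hv, map_sum, Finsupp.finsetSum_apply, shiftVec_single_apply b (hneg _)]
  simp only [map_smul, Finsupp.smul_apply, smul_eq_mul, shiftVec_single_apply b (hneg p)]
  split_ifs with h
  · rw [show (fun k => p k + p' k) = fun k => p' k + p k from funext fun k => add_comm _ _,
      schurOne_add]
    refine (Finset.sum_subset (fun w hw => ?_) fun w hw hw' => ?_).symm
    · rw [Finset.mem_Icc] at hw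
      rw [Finset.mem_Ioc]
      omega
    · rw [Finset.mem_Icc] at hw'
      rw [Finset.mem_Ioc] at hw
      rw [hneg p _ (by omega), mul_zero]
  · simp

/-- The exponentials of currents form a one-parameter group in each `t_k`. -/
theorem currentExpEnd_currentExpEnd (t s : ℕ+ → B) (T : Maya) :
    currentExpEnd t (currentExpEnd s (ketOver B T))
      = currentExpEnd (fun k => t k + s k) (ketOver B T) := by
  obtain ⟨b, hb⟩ := T.exists_fills
  obtain ⟨L, a, ha⟩ := exists_wedge (B := B) hb
  have h : ∀ t : ℕ+ → B, ∀ k, (fun k : ℕ+ => ((k : ℕ) : B) * t k) k = ((k : ℕ) : B) * t k :=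
    fun _ _ => rfl
  rw [ha, currentExpEnd_wedge (h s) (isComplete_schurOne _),
    currentExpEnd_wedge (h t) (isComplete_schurOne _),
    currentExpEnd_wedge (h _) (isComplete_schurOne _)]
  simp only [shiftVec_shiftVec, mul_add]

theorem currentExpEnd_zero (T : Maya) :
    currentExpEnd (fun _ => 0) (ketOver B T) = ketOver B T := by
  have h : currentSum (fun _ => (0 : B)) = 0 := by
    refine fock_hom_ext fun T => ?_
    simp [currentSum]
  rw [currentExpEnd, Finsupp.linearCombination_single, one_smul, Finset.sum_range_succ', h]
  simp

end

section
variable {B : Type*} [CommRing B] [Algebra ℂ B] [TopologicalSpace B]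

theorem opMul_currentExp (ε : ℤˣ) (t s : ℕ+ → B) :
    opMul (currentExp ε t) (currentExp ε s) = currentExp ε fun k => t k + s k := by
  funext S T
  rcases Int.units_eq_one_or ε with rfl | rfl
  · rw [opMul_eq (currentExp_one_apply t) (currentExp_one_apply s), Module.End.mul_apply,
      currentExpEnd_currentExpEnd, currentExp_one_apply]
  · rw [currentExp_neg_one_apply, funext fun k => add_comm (t k) (s k),
      ← currentExpEnd_currentExpEnd, ← tsum_eq_apply]
    exact tsum_congr fun U => by
      rw [currentExp_neg_one_apply, currentExp_neg_one_apply, mul_comm]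

open Classical in
theorem currentExp_zero (ε : ℤˣ) : currentExp ε (fun _ => (0 : B)) = 1 := by
  funext S T
  rcases Int.units_eq_one_or ε with rfl | rfl
  · rw [currentExp_one_apply, currentExpEnd_zero, Matrix.one_apply, Finsupp.single_apply]
    simp only [eq_comm]
  · rw [currentExp_neg_one_apply, currentExpEnd_zero, Matrix.one_apply, Finsupp.single_apply]

end

theorem gammaPartial_eq (ε : ℤˣ) (x : ℕ → ℂ) (N : ℕ) : gammaPartial ε x N
    = currentExp ε fun k => ∑ i ∈ Finset.range N, x i ^ (k : ℕ) / (k : ℂ) := by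
  induction N with
  | zero => simp only [Finset.range_zero, Finset.sum_empty]; exact (currentExp_zero ε).symm
  | succ N ih =>
    rw [gammaPartial, ih, Gamma, opMul_currentExp]
    simp only [Finset.sum_range_succ]

theorem continuous_currentSum_pow (j : ℕ) (S T : Maya) :
    Continuous fun t : ℕ+ → ℂ => (currentSum t ^ j) (ketOver ℂ T) S := by
  induction j generalizing T with
  | zero => simp only [pow_zero, Module.End.one_apply]; exact continuous_const
  | succ j ih =>
    have h : ∀ t : ℕ+ → ℂ, (currentSum t ^ (j + 1)) (ketOver ℂ T) S
        = ∑ k ∈ Finset.Icc 1 (energy T).toNat.succPNat, t k *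
          ∑ U ∈ (current k (ketOver ℂ T)).support,
            (currentSum t ^ j) (ketOver ℂ U) S * current k (ketOver ℂ T) U := by
      intro t
      rw [pow_succ, Module.End.mul_apply, currentSum, Finsupp.linearCombination_single, one_smul,
        map_sum, Finsupp.finsetSum_apply]
      refine Finset.sum_congr rfl fun k _ => ?_
      rw [map_smul, Finsupp.smul_apply, smul_eq_mul, apply_eq_sum]
    simp only [h]
    exact continuous_finsetSum _ fun k _ => (continuous_apply k).mul
      (continuous_finsetSum _ fun U _ => (ih U).mul continuous_const)

theorem continuous_currentExpEnd (S T : Maya) :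
    Continuous fun t : ℕ+ → ℂ => currentExpEnd t (ketOver ℂ T) S := by
  simp only [currentExpEnd, Finsupp.linearCombination_single, one_smul, Finsupp.finsetSum_apply,
    Finsupp.smul_apply, smul_eq_mul]
  exact continuous_finsetSum _ fun j _ => continuous_const.mul (continuous_currentSum_pow j S T)

/-- The matrix elements of `exp (∑ t_k J_{εk})` are polynomials in finitely many `t_k`. -/
theorem continuous_currentExp (ε : ℤˣ) (S T : Maya) :
    Continuous fun t : ℕ+ → ℂ => currentExp ε t S T := by
  rcases Int.units_eq_one_or ε with rfl | rfl
  · simp only [currentExp_one_apply]; exact continuous_currentExpEnd S T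
  · simp only [currentExp_neg_one_apply]; exact continuous_currentExpEnd T S

theorem hasSum_qNegRho_pow {ħ : ℂ} (hq : ‖qpow ħ 1‖ < 1) (k : ℕ+) :
    HasSum (fun i => qNegRho ħ i ^ (k : ℕ)) (powerSumNegRho ħ k) := by
  have hk : qpow ħ (k : ℕ) = qpow ħ 1 ^ (k : ℕ) := by rw [qpow_pow, mul_one]
  have hlt : ‖qpow ħ (k : ℕ)‖ < 1 := by
    rw [hk, norm_pow]
    exact pow_lt_one₀ (norm_nonneg _) hq k.ne_zero
  have h := (hasSum_geometric_of_norm_lt_one hlt).mul_left (qpow ħ ((k : ℂ) / 2))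
  rw [← div_eq_mul_inv] at h
  refine h.congr_fun fun i => ?_
  rw [qNegRho, qpow_pow, qpow_pow, ← qpow_add]
  congr 1
  ring

theorem tendsto_gammaPartial {ħ : ℂ} (hq : ‖qpow ħ 1‖ < 1) (ε : ℤˣ) (S T : Maya) :
    Filter.Tendsto (fun N => gammaPartial ε (qNegRho ħ) N S T) Filter.atTop
      (𝓝 (GammaRhoCont ε ħ S T)) := by
  simp only [gammaPartial_eq, GammaRhoCont_eq]
  refine ((continuous_currentExp ε S T).tendsto _).comp (tendsto_pi_nhds.2 fun k => ?_)
  exact ((hasSum_qNegRho_pow hq k).div_const _).tendsto_sum_nat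

theorem GammaSeq_eq {ħ : ℂ} (hq : ‖qpow ħ 1‖ < 1) (ε : ℤˣ) :
    GammaSeq ε (qNegRho ħ) = GammaRhoCont ε ħ :=
  funext fun S => funext fun T => (tendsto_gammaPartial hq ε S T).limUnder_eq

end TwoPartition

theorem theorem3p3 (τ ħ : ℂ) (hτ : τ ≠ 0)
    (hq : ∀ k : ℕ+, TwoPartition.qpow ħ 1 ^ (k : ℕ) ≠ 1) :
    Summable (TwoPartition.rTerm τ ħ) ∧
    (‖TwoPartition.qpow ħ 1‖ < 1 →
      (∀ ε : ℤˣ, TwoPartition.IsGammaProd ε (TwoPartition.qNegRho ħ)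
        (TwoPartition.GammaSeq ε (TwoPartition.qNegRho ħ))) ∧
      TwoPartition.RBullet τ ħ = TwoPartition.vev (TwoPartition.hOp τ ħ)) ∧
    TwoPartition.RBullet τ ħ = TwoPartition.vev (TwoPartition.hCont τ ħ) := by
  refine ⟨TwoPartition.summable_smul_schur_mul _, fun h => ⟨fun ε S T => ?_, ?_⟩,
    TwoPartition.RBullet_eq_vev τ hq⟩
  · rw [TwoPartition.GammaSeq_eq h]
    exact TwoPartition.tendsto_gammaPartial h ε S T
  · rw [TwoPartition.hOp, TwoPartition.GammaSeq_eq h, TwoPartition.GammaSeq_eq h]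
    exact TwoPartition.RBullet_eq_vev τ hq
end
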